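/- Write $\|h\|_p$ for the norm of $L^p(\mathbb R^3)$ and, for $s\ge 0$, $\|h\|_{L^2_s(\mathbb R^3)}=\big(\int_{\mathbb R^3}(1+|\xi|^2)^{s}\,|\widehat h(\xi)|^2\,d\xi\big)^{1/2}$ with $\widehat h(\xi)=\int_{\mathbb R^3} h(x)e^{-2\pi i x\cdot\xi}\,dx$ (extended to $L^2$ by Plancherel), the norm being $\infty$ if $h\notin L^2$. Let $u,v$ be (complex-valued) solutions on $\mathbb R^3_x\times\mathbb R_t$ of $$u_{tt}=\Delta u,\quad u(x,0)=0,\quad u_t(x,0)=f(x),\qquad v_{tt}=\Delta v,\quad v(x,0)=0,\quad v_t(x,0)=g(x),$$ in the weak sense: $t\mapsto u(\cdot,t)$ is continuous into $L^1_{\rm loc}(\mathbb R^3)$, $u(\cdot,0)=0$ almost everywhere, and for each $\varphi\in C_c^\infty(\mathbb R^3)$ the function $t\mapsto\int u(x,t)\varphi(x)\,dx$ is twice differentiable with second derivative $\int u(x,t)\Delta\varphi(x)\,dx$, and with derivative $\int f\varphi\,dx$ at $t=0$; similarly for $v$ and $g$. (i) There are absolute constants $C,C'$ such that, for every $t\in\mathbb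 R$ and all such $u,v$ with $f,g\in L^2(\mathbb R^3)$, $$\|u(\cdot,t)v(\cdot,t)\|_{3}\le C\,\|u(\cdot,t)v(\cdot,t)\|_{L^2_{1/2}(\mathbb R^3)},\qquad \|u(\cdot,t)v(\cdot,t)\|_{L^2_{1/2}(\mathbb R^3)}\le C'(1+|t|)^{1/2}\,\|f\|_{2}\,\|g\|_{2},$$ and moreover, uniformly in $t$, $$\|u(\cdot,t)v(\cdot,t)\|_{3}\le C'\,\|f\|_{2}\,\|g\|_{2}.$$ (ii) For every $p$ with $5/3<p\le 2$ and every $t\in\mathbb R$ there is a constant $C_{p,t}$, depending only on $p$ and $t$, such that for all such $u,v$ with $f,g\in L^p(\mathbb R^3)$, $$\|u(\cdot,t)v(\cdot,t)\|_{p'}\le C_{p,t}\,\|f\|_{p}\,\|g\|_{p},\qquad p'=\frac{p}{p-1}.$$ -/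

import Mathlib

open MeasureTheory Filter Topology
open scoped ENNReal NNReal ContDiff FourierTransform Laplacian

/-- Physical space `ℝ³` with its Euclidean norm and Lebesgue measure. -/
abbrev R3 : Type := EuclideanSpace ℝ (Fin 3)

/-- `u` is a (weak) solution on `ℝ × ℝ³` of the Cauchy problem
`u_tt = Δ u`, `u(·, 0) = 0`, `u_t(·, 0) = f`:
`u` is continuous in time with values in `L¹_loc(ℝ³)`, and for every test function `φ` the pairing
`t ↦ ⟨u(t), φ⟩` is twice differentiable with second derivative `⟨u(t), Δφ⟩`, and its derivative
at `t = 0` is `⟨f, φ⟩`. Here `u t x` is the value at time `t` and position `x`. Every classical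
`C²` solution is a solution in this sense. -/
structure IsWaveSolution (f : R3 → ℂ) (u : ℝ → R3 → ℂ) : Prop where
  locallyIntegrable : ∀ t, LocallyIntegrable (u t) volume
  continuous_L1loc : ∀ K : Set R3, IsCompact K → ∀ t₀ : ℝ,
    Tendsto (fun t => ∫⁻ x in K, ‖u t x - u t₀ x‖ₑ) (𝓝 t₀) (𝓝 0)
  initial_position : u 0 =ᵐ[volume] 0
  weak_equation : ∀ φ : R3 → ℝ, ContDiff ℝ ∞ φ → HasCompactSupport φ →
    ∃ w : ℝ → ℂ,
      (∀ t, HasDerivAt (fun s => ∫ x, u s x * (φ x : ℂ)) (w t) t) ∧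
      (∀ t, HasDerivAt w (∫ x, u t x * ((Δ φ) x : ℂ)) t) ∧
      w 0 = ∫ x, f x * (φ x : ℂ)

/-- The norm of the inhomogeneous Sobolev space `L²_s(ℝ³)`, for an order `s ≥ 0`:
the `L²` norm of `(1 + |ξ|²)^(s/2) ĥ(ξ)`, where `ĥ` is the Fourier transform (with kernel
`exp (-2πi x·ξ)`) on `L²`. It is `∞` when `h` is not in `L²`. -/
noncomputable def sobolevNorm (s : ℝ) (h : R3 → ℂ) : ℝ≥0∞ :=
  ⨅ hh : MemLp h 2 volume,
    eLpNorm (fun ξ : R3 => (((1 + ‖ξ‖ ^ 2) ^ (s / 2) : ℝ) : ℂ) * (𝓕 (hh.toLp h)) ξ) 2 volume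

/-! Every weak solution is given by Kirchhoff's formula (`IsWaveSolution.ae_eq_wave`): `u(t)` is `t`
times the mean of `f` over spheres of radius `|t|`, that is, the Fourier multiplier with symbol
`σ(ξ) = sin(2πt|ξ|)/(2π|ξ|)`. This follows by pairing `u(s)` with the Kirchhoff solution at time `τ`
issued from a test function: the pairing solves the one-dimensional wave equation in `(s, τ)`, and
d'Alembert's argument reads off `⟨u(T), φ⟩`. Everything else concerns the one operator `wave`.

(i) The transform of `uv` is the convolution of `σ f̂` and `σ ĝ`. By Cauchy–Schwarz its weighted
`L²` norm is controlled by `‖f‖₂ ‖g‖₂` and `sup_ξ w(ξ) ∫ |σ(η) σ(ξ-η)|² dη`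
(`lintegral_weight_conv_sq_le`). From `|σ(η)| ≤ 1/|η|` and `∫ |η|⁻² |ξ-η|⁻² dη ≤ C/|ξ|`, the weight
`w = |ξ|` is admissible uniformly in `t`; from `|σ| ≤ min(|t|, 1/|η|)`, which gives `∫ σ⁴ ≤ C|t|`,
the weight `w = 1` costs a factor `|t|`. So the homogeneous half-derivative norm of `uv` is bounded
uniformly in time, only its `L²` norm grows, and the homogeneous Sobolev inequality `sobolev_three`
yields the uniform `L³` bound.

(ii) By Hölder it suffices that `wave t` maps `L^p` to `L^q` with `q = 2p'`. For spherical averages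
`A` of indicators there are two level set bounds: `|{A 1_E ≥ l}| ≤ |E|/l`, and `|{A 1_E ≥ l}| ≤
C|E|³/l⁴` (`measure_le_avg_le_pow`). The second uses the one derivative gained by `σ`: `A 1_E` is
`L²`-close to its mean over small balls, and that mean is small pointwise. Interpolating the level
sets, integrating in `l` and summing a dyadic decomposition of `f` gives `L^p → L^q` for `q ≥ 4` and
`p < q < 3p`. For `q = 2p'` the condition `q < 3p` is exactly `p > 5/3`. -/

/-! ### Uniform measure on the sphere, Archimedes' theorem and the Fourier transform. -/

/-- The uniform probability measure on the unit sphere of `ℝ³`, as a measure on `ℝ³`. -/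
noncomputable def sph : Measure R3 :=
  (ProbabilityTheory.cond volume (Metric.ball (0 : R3) 1)).map fun y => ‖y‖⁻¹ • y

lemma volume_ball_one_R3 : volume (Metric.ball (0 : R3) 1) = ENNReal.ofReal (Real.pi * 4 / 3) := by
  simp [EuclideanSpace.volume_ball_fin_three]

lemma measurable_normalize : Measurable fun y : R3 => ‖y‖⁻¹ • y := by fun_prop

instance : IsProbabilityMeasure (ProbabilityTheory.cond volume (Metric.ball (0 : R3) 1)) :=
  ProbabilityTheory.cond_isProbabilityMeasure_of_finite
    (by rw [volume_ball_one_R3]; simp; positivity) (by rw [volume_ball_one_R3]; simp)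

instance : IsProbabilityMeasure sph :=
  Measure.isProbabilityMeasure_map measurable_normalize.aemeasurable

lemma sph_ae_norm : ∀ᵐ θ ∂sph, ‖θ‖ = 1 := by
  rw [sph, ae_map_iff measurable_normalize.aemeasurable
    (measurableSet_eq_fun (by fun_prop) (by fun_prop))]
  have h : ∀ᵐ y ∂(volume : Measure R3), y ≠ 0 := by
    rw [ae_iff]; simp
  have h2 := (ProbabilityTheory.cond_absolutelyContinuous
    (μ := (volume : Measure R3)) (s := Metric.ball 0 1)).ae_le h
  filter_upwards [h2] with y hy
  rw [norm_smul, norm_inv, norm_norm, inv_mul_cancel₀ (norm_ne_zero_iff.2 hy)]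

lemma sph_map_isometry (L : R3 ≃ₗᵢ[ℝ] R3) : sph.map L = sph := by
  have hL : MeasurePreserving L volume volume := L.measurePreserving
  have h1 : (ProbabilityTheory.cond volume (Metric.ball (0 : R3) 1)).map L
      = ProbabilityTheory.cond volume (Metric.ball (0 : R3) 1) := by
    rw [ProbabilityTheory.cond, Measure.map_smul]
    congr 1
    have h2 := hL.restrict_preimage (s := Metric.ball (0 : R3) 1) measurableSet_ball
    have h3 : L ⁻¹' Metric.ball (0 : R3) 1 = Metric.ball 0 1 := by
      ext x; simp
    rw [h3] at h2
    exact h2.map_eq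
  rw [sph, Measure.map_map L.continuous.measurable measurable_normalize]
  conv_rhs => rw [← h1, Measure.map_map measurable_normalize L.continuous.measurable]
  congr 1
  ext1 y
  simp

lemma sph_map_neg : sph.map (fun θ => -θ) = sph :=
  sph_map_isometry (LinearIsometryEquiv.neg ℝ)

lemma volume_sq_norm_lt (r : ℝ) :
    volume {w : EuclideanSpace ℝ (Fin 2) | ‖w‖ ^ 2 < r} = ENNReal.ofReal (Real.pi * r) := by
  have h : {w : EuclideanSpace ℝ (Fin 2) | ‖w‖ ^ 2 < r} = Metric.ball 0 (√r) := by
    ext w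
    simp [Real.lt_sqrt (norm_nonneg w)]
  rw [h, EuclideanSpace.volume_ball_fin_two, ← ENNReal.ofReal_pow (Real.sqrt_nonneg _),
    ← ENNReal.ofReal_mul (by positivity)]
  rcases le_total 0 r with hr | hr
  · rw [Real.sq_sqrt hr, mul_comm]
  · rw [Real.sqrt_eq_zero_of_nonpos hr, ENNReal.ofReal_of_nonpos (p := Real.pi * r)
      (mul_nonpos_of_nonneg_of_nonpos Real.pi_pos.le hr)]
    simp

/-- Splitting `ℝ³` into the component along a unit vector and the orthogonal plane. -/
lemma exists_measurePreserving_split (e : R3) (he : ‖e‖ = 1) :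
    ∃ Φ : R3 → ℝ × EuclideanSpace ℝ (Fin 2), MeasurePreserving Φ volume volume ∧
      ∀ y, (Φ y).1 = inner ℝ e y ∧ ‖y‖ ^ 2 = (Φ y).1 ^ 2 + ‖(Φ y).2‖ ^ 2 := by
  obtain ⟨b, hb⟩ := Orthonormal.exists_orthonormalBasis_extension_of_card_eq (𝕜 := ℝ)
    (E := R3) (ι := Fin 3) (by simp) (v := fun _ => e) (s := {0}) (by
      rw [orthonormal_iff_ite]
      rintro ⟨i, hi⟩ ⟨j, hj⟩
      simp only [Set.mem_singleton_iff] at hi hj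
      subst hi; subst hj
      simp [he])
  have hb0 : b 0 = e := hb 0 rfl
  let Φ : R3 → ℝ × EuclideanSpace ℝ (Fin 2) :=
    Prod.map id (MeasurableEquiv.toLp 2 (Fin 2 → ℝ)) ∘
      MeasurableEquiv.piFinSuccAbove (fun _ : Fin 3 => ℝ) 0 ∘
      (MeasurableEquiv.toLp 2 (Fin 3 → ℝ)).symm ∘ b.repr
  refine ⟨Φ, ?_, fun y => ?_⟩
  · have h1 := b.measurePreserving_repr
    have h2 := EuclideanSpace.volume_preserving_symm_measurableEquiv_toLp (Fin 3)
    have h3 := volume_preserving_piFinSuccAbove (fun _ : Fin 3 => ℝ) 0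
    have h4 := (EuclideanSpace.volume_preserving_symm_measurableEquiv_toLp (Fin 2)).symm
    exact (((MeasurePreserving.id volume).prod h4).comp h3).comp (h2.comp h1)
  · have h0 : (Φ y).1 = b.repr y 0 := rfl
    have h1 : ∀ i, (Φ y).2 i = b.repr y i.succ := fun i => rfl
    constructor
    · rw [h0, b.repr_apply_apply, hb0]
    · rw [← b.repr.norm_map y, EuclideanSpace.norm_sq_eq, EuclideanSpace.norm_sq_eq,
        Fin.sum_univ_succ, h0]
      simp [h1]

/-- The integrand is the area of a slice, at height `z`, of the part of the unit ball inside the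
double cone `c‖y‖ < |z|`. Ball and cone bound the squared radius by the two terms of the minimum,
which cross at `|z| = c`. -/
lemma lintegral_min_quadratic {c : ℝ} (hc : 0 < c) (hc1 : c ≤ 1) :
    ∫⁻ z : ℝ, ENNReal.ofReal (Real.pi * min (1 - z ^ 2) ((1 - c ^ 2) / c ^ 2 * z ^ 2))
      = ENNReal.ofReal (Real.pi * 4 / 3 * (1 - c)) := by
  set κ := (1 - c ^ 2) / c ^ 2 with hκ
  have hκ0 : 0 ≤ κ := by
    rw [hκ]; apply div_nonneg _ (by positivity); nlinarith
  set F : ℝ → ℝ := fun z => Real.pi * min (1 - z ^ 2) (κ * z ^ 2) with hF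
  have hFc : Continuous F := by fun_prop
  have hsupp : ∀ z, z ∉ Set.Ioc (-1 : ℝ) 1 → ENNReal.ofReal (F z) = 0 := by
    intro z hz
    rw [ENNReal.ofReal_eq_zero]
    have : 1 - z ^ 2 ≤ 0 := by
      simp only [Set.mem_Ioc, not_and_or, not_lt, not_le] at hz
      rcases hz with hz | hz <;> nlinarith
    exact mul_nonpos_of_nonneg_of_nonpos Real.pi_pos.le ((min_le_left _ _).trans this)
  have h1 : ∫⁻ z, ENNReal.ofReal (F z) = ∫⁻ z in Set.Ioc (-1 : ℝ) 1, ENNReal.ofReal (F z) := by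
    rw [← lintegral_indicator measurableSet_Ioc]
    congr 1; ext z
    by_cases hz : z ∈ Set.Ioc (-1 : ℝ) 1
    · simp [hz]
    · rw [hsupp z hz]; simp [hz]
  rw [h1, ← ofReal_integral_eq_lintegral_ofReal, ← intervalIntegral.integral_of_le (by norm_num)]
  · congr 1
    have hint : ∀ a b, IntervalIntegrable F volume a b := fun a b => hFc.intervalIntegrable a b
    have heven : ∫ z in (-1 : ℝ)..0, F z = ∫ z in (0 : ℝ)..1, F z := by
      have := intervalIntegral.integral_comp_neg (a := (0 : ℝ)) (b := 1) F
      simp only [neg_zero] at this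
      rw [← this]
      congr 1; ext z; simp [hF]
    rw [← intervalIntegral.integral_add_adjacent_intervals (hint (-1) 0) (hint 0 1), heven,
      ← intervalIntegral.integral_add_adjacent_intervals (hint 0 c) (hint c 1)]
    have hcc : κ * c ^ 2 = 1 - c ^ 2 := by rw [hκ]; field_simp
    have ha : ∫ z in (0 : ℝ)..c, F z = ∫ z in (0 : ℝ)..c, Real.pi * (κ * z ^ 2) := by
      apply intervalIntegral.integral_congr
      intro z hz
      rw [Set.uIcc_of_le hc.le] at hz
      simp only [hF]
      congr 1
      apply min_eq_right
      have : z ^ 2 ≤ c ^ 2 := by nlinarith [hz.1, hz.2]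
      nlinarith
    have hb : ∫ z in c..1, F z = ∫ z in c..1, Real.pi * (1 - z ^ 2) := by
      apply intervalIntegral.integral_congr
      intro z hz
      rw [Set.uIcc_of_le hc1] at hz
      simp only [hF]
      congr 1
      apply min_eq_left
      have : c ^ 2 ≤ z ^ 2 := by nlinarith [hz.1, hz.2]
      nlinarith
    rw [ha, hb]
    have hb2 : ∫ z in c..1, Real.pi * (1 - z ^ 2) = Real.pi * ((1 - c) - (1 - c ^ 3) / 3) := by
      rw [intervalIntegral.integral_const_mul, intervalIntegral.integral_sub (by simp) (by simp)]
      simp [integral_pow]; norm_num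
    have ha2 : ∫ z in (0 : ℝ)..c, Real.pi * (κ * z ^ 2) = Real.pi * (κ * (c ^ 3 / 3)) := by
      rw [intervalIntegral.integral_const_mul, intervalIntegral.integral_const_mul]
      simp [integral_pow]; norm_num
    rw [ha2, hb2]
    have : κ * (c ^ 3 / 3) = (1 - c ^ 2) * c / 3 := by rw [← hcc]; ring
    rw [this]; ring
  · exact (hFc.integrableOn_Icc (a := -1) (b := 1)).mono_set Set.Ioc_subset_Icc_self
  · refine (ae_restrict_iff' measurableSet_Ioc).2 (Eventually.of_forall fun z hz => ?_)
    refine mul_nonneg Real.pi_pos.le (le_min ?_ (by positivity))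
    nlinarith [hz.1, hz.2]

/-- Archimedes: the two polar caps of height `1 - c` carry the fraction `1 - c` of the sphere. -/
lemma sph_cap (e : R3) (he : ‖e‖ = 1) {c : ℝ} (hc : 0 < c) (hc1 : c ≤ 1) :
    sph {θ | c < |inner ℝ e θ|} = ENNReal.ofReal (1 - c) := by
  obtain ⟨Φ, hΦ, hΦ'⟩ := exists_measurePreserving_split e he
  have hmeas : MeasurableSet {θ : R3 | c < |inner ℝ e θ|} :=
    measurableSet_lt (by fun_prop) (by fun_prop)
  -- In the coordinates `(z, w)`, `c‖y‖ < |z|` squares to `‖w‖² < (1 - c²)/c² · z²`, and the unit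
  -- ball is `‖w‖² < 1 - z²`.
  set S : Set (ℝ × EuclideanSpace ℝ (Fin 2)) :=
    {p | ‖p.2‖ ^ 2 < min (1 - p.1 ^ 2) ((1 - c ^ 2) / c ^ 2 * p.1 ^ 2)} with hS
  have hSm : MeasurableSet S := measurableSet_lt (by fun_prop) (by fun_prop)
  rw [sph, Measure.map_apply measurable_normalize hmeas,
    ProbabilityTheory.cond_apply measurableSet_ball]
  have hset : Metric.ball (0 : R3) 1 ∩ (fun y : R3 => ‖y‖⁻¹ • y) ⁻¹' {θ | c < |inner ℝ e θ|}
      = Φ ⁻¹' S := by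
    ext y
    obtain ⟨h1, h2⟩ := hΦ' y
    simp only [Set.mem_inter_iff, mem_ball_zero_iff, Set.mem_preimage, Set.mem_ofPred_eq, hS,
      inner_smul_right, ← h1, lt_min_iff]
    set z := (Φ y).1
    set w := ‖(Φ y).2‖
    have hn1 : ‖y‖ < 1 ↔ ‖y‖ ^ 2 < 1 := by
      rw [sq_lt_one_iff₀ (norm_nonneg y)]
    refine and_congr ?_ ?_
    · rw [hn1, h2]; constructor <;> intro h <;> linarith
    · rw [abs_mul, abs_inv, abs_norm]
      rcases eq_or_ne y 0 with rfl | hy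
      · have hz : z = 0 := by rw [h1]; simp
        have hw : 0 ≤ w ^ 2 := sq_nonneg w
        simp [hz]
        exact ⟨fun h => absurd h (by linarith), fun h => absurd h (by linarith)⟩
      · have hy0 : 0 < ‖y‖ := norm_pos_iff.2 hy
        rw [inv_mul_eq_div, lt_div_iff₀ hy0, ← sq_lt_sq₀ (by positivity) (abs_nonneg z),
          mul_pow, h2, sq_abs, div_mul_eq_mul_div, lt_div_iff₀ (by positivity)]
        constructor <;> intro h <;> nlinarith
  rw [hset, hΦ.measure_preimage hSm.nullMeasurableSet, Measure.volume_eq_prod,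
    Measure.prod_apply hSm]
  have : ∀ z : ℝ, volume (Prod.mk z ⁻¹' S)
      = ENNReal.ofReal (Real.pi * min (1 - z ^ 2) ((1 - c ^ 2) / c ^ 2 * z ^ 2)) := fun z => by
    rw [← volume_sq_norm_lt]; rfl
  simp_rw [this]
  rw [lintegral_min_quadratic hc hc1, volume_ball_one_R3,
    ENNReal.ofReal_mul (by positivity), ← mul_assoc, ENNReal.inv_mul_cancel, one_mul]
  · simp; positivity
  · simp

/-- Archimedes' theorem as a law: the height above an equator is uniform on `[0, 1]`, so integrals
of functions of `|⟨e, θ⟩|` become one-dimensional. -/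
lemma sph_map_abs_inner (e : R3) (he : ‖e‖ = 1) :
    sph.map (fun θ => |inner ℝ e θ|) = volume.restrict (Set.Icc (0 : ℝ) 1) := by
  have hm : Measurable fun θ : R3 => |inner ℝ e θ| := by fun_prop
  have hp : IsProbabilityMeasure (sph.map (fun θ => |inner ℝ e θ|)) :=
    Measure.isProbabilityMeasure_map hm.aemeasurable
  have key : ∀ c : ℝ, 0 < c → c ≤ 1 →
      sph.map (fun θ => |inner ℝ e θ|) (Set.Iic c) = ENNReal.ofReal c := by
    intro c hc hc1
    have h1 := sph_cap e he hc hc1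
    have h2 : sph.map (fun θ => |inner ℝ e θ|) (Set.Ioi c) = ENNReal.ofReal (1 - c) := by
      rw [Measure.map_apply hm measurableSet_Ioi]; exact h1
    rw [← Set.compl_Ioi, prob_compl_eq_one_sub measurableSet_Ioi, h2, ← ENNReal.ofReal_one,
      ← ENNReal.ofReal_sub _ (by linarith)]
    congr 1; ring
  have hvol : ∀ c : ℝ, (volume.restrict (Set.Icc (0 : ℝ) 1)) (Set.Iic c)
      = ENNReal.ofReal (min c 1) := fun c => by
    rw [Measure.restrict_apply measurableSet_Iic]
    have : Set.Iic c ∩ Set.Icc (0 : ℝ) 1 = Set.Icc 0 (min c 1) := by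
      ext x; simp; tauto
    rw [this]; simp
  apply Measure.ext_of_Iic
  intro c
  rw [hvol]
  rcases lt_trichotomy c 0 with hc | rfl | hc
  · rw [Measure.map_apply hm measurableSet_Iic, ENNReal.ofReal_of_nonpos
      ((min_le_left _ _).trans hc.le)]
    have : (fun θ : R3 => |inner ℝ e θ|) ⁻¹' Set.Iic c = ∅ := by
      ext θ; simp; exact hc.trans_le (abs_nonneg _)
    rw [this]; simp
  -- `sph_cap` needs a positive height, so the equator is reached as a limit of thin bands.
  · have : ∀ c : ℝ, 0 < c → c ≤ 1 →
      sph.map (fun θ => |inner ℝ e θ|) (Set.Iic 0) ≤ ENNReal.ofReal c := fun c hc hc1 =>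
      (measure_mono (Set.Iic_subset_Iic.2 hc.le)).trans (key c hc hc1).le
    simp only [zero_le_one, min_eq_left, ENNReal.ofReal_zero]
    refine le_antisymm (le_of_forall_gt fun b hb => ?_) zero_le
    obtain ⟨c, hc0, hcb⟩ := ENNReal.lt_iff_exists_nnreal_btwn.1 hb
    have hc0' : (0 : ℝ≥0) < c := by simpa using hc0
    refine (this (min c 1) (lt_min (by exact_mod_cast hc0') one_pos) (min_le_right _ _)).trans_lt
      (lt_of_le_of_lt ?_ hcb)
    rw [← ENNReal.ofReal_coe_nnreal]
    exact ENNReal.ofReal_le_ofReal (min_le_left _ _)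
  · rcases le_total c 1 with hc1 | hc1
    · rw [key c hc hc1, min_eq_left hc1]
    · rw [min_eq_right hc1]
      refine le_antisymm (prob_le_one.trans_eq (by simp)) ?_
      rw [← key 1 one_pos le_rfl]
      exact measure_mono (Set.Iic_subset_Iic.2 hc1)

/-- The Fourier transform of the uniform measure on the sphere. -/
lemma integral_sph_cos (a : ℝ) (e : R3) (he : ‖e‖ = 1) :
    ∫ θ, Real.cos (a * inner ℝ e θ) ∂sph = Real.sinc a := by
  have hm : Measurable fun θ : R3 => |inner ℝ e θ| := by fun_prop
  have h1 : ∀ θ : R3, Real.cos (a * inner ℝ e θ) = Real.cos (a * |inner ℝ e θ|) := fun θ => by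
    rcases abs_choice (inner ℝ e θ : ℝ) with h | h <;> rw [h]
    rw [mul_neg, Real.cos_neg]
  simp_rw [h1]
  rw [← integral_map (f := fun s : ℝ => Real.cos (a * s)) hm.aemeasurable
    (by fun_prop), sph_map_abs_inner e he, integral_Icc_eq_integral_Ioc,
    ← intervalIntegral.integral_of_le zero_le_one]
  rcases eq_or_ne a 0 with rfl | ha
  · simp
  · rw [intervalIntegral.integral_comp_mul_left (fun x => Real.cos x) ha, Real.sinc_of_ne_zero ha]
    simp [div_eq_inv_mul]

/-- The antipodal symmetry removes the sine part; the cosine part is `integral_sph_cos` along the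
direction of `ξ`. -/
lemma integral_sph_exp (ξ : R3) :
    ∫ θ, Complex.exp (Complex.I * (inner ℝ ξ θ : ℝ)) ∂sph = Real.sinc ‖ξ‖ := by
  have hint : Integrable (fun θ => Complex.exp (Complex.I * (inner ℝ ξ θ : ℝ))) sph := by
    refine Integrable.of_bound (by fun_prop) 1 (Eventually.of_forall fun θ => ?_)
    rw [mul_comm, Complex.norm_exp_ofReal_mul_I]
  have hneg : ∫ θ, Complex.exp (Complex.I * (inner ℝ ξ θ : ℝ)) ∂sph
      = ∫ θ, Complex.exp (-(Complex.I * (inner ℝ ξ θ : ℝ))) ∂sph := by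
    conv_lhs => rw [← sph_map_neg, integral_map (by fun_prop) (by fun_prop)]
    simp [inner_neg_right]
  have hint' : Integrable (fun θ => Complex.exp (-(Complex.I * (inner ℝ ξ θ : ℝ)))) sph := by
    refine Integrable.of_bound (by fun_prop) 1 (Eventually.of_forall fun θ => ?_)
    rw [← mul_neg, mul_comm, ← Complex.ofReal_neg, Complex.norm_exp_ofReal_mul_I]
  have hcos : ∫ θ, Complex.exp (Complex.I * (inner ℝ ξ θ : ℝ)) ∂sph
      = ∫ θ, ((Real.cos (inner ℝ ξ θ) : ℝ) : ℂ) ∂sph := by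
    have h2 : ∀ z w : ℂ, z = w → z = (z + w) / 2 := by rintro z _ rfl; ring
    rw [h2 _ _ hneg, ← integral_add hint hint', ← integral_div]
    congr 1; ext θ
    rw [Complex.ofReal_cos, Complex.cos]
    congr 2 <;> ring_nf
  rw [hcos, integral_complex_ofReal]
  congr 1
  rcases eq_or_ne ξ 0 with rfl | hξ
  · simp
  · rw [← integral_sph_cos ‖ξ‖ (‖ξ‖⁻¹ • ξ) (by
      rw [norm_smul, norm_inv, norm_norm, inv_mul_cancel₀ (norm_ne_zero_iff.2 hξ)])]
    congr 1; ext θ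
    rw [inner_smul_left]
    simp [← mul_assoc, mul_inv_cancel₀ (norm_ne_zero_iff.2 hξ)]

/-- If the ball meets the sphere at `e`, all its points on the sphere are within `2δ` of `e`. Since
`‖e - θ‖² = 2 - 2⟨e, θ⟩`, they lie in the cap `⟨e, θ⟩ > 1 - 2δ²`, and Archimedes gives its measure.
-/
lemma sph_ball_le (z : R3) (δ : ℝ) :
    sph {θ | ‖z - θ‖ < δ} ≤ ENNReal.ofReal (2 * δ ^ 2) := by
  rcases le_or_gt 1 (2 * δ ^ 2) with h1 | h1
  · exact prob_le_one.trans (by rw [← ENNReal.ofReal_one]; exact ENNReal.ofReal_le_ofReal h1)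
  by_cases hne : ∃ e : R3, ‖e‖ = 1 ∧ ‖z - e‖ < δ
  · obtain ⟨e, he, hez⟩ := hne
    have hcap := sph_cap e he (c := 1 - 2 * δ ^ 2) (by linarith) (by nlinarith)
    rw [sub_sub_cancel] at hcap
    rw [← hcap]
    refine measure_mono_ae ?_
    filter_upwards [sph_ae_norm] with θ hθ (hθz : ‖z - θ‖ < δ)
    change 1 - 2 * δ ^ 2 < |inner ℝ e θ|
    have h3 : ‖e - θ‖ < 2 * δ := by
      calc ‖e - θ‖ = ‖(z - θ) - (z - e)‖ := by congr 1; abel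
        _ ≤ ‖z - θ‖ + ‖z - e‖ := norm_sub_le _ _
        _ < 2 * δ := by linarith
    have h4 := norm_sub_sq_real e θ
    rw [he, hθ] at h4
    have h5 : ‖e - θ‖ ^ 2 < (2 * δ) ^ 2 := by gcongr
    exact lt_of_lt_of_le (by nlinarith) (le_abs_self _)
  · have : sph {θ | ‖z - θ‖ < δ} = 0 := by
      refine measure_mono_null (t := {θ | ¬ ‖θ‖ = 1}) (fun θ hθ h => hne ⟨θ, h, hθ⟩) ?_
      exact ae_iff.1 sph_ae_norm
    simp [this]

/-! ### Kirchhoff's formula as a Fourier multiplier, and its time derivatives. -/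

/-- Kirchhoff's solution at time `t`: `t` times the mean of `f` over the sphere of radius `|t|`. -/
noncomputable def wave {E : Type*} [NormedAddCommGroup E] [NormedSpace ℝ E]
    (t : ℝ) (f : R3 → E) (x : R3) : E := t • ∫ θ, f (x + t • θ) ∂sph

/-- The Fourier multiplier with symbol `m`. -/
noncomputable def multOp (m : R3 → ℝ) (φ : SchwartzMap R3 ℂ) : R3 → ℂ :=
  𝓕⁻ fun ξ => (m ξ : ℂ) * 𝓕 φ ξ

/-- Equal to `sin(2πt‖ξ‖)/(2π‖ξ‖)` away from the origin; `sinc` supplies the correct value `t` at `ξ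
= 0`. -/
noncomputable def sinSymbol (t : ℝ) (ξ : R3) : ℝ := t * Real.sinc (2 * Real.pi * t * ‖ξ‖)

noncomputable def cosSymbol (t : ℝ) (ξ : R3) : ℝ := Real.cos (2 * Real.pi * t * ‖ξ‖)

lemma continuous_sinSymbol (t : ℝ) : Continuous (sinSymbol t) := by
  unfold sinSymbol; fun_prop

lemma continuous_cosSymbol (t : ℝ) : Continuous (cosSymbol t) := by
  unfold cosSymbol; fun_prop

lemma abs_sinSymbol_le (t : ℝ) (ξ : R3) : |sinSymbol t ξ| ≤ |t| := by
  rw [sinSymbol, abs_mul]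
  exact mul_le_of_le_one_right (abs_nonneg t) (Real.abs_sinc_le_one _)

lemma abs_cosSymbol_le (t : ℝ) (ξ : R3) : |cosSymbol t ξ| ≤ 1 := Real.abs_cos_le_one _

lemma norm_mul_sinSymbol (t : ℝ) (ξ : R3) :
    2 * Real.pi * ‖ξ‖ * sinSymbol t ξ = Real.sin (2 * Real.pi * t * ‖ξ‖) := by
  rcases eq_or_ne (2 * Real.pi * t * ‖ξ‖) 0 with h | h
  · rw [h, Real.sin_zero, sinSymbol, h, Real.sinc_zero, mul_one]
    linarith
  · rw [sinSymbol, Real.sinc_of_ne_zero h]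
    have ht : t ≠ 0 := by rintro rfl; simp at h
    have hr : ‖ξ‖ ≠ 0 := by intro h0; simp [h0] at h
    field_simp

lemma norm_mul_abs_sinSymbol_le (t : ℝ) (ξ : R3) :
    2 * Real.pi * ‖ξ‖ * |sinSymbol t ξ| ≤ 1 := by
  have := Real.abs_sin_le_one (2 * Real.pi * t * ‖ξ‖)
  rwa [← norm_mul_sinSymbol, abs_mul, abs_of_nonneg (by positivity)] at this

lemma hasDerivAt_sinSymbol (t : ℝ) (ξ : R3) :
    HasDerivAt (fun s => sinSymbol s ξ) (cosSymbol t ξ) t := by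
  rcases eq_or_ne ξ 0 with rfl | hξ
  · simpa [sinSymbol, cosSymbol] using hasDerivAt_id' t
  · have hr : 2 * Real.pi * ‖ξ‖ ≠ 0 := by positivity
    have h1 : (fun s => sinSymbol s ξ)
        = fun s => Real.sin (2 * Real.pi * s * ‖ξ‖) / (2 * Real.pi * ‖ξ‖) := by
      ext s; rw [← norm_mul_sinSymbol, mul_div_cancel_left₀ _ hr]
    rw [h1]
    have h2 : HasDerivAt (fun s => 2 * Real.pi * s * ‖ξ‖) (2 * Real.pi * ‖ξ‖) t := by
      simpa using ((hasDerivAt_id t).const_mul (2 * Real.pi)).mul_const ‖ξ‖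
    have h3 := h2.sin.div_const (2 * Real.pi * ‖ξ‖)
    rwa [mul_div_cancel_right₀ _ hr] at h3

lemma hasDerivAt_cosSymbol (t : ℝ) (ξ : R3) :
    HasDerivAt (fun s => cosSymbol s ξ) (-(2 * Real.pi * ‖ξ‖) ^ 2 * sinSymbol t ξ) t := by
  have h2 : HasDerivAt (fun s => 2 * Real.pi * s * ‖ξ‖) (2 * Real.pi * ‖ξ‖) t := by
    simpa using ((hasDerivAt_id t).const_mul (2 * Real.pi)).mul_const ‖ξ‖
  refine h2.cos.congr_deriv ?_
  rw [← norm_mul_sinSymbol]; ring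

lemma integrable_symbol_mul {m : R3 → ℝ} (hm : Continuous m) {M : ℝ} (hM : ∀ ξ, |m ξ| ≤ M)
    (φ : SchwartzMap R3 ℂ) (n : ℕ) :
    Integrable fun ξ => ‖ξ‖ ^ n * ‖(m ξ : ℂ) * 𝓕 φ ξ‖ := by
  refine (((𝓕 φ).integrable_pow_mul volume n).const_mul M).mono' (by fun_prop) ?_
  refine Eventually.of_forall fun ξ => ?_
  rw [norm_mul, norm_norm, norm_mul, norm_pow, norm_norm, Complex.norm_real, Real.norm_eq_abs]
  calc ‖ξ‖ ^ n * (|m ξ| * ‖𝓕 φ ξ‖) = |m ξ| * (‖ξ‖ ^ n * ‖𝓕 φ ξ‖) := by ring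
    _ ≤ _ := by gcongr; exact hM ξ

lemma integrable_symbol_mul' {m : R3 → ℝ} (hm : Continuous m) {M : ℝ} (hM : ∀ ξ, |m ξ| ≤ M)
    (φ : SchwartzMap R3 ℂ) : Integrable fun ξ => (m ξ : ℂ) * 𝓕 φ ξ := by
  have := integrable_symbol_mul hm hM φ 0
  simp only [pow_zero, one_mul] at this
  exact (integrable_norm_iff (by fun_prop)).1 this

lemma multOp_apply (m : R3 → ℝ) (φ : SchwartzMap R3 ℂ) (x : R3) :
    multOp m φ x = ∫ ξ, Complex.exp (2 * Real.pi * Complex.I * (inner ℝ ξ x : ℝ))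
      * ((m ξ : ℂ) * 𝓕 φ ξ) := by
  rw [multOp, Real.fourierInv_eq']
  congr 1; ext ξ
  rw [smul_eq_mul]
  congr 2
  push_cast
  ring

lemma contDiff_multOp {m : R3 → ℝ} (hm : Continuous m) {M : ℝ} (hM : ∀ ξ, |m ξ| ≤ M)
    (φ : SchwartzMap R3 ℂ) : ContDiff ℝ ∞ (multOp m φ) := by
  have h : ContDiff ℝ ∞ (𝓕 fun ξ => (m ξ : ℂ) * 𝓕 φ ξ) :=
    Real.contDiff_fourier (N := ⊤) fun n _ => integrable_symbol_mul hm hM φ n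
  have : multOp m φ = (𝓕 fun ξ => (m ξ : ℂ) * 𝓕 φ ξ) ∘ fun x => -x := by
    ext x; rw [multOp, Real.fourierInv_eq_fourier_neg]; rfl
  rw [this]
  exact h.comp contDiff_neg

lemma norm_multOp_le {m : R3 → ℝ} {M : ℝ} (hM : ∀ ξ, |m ξ| ≤ M)
    (φ : SchwartzMap R3 ℂ) (x : R3) : ‖multOp m φ x‖ ≤ M * ∫ ξ, ‖𝓕 φ ξ‖ := by
  rw [multOp_apply, ← integral_const_mul]
  refine norm_integral_le_of_norm_le ((𝓕 φ).integrable.norm.const_mul M)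
    (Eventually.of_forall fun ξ => ?_)
  have : 2 * Real.pi * Complex.I * (inner ℝ ξ x : ℝ)
      = ((2 * Real.pi * inner ℝ ξ x : ℝ) : ℂ) * Complex.I := by push_cast; ring
  rw [norm_mul, this, Complex.norm_exp_ofReal_mul_I, one_mul, norm_mul, Complex.norm_real,
    Real.norm_eq_abs]
  gcongr
  exact hM ξ

/-- By Fourier inversion and Fubini: the spherical mean of a plane wave of frequency `ξ` is that
wave times the transform of `sph` at `2πtξ`. -/
lemma wave_eq_multOp (t : ℝ) (φ : SchwartzMap R3 ℂ) (x : R3) :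
    wave t φ x = multOp (sinSymbol t) φ x := by
  have hinv : ∀ y, φ y = ∫ ξ, Complex.exp (2 * Real.pi * Complex.I * (inner ℝ ξ y : ℝ)) * 𝓕 φ ξ := by
    intro y
    have h1 : 𝓕⁻ (𝓕 φ) = φ := FourierTransform.fourierInv_fourier_eq φ
    conv_lhs => rw [← h1]
    rw [SchwartzMap.fourierInv_coe, Real.fourierInv_eq']
    congr 1; ext ξ
    rw [smul_eq_mul]
    congr 2
    push_cast
    ring
  have hexp : ∀ ξ y : R3, ‖Complex.exp (2 * Real.pi * Complex.I * (inner ℝ ξ y : ℝ))‖ = 1 := by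
    intro ξ y
    have : 2 * Real.pi * Complex.I * (inner ℝ ξ y : ℝ)
      = ((2 * Real.pi * inner ℝ ξ y : ℝ) : ℂ) * Complex.I := by push_cast; ring
    rw [this, Complex.norm_exp_ofReal_mul_I]
  rw [wave, multOp_apply]
  simp_rw [hinv (x + t • _)]
  rw [integral_integral_swap]
  · rw [← integral_smul]
    congr 1; ext ξ
    have h1 : ∀ θ : R3, Complex.exp (2 * Real.pi * Complex.I * (inner ℝ ξ (x + t • θ) : ℝ)) * 𝓕 φ ξ
        = Complex.exp (Complex.I * (inner ℝ ((2 * Real.pi * t) • ξ) θ : ℝ))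
          * (Complex.exp (2 * Real.pi * Complex.I * (inner ℝ ξ x : ℝ)) * 𝓕 φ ξ) := by
      intro θ
      rw [← mul_assoc, ← Complex.exp_add, inner_add_right, inner_smul_right, inner_smul_left]
      congr 2
      simp only [conj_trivial]
      push_cast
      ring
    simp_rw [h1]
    rw [integral_mul_const, integral_sph_exp, norm_smul, sinSymbol, Complex.real_smul]
    have h2 : Real.sinc (‖2 * Real.pi * t‖ * ‖ξ‖) = Real.sinc (2 * Real.pi * t * ‖ξ‖) := by
      rcases abs_choice (2 * Real.pi * t) with h | h <;> rw [Real.norm_eq_abs, h]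
      rw [neg_mul, Real.sinc_neg]
    rw [h2]
    push_cast
    ring
  · have h1 : Integrable (fun p : R3 × R3 => ‖𝓕 φ p.2‖) (sph.prod volume) :=
      (𝓕 φ).integrable.norm.comp_snd sph
    refine h1.mono' ?_ (Eventually.of_forall fun p => ?_)
    · apply Continuous.aestronglyMeasurable
      fun_prop
    · simp only [Function.uncurry]
      rw [norm_mul, hexp, one_mul]

lemma norm_exp_inner (ξ x : R3) :
    ‖Complex.exp (2 * Real.pi * Complex.I * (inner ℝ ξ x : ℝ))‖ = 1 := by
  have : 2 * Real.pi * Complex.I * (inner ℝ ξ x : ℝ)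
    = ((2 * Real.pi * inner ℝ ξ x : ℝ) : ℂ) * Complex.I := by push_cast; ring
  rw [this, Complex.norm_exp_ofReal_mul_I]

lemma fourier_laplacian_schwartz (φ : SchwartzMap R3 ℂ) (ξ : R3) :
    𝓕 (Δ φ) ξ = (-(2 * Real.pi * ‖ξ‖) ^ 2 : ℝ) * 𝓕 φ ξ := by
  rw [SchwartzMap.laplacian_eq_fourierMultiplierCLM, FourierTransform.fourier_smul,
    SchwartzMap.fourierMultiplierCLM_apply, FourierTransform.fourier_fourierInv_eq,
    smul_apply, SchwartzMap.smulLeftCLM_apply_apply (by fun_prop)]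
  simp only [Complex.real_smul]
  push_cast
  ring

lemma hasDerivAt_multOp_sin (φ : SchwartzMap R3 ℂ) (x : R3) (t : ℝ) :
    HasDerivAt (fun s => multOp (sinSymbol s) φ x) (multOp (cosSymbol t) φ x) t := by
  simp_rw [multOp_apply]
  refine (hasDerivAt_integral_of_dominated_loc_of_deriv_le (μ := (volume : Measure R3))
    (𝕜 := ℝ) (E := ℂ) (x₀ := t)
    (F := fun s ξ => Complex.exp (2 * Real.pi * Complex.I * (inner ℝ ξ x : ℝ)) * (sinSymbol s ξ * 𝓕 φ ξ))
    (F' := fun s ξ => Complex.exp (2 * Real.pi * Complex.I * (inner ℝ ξ x : ℝ)) * (cosSymbol s ξ * 𝓕 φ ξ))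
    (bound := fun ξ => ‖𝓕 φ ξ‖)
    (s := Set.univ) univ_mem (Eventually.of_forall fun s => ?_) ?_ ?_ ?_ ?_ ?_).2
  · have := continuous_sinSymbol s
    exact Continuous.aestronglyMeasurable (by fun_prop)
  · refine (integrable_symbol_mul' (continuous_sinSymbol t) (abs_sinSymbol_le t) φ).norm.mono' ?_
      (Eventually.of_forall fun ξ => by rw [norm_mul, norm_exp_inner, one_mul])
    have := continuous_sinSymbol t
    exact Continuous.aestronglyMeasurable (by fun_prop)
  · have := continuous_cosSymbol t
    exact Continuous.aestronglyMeasurable (by fun_prop)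
  · refine Eventually.of_forall fun ξ s _ => ?_
    rw [norm_mul, norm_exp_inner, one_mul, norm_mul, Complex.norm_real]
    exact mul_le_of_le_one_left (norm_nonneg _) (abs_cosSymbol_le s ξ)
  · exact (𝓕 φ).integrable.norm
  · refine Eventually.of_forall fun ξ s _ => ?_
    exact ((hasDerivAt_sinSymbol s ξ).ofReal_comp.mul_const _).const_mul _

lemma hasDerivAt_multOp_cos (φ : SchwartzMap R3 ℂ) (x : R3) (t : ℝ) :
    HasDerivAt (fun s => multOp (cosSymbol s) φ x) (multOp (sinSymbol t) (Δ φ) x) t := by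
  -- The factor `-(2π‖ξ‖)²` produced by the second time derivative is absorbed into `Δ φ`, whose
  -- transform is integrable and dominates.
  have key : ∀ s ξ, ((-(2 * Real.pi * ‖ξ‖) ^ 2 * sinSymbol s ξ : ℝ) : ℂ) * 𝓕 φ ξ
      = (sinSymbol s ξ : ℂ) * 𝓕 (Δ φ) ξ := by
    intro s ξ
    rw [fourier_laplacian_schwartz]; push_cast; ring
  simp_rw [multOp_apply]
  refine (hasDerivAt_integral_of_dominated_loc_of_deriv_le (μ := (volume : Measure R3))
    (𝕜 := ℝ) (E := ℂ) (x₀ := t)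
    (F := fun s ξ => Complex.exp (2 * Real.pi * Complex.I * (inner ℝ ξ x : ℝ)) * (cosSymbol s ξ * 𝓕 φ ξ))
    (F' := fun s ξ => Complex.exp (2 * Real.pi * Complex.I * (inner ℝ ξ x : ℝ)) * (sinSymbol s ξ * 𝓕 (Δ φ) ξ))
    (bound := fun ξ => (|t| + 1) * ‖𝓕 (Δ φ) ξ‖)
    (s := Metric.ball t 1) (Metric.ball_mem_nhds t one_pos)
    (Eventually.of_forall fun s => ?_) ?_ ?_ ?_ ?_ ?_).2
  · have := continuous_cosSymbol s
    exact Continuous.aestronglyMeasurable (by fun_prop)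
  · refine (integrable_symbol_mul' (continuous_cosSymbol t) (abs_cosSymbol_le t) φ).norm.mono' ?_
      (Eventually.of_forall fun ξ => by rw [norm_mul, norm_exp_inner, one_mul])
    have := continuous_cosSymbol t
    exact Continuous.aestronglyMeasurable (by fun_prop)
  · have := continuous_sinSymbol t
    exact Continuous.aestronglyMeasurable (by fun_prop)
  · refine Eventually.of_forall fun ξ s hs => ?_
    rw [norm_mul, norm_exp_inner, one_mul, norm_mul, Complex.norm_real]
    gcongr
    refine (abs_sinSymbol_le s ξ).trans ?_
    rw [Metric.mem_ball, Real.dist_eq] at hs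
    have := abs_sub_abs_le_abs_sub s t
    linarith
  · exact (𝓕 (Δ φ)).integrable.norm.const_mul _
  · refine Eventually.of_forall fun ξ s _ => ?_
    rw [← key]
    exact ((hasDerivAt_cosSymbol s ξ).ofReal_comp.mul_const _).const_mul _

/-- A compactly supported output of a multiplier has the expected Fourier transform. -/
lemma fourier_multOp {m : R3 → ℝ} (hm : Continuous m) {M : ℝ} (hM : ∀ ξ, |m ξ| ≤ M)
    (φ : SchwartzMap R3 ℂ) (hc : HasCompactSupport (multOp m φ)) (ξ : R3) :
    𝓕 (multOp m φ) ξ = m ξ * 𝓕 φ ξ := by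
  have hi : Integrable (multOp m φ) :=
    (contDiff_multOp hm hM φ).continuous.integrable_of_hasCompactSupport hc
  have h𝓕 : Integrable (𝓕 fun ξ => (m ξ : ℂ) * 𝓕 φ ξ) := by
    have : (𝓕 fun ξ => (m ξ : ℂ) * 𝓕 φ ξ) = fun x => multOp m φ (-x) := by
      ext x; rw [multOp, Real.fourierInv_eq_fourier_neg, neg_neg]
    rw [this]
    exact hi.comp_neg
  exact congrFun (Continuous.fourier_fourierInv_eq (f := fun ξ => (m ξ : ℂ) * 𝓕 φ ξ) (by fun_prop)
    (integrable_symbol_mul' hm hM φ) h𝓕) ξ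

/-- A smooth compactly supported output is itself Schwartz, so both sides are inverse transforms of
the same product of symbols with `𝓕 φ`. -/
lemma laplacian_multOp {m : R3 → ℝ} (hm : Continuous m) {M : ℝ} (hM : ∀ ξ, |m ξ| ≤ M)
    (φ : SchwartzMap R3 ℂ) (hc : HasCompactSupport (multOp m φ)) :
    Δ (multOp m φ) = multOp m (Δ φ) := by
  have hs := contDiff_multOp hm hM φ
  set ψ : SchwartzMap R3 ℂ := hc.toSchwartzMap hs with hψ
  have hψc : (ψ : R3 → ℂ) = multOp m φ := rfl
  ext x
  have h1 : Δ (multOp m φ) x = (Δ ψ) x := by rw [SchwartzMap.laplacian_apply, hψc]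
  have h2 : 𝓕⁻ (𝓕 (Δ ψ)) = Δ ψ := FourierTransform.fourierInv_fourier_eq _
  rw [h1, ← h2, SchwartzMap.fourierInv_coe, multOp]
  refine congrFun (congrArg _ (funext fun ξ => ?_)) x
  have h3 : 𝓕 ψ ξ = m ξ * 𝓕 φ ξ := by
    rw [SchwartzMap.fourier_coe, hψc, fourier_multOp hm hM φ hc]
  rw [fourier_laplacian_schwartz, fourier_laplacian_schwartz, h3]
  ring

/-! ### Propagation of test functions: smoothness, finite speed, commutation with the Laplacian. -/

/-- The test functions on `ℝ³`. -/
def IsTest (φ : R3 → ℝ) : Prop := ContDiff ℝ ∞ φ ∧ HasCompactSupport φ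

/-- A real test function as a complex Schwartz function. -/
noncomputable def IsTest.schwartz {φ : R3 → ℝ} (h : IsTest φ) : SchwartzMap R3 ℂ :=
  HasCompactSupport.toSchwartzMap (f := fun x => (φ x : ℂ)) (h.2.comp_left (g := Complex.ofReal) rfl)
    (Complex.ofRealCLM.contDiff.comp h.1)

lemma IsTest.schwartz_apply {φ : R3 → ℝ} (h : IsTest φ) (x : R3) : h.schwartz x = φ x := rfl

lemma laplacian_ofReal {ψ : R3 → ℝ} (h : ContDiff ℝ ∞ ψ) (x : R3) :
    Δ (fun y => (ψ y : ℂ)) x = ((Δ ψ x : ℝ) : ℂ) :=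
  ContDiffAt.laplacian_CLM_comp_left (l := Complex.ofRealCLM)
    ((contDiff_infty.1 h 2).contDiffAt)

lemma IsTest.ofReal_laplacian {φ : R3 → ℝ} (h : IsTest φ) (x : R3) :
    ((Δ φ x : ℝ) : ℂ) = (Δ h.schwartz) x := by
  rw [SchwartzMap.laplacian_apply, ← laplacian_ofReal h.1]; rfl

lemma IsTest.laplacian {φ : R3 → ℝ} (h : IsTest φ) : IsTest (Δ φ) := by
  constructor
  · have : Δ φ = fun x => Complex.reCLM ((Δ h.schwartz) x) := by
      ext x; rw [← h.ofReal_laplacian]; simp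
    rw [this]
    exact Complex.reCLM.contDiff.comp ((Δ h.schwartz).smooth ⊤)
  · refine HasCompactSupport.intro h.2 fun x hx => ?_
    have h0 : φ =ᶠ[𝓝 x] fun _ => 0 := notMem_tsupport_iff_eventuallyEq.1 hx
    have h1 := (InnerProductSpace.laplacian_congr_nhds h0).self_of_nhds
    rw [h1]
    simp [InnerProductSpace.laplacian_eq_iteratedFDeriv_stdOrthonormalBasis]

lemma IsTest.schwartz_laplacian {φ : R3 → ℝ} (h : IsTest φ) :
    h.laplacian.schwartz = Δ h.schwartz := by
  ext x; rw [IsTest.schwartz_apply, h.ofReal_laplacian]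

/-- Finite speed of propagation: a sphere of radius `|t|` centred at `x` stays outside the ball of
radius `R`. -/
lemma wave_eq_zero {E : Type*} [NormedAddCommGroup E] [NormedSpace ℝ E] {φ : R3 → E} {R : ℝ}
    (hR : ∀ y, R < ‖y‖ → φ y = 0) {t : ℝ} {x : R3} (hx : R + |t| < ‖x‖) : wave t φ x = 0 := by
  have : ∀ᵐ θ ∂sph, φ (x + t • θ) = 0 := by
    filter_upwards [sph_ae_norm] with θ hθ
    apply hR
    have h1 := norm_sub_le (x + t • θ) (t • θ)
    rw [add_sub_cancel_right, norm_smul, hθ, mul_one, Real.norm_eq_abs] at h1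
    linarith
  rw [wave, integral_congr_ae this]
  simp

lemma ofReal_wave (t : ℝ) (φ : R3 → ℝ) (x : R3) :
    ((wave t φ x : ℝ) : ℂ) = wave t (fun y => (φ y : ℂ)) x := by
  rw [wave, wave, integral_complex_ofReal, Complex.real_smul, smul_eq_mul, Complex.ofReal_mul]

/-- The time derivative of Kirchhoff's solution. -/
noncomputable def waveDeriv (t : ℝ) (φ : R3 → ℝ) (x : R3) : ℝ := deriv (fun s => wave s φ x) t

namespace IsTest
variable {φ : R3 → ℝ}

lemma ofReal_wave_eq (h : IsTest φ) (t : ℝ) (x : R3) :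
    ((wave t φ x : ℝ) : ℂ) = multOp (sinSymbol t) h.schwartz x := by
  rw [ofReal_wave, ← wave_eq_multOp]; rfl

lemma hasDerivAt_wave (h : IsTest φ) (t : ℝ) (x : R3) :
    HasDerivAt (fun s => wave s φ x) (waveDeriv t φ x) t := by
  have h1 := hasDerivAt_multOp_sin h.schwartz x t
  simp_rw [← h.ofReal_wave_eq] at h1
  have h2 := Complex.reCLM.hasFDerivAt.comp_hasDerivAt t h1
  have h3 : HasDerivAt (fun s => wave s φ x)
    (Complex.reCLM (multOp (cosSymbol t) h.schwartz x)) t := h2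
  exact h3.differentiableAt.hasDerivAt

lemma ofReal_waveDeriv_eq (h : IsTest φ) (t : ℝ) (x : R3) :
    ((waveDeriv t φ x : ℝ) : ℂ) = multOp (cosSymbol t) h.schwartz x := by
  have h1 := hasDerivAt_multOp_sin h.schwartz x t
  simp_rw [← h.ofReal_wave_eq] at h1
  exact (h.hasDerivAt_wave t x).ofReal_comp.unique h1

lemma hasDerivAt_waveDeriv (h : IsTest φ) (t : ℝ) (x : R3) :
    HasDerivAt (fun s => waveDeriv s φ x) (wave t (Δ φ) x) t := by
  have h1 := hasDerivAt_multOp_cos h.schwartz x t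
  rw [← h.schwartz_laplacian] at h1
  simp_rw [← h.ofReal_waveDeriv_eq, ← h.laplacian.ofReal_wave_eq] at h1
  exact Complex.reCLM.hasFDerivAt.comp_hasDerivAt t h1

lemma waveDeriv_eq_zero {R : ℝ} (hR : ∀ y, R < ‖y‖ → φ y = 0) {t : ℝ} {x : R3}
    (hx : R + |t| < ‖x‖) : waveDeriv t φ x = 0 := by
  have h0 : (fun s => wave s φ x) =ᶠ[𝓝 t] fun _ => 0 := by
    have : ∀ᶠ s in 𝓝 t, R + |s| < ‖x‖ :=
      (continuous_const.add continuous_abs).continuousAt.eventually_lt continuousAt_const hx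
    filter_upwards [this] with s hs using wave_eq_zero hR hs
  rw [waveDeriv, h0.deriv_eq, deriv_const]

lemma exists_radius (h : IsTest φ) : ∃ R, 0 ≤ R ∧ ∀ y, R < ‖y‖ → φ y = 0 := by
  obtain ⟨R, hR⟩ := h.2.isCompact.isBounded.subset_closedBall (0 : R3)
  refine ⟨max R 0, le_max_right _ _, fun y hy => ?_⟩
  by_contra h0
  have := hR (subset_tsupport _ h0)
  rw [mem_closedBall_zero_iff] at this
  exact absurd (hy.trans_le this) (not_lt.2 (le_max_left _ _))

lemma hasCompactSupport_of_radius {ψ : R3 → ℝ} {R : ℝ} (hR : ∀ y, R < ‖y‖ → ψ y = 0) :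
    HasCompactSupport ψ :=
  HasCompactSupport.intro (isCompact_closedBall (0 : R3) R) fun x hx => hR x (by simpa using hx)

lemma wave (h : IsTest φ) (t : ℝ) : IsTest (wave t φ) := by
  constructor
  · have : _root_.wave t φ = fun x => Complex.reCLM (multOp (sinSymbol t) h.schwartz x) := by
      ext x; rw [← h.ofReal_wave_eq]; simp
    rw [this]
    exact Complex.reCLM.contDiff.comp (contDiff_multOp (continuous_sinSymbol t)
      (abs_sinSymbol_le t) _)
  · obtain ⟨R, -, hR⟩ := h.exists_radius
    exact hasCompactSupport_of_radius fun x hx => wave_eq_zero hR hx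

lemma waveDeriv (h : IsTest φ) (t : ℝ) : IsTest (waveDeriv t φ) := by
  constructor
  · have : _root_.waveDeriv t φ = fun x => Complex.reCLM (multOp (cosSymbol t) h.schwartz x) := by
      ext x; rw [← h.ofReal_waveDeriv_eq]; simp
    rw [this]
    exact Complex.reCLM.contDiff.comp (contDiff_multOp (continuous_cosSymbol t)
      (abs_cosSymbol_le t) _)
  · obtain ⟨R, -, hR⟩ := h.exists_radius
    exact hasCompactSupport_of_radius fun x hx => waveDeriv_eq_zero hR hx

/-- Shared by `wave` and `waveDeriv`: the complex identity `laplacian_multOp` is transferred to real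
test functions. -/
lemma laplacian_eq_of_multOp (h : IsTest φ) {m : R3 → ℝ} (hm : Continuous m) {M : ℝ}
    (hM : ∀ ξ, |m ξ| ≤ M) {ψ χ : R3 → ℝ} (hψ : IsTest ψ)
    (h1 : ∀ x, (ψ x : ℂ) = multOp m h.schwartz x)
    (h2 : ∀ x, (χ x : ℂ) = multOp m h.laplacian.schwartz x) : Δ ψ = χ := by
  ext x
  have h3 : (fun y => (ψ y : ℂ)) = multOp m h.schwartz := funext h1
  have h4 : HasCompactSupport (multOp m h.schwartz) := by
    rw [← h3]; exact hψ.2.comp_left (g := Complex.ofReal) rfl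
  have h5 := congrFun (laplacian_multOp hm hM h.schwartz h4) x
  rw [← h3, laplacian_ofReal hψ.1, ← h.schwartz_laplacian, ← h2] at h5
  exact_mod_cast h5

lemma laplacian_wave (h : IsTest φ) (t : ℝ) : Δ (_root_.wave t φ) = _root_.wave t (Δ φ) :=
  h.laplacian_eq_of_multOp (continuous_sinSymbol t) (abs_sinSymbol_le t) (h.wave t)
    (h.ofReal_wave_eq t) (h.laplacian.ofReal_wave_eq t)

lemma laplacian_waveDeriv (h : IsTest φ) (t : ℝ) :
    Δ (_root_.waveDeriv t φ) = _root_.waveDeriv t (Δ φ) :=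
  h.laplacian_eq_of_multOp (continuous_cosSymbol t) (abs_cosSymbol_le t) (h.waveDeriv t)
    (h.ofReal_waveDeriv_eq t) (h.laplacian.ofReal_waveDeriv_eq t)

lemma abs_wave_le (h : IsTest φ) : ∃ M, ∀ t x, |_root_.wave t φ x| ≤ |t| * M := by
  refine ⟨∫ ξ, ‖𝓕 h.schwartz ξ‖, fun t x => ?_⟩
  rw [← Real.norm_eq_abs, ← Complex.norm_real, h.ofReal_wave_eq]
  exact norm_multOp_le (abs_sinSymbol_le t) _ _

lemma abs_waveDeriv_le (h : IsTest φ) : ∃ M, ∀ t x, |_root_.waveDeriv t φ x| ≤ M := by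
  refine ⟨1 * ∫ ξ, ‖𝓕 h.schwartz ξ‖, fun t x => ?_⟩
  rw [← Real.norm_eq_abs, ← Complex.norm_real, h.ofReal_waveDeriv_eq]
  exact norm_multOp_le (abs_cosSymbol_le t) _ _

end IsTest

/-! ### The one-dimensional wave equation in two time variables. -/

section Duhamel

/-- A second antiderivative determines the first derivative. -/
lemma deriv_eq_sub_integral {g G K : ℝ → ℂ} (hg : ∀ s, HasDerivAt g (G s) s)
    (hG : ∀ s, HasDerivAt G (K s) s) (hK : Continuous K) (s : ℝ) :
    G s = g (s + 1) - g s - ∫ r in (0 : ℝ)..1, ((1 - r : ℝ) : ℂ) * K (s + r) := by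
  have hd : ∀ r ∈ Set.uIcc (0 : ℝ) 1,
      HasDerivAt (fun r : ℝ => ((1 - r : ℝ) : ℂ) * G (s + r) + g (s + r))
        (((1 - r : ℝ) : ℂ) * K (s + r)) r := by
    intro r _
    have h1 : HasDerivAt (fun r : ℝ => s + r) 1 r := by simpa using (hasDerivAt_id' r).const_add s
    have h2 : HasDerivAt (fun r => G (s + r)) (K (s + r)) r := by
      simpa [Function.comp_def] using (hG (s + r)).scomp r h1
    have h3 : HasDerivAt (fun r => g (s + r)) (G (s + r)) r := by
      simpa [Function.comp_def] using (hg (s + r)).scomp r h1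
    have h4 : HasDerivAt (fun r : ℝ => ((1 - r : ℝ) : ℂ)) (-1) r := by
      simpa using ((hasDerivAt_id' r).const_sub 1).ofReal_comp
    refine ((h4.mul h2).add h3).congr_deriv ?_
    ring
  rw [intervalIntegral.integral_eq_sub_of_hasDerivAt hd
    (Continuous.intervalIntegrable (by fun_prop) _ _)]
  simp

/-- The weak equation gives a first time derivative that is not known to depend continuously on the
test function's parameter. Taylor's formula with integral remainder expresses it through `g` and
`K`, which are jointly continuous. -/
lemma continuous_deriv_of_second {g G K : ℝ → ℝ → ℂ}
    (hg : ∀ s τ, HasDerivAt (fun s => g s τ) (G s τ) s)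
    (hG : ∀ s τ, HasDerivAt (fun s => G s τ) (K s τ) s)
    (hgc : Continuous fun p : ℝ × ℝ => g p.1 p.2) (hK : Continuous fun p : ℝ × ℝ => K p.1 p.2) :
    Continuous fun p : ℝ × ℝ => G p.1 p.2 := by
  have h1 : (fun p : ℝ × ℝ => G p.1 p.2) = fun p => g (p.1 + 1) p.2 - g p.1 p.2
      - ∫ r in (0 : ℝ)..1, ((1 - r : ℝ) : ℂ) * K (p.1 + r) p.2 := by
    ext p
    exact deriv_eq_sub_integral (g := fun s => g s p.2) (G := fun s => G s p.2)
      (K := fun s => K s p.2) (fun s => hg s p.2) (fun s => hG s p.2)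
      (hK.comp (continuous_id.prodMk continuous_const)) p.1
  rw [h1]
  have h2 : Continuous fun p : ℝ × ℝ => g (p.1 + 1) p.2 :=
    hgc.comp ((continuous_fst.add continuous_const).prodMk continuous_snd)
  refine (h2.sub hgc).sub ?_
  apply intervalIntegral.continuous_parametric_intervalIntegral_of_continuous'
  have h3 : Continuous fun q : (ℝ × ℝ) × ℝ => K (q.1.1 + q.2) q.1.2 :=
    hK.comp (f := fun q : (ℝ × ℝ) × ℝ => (q.1.1 + q.2, q.1.2)) (by fun_prop)
  exact (Complex.continuous_ofReal.comp (by fun_prop)).mul h3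

lemma hasDerivAt_antidiagonal {F Fs Fτ : ℝ → ℝ → ℂ}
    (hs : ∀ s τ, HasDerivAt (fun s => F s τ) (Fs s τ) s)
    (hτ : ∀ s τ, HasDerivAt (fun τ => F s τ) (Fτ s τ) τ)
    (cs : Continuous fun p : ℝ × ℝ => Fs p.1 p.2) (cτ : Continuous fun p : ℝ × ℝ => Fτ p.1 p.2)
    (T s : ℝ) : HasDerivAt (fun s => F s (T - s)) (Fs s (T - s) - Fτ s (T - s)) s := by
  have h := hasStrictFDerivAt_uncurry_coprod (𝕜 := ℝ) (u := (s, T - s)) (f := F)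
    (f₁ := fun s τ => ContinuousLinearMap.toSpanSingleton ℝ (Fs s τ))
    (f₂ := fun s τ => ContinuousLinearMap.toSpanSingleton ℝ (Fτ s τ))
    (Eventually.of_forall fun v => (hs v.1 v.2).hasFDerivAt)
    (Eventually.of_forall fun v => (hτ v.1 v.2).hasFDerivAt)
    (((ContinuousLinearMap.toSpanSingletonCLE (𝕜 := ℝ) (E := ℂ)).continuous.comp cs).continuousAt)
    (((ContinuousLinearMap.toSpanSingletonCLE (𝕜 := ℝ) (E := ℂ)).continuous.comp cτ).continuousAt)
  have h1 : HasDerivAt (fun s : ℝ => (s, T - s)) ((1 : ℝ), (-1 : ℝ)) s :=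
    (hasDerivAt_id' s).prodMk (by simpa using (hasDerivAt_id' s).const_sub T)
  have h2 := h.hasFDerivAt.comp_hasDerivAt s h1
  refine h2.congr_deriv ?_
  simp [Function.HasUncurry.uncurry, sub_eq_add_neg]

/-- d'Alembert: a function with `J_ss = J_ττ` and vanishing `J(·, 0)`, `J(0, ·)` satisfies
`J_τ(T, 0) = J_s(0, T)`. -/
lemma dAlembert {J C W D K K' : ℝ → ℝ → ℂ}
    (hJs : ∀ s τ, HasDerivAt (fun s => J s τ) (W s τ) s)
    (hWs : ∀ s τ, HasDerivAt (fun s => W s τ) (K s τ) s)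
    (hJτ : ∀ s τ, HasDerivAt (fun τ => J s τ) (C s τ) τ)
    (hCτ : ∀ s τ, HasDerivAt (fun τ => C s τ) (K s τ) τ)
    (hCs : ∀ s τ, HasDerivAt (fun s => C s τ) (D s τ) s)
    (hDs : ∀ s τ, HasDerivAt (fun s => D s τ) (K' s τ) s)
    (cC : Continuous fun p : ℝ × ℝ => C p.1 p.2)
    (cK : Continuous fun p : ℝ × ℝ => K p.1 p.2) (cK' : Continuous fun p : ℝ × ℝ => K' p.1 p.2)
    (h0 : ∀ s, J s 0 = 0) (h1 : ∀ τ, J 0 τ = 0) (T : ℝ) : C T 0 = W 0 T := by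
  have cD := continuous_deriv_of_second hCs hDs cC cK'
  have hJint : ∀ s τ, J s τ = ∫ r in (0 : ℝ)..τ, C s r := by
    intro s τ
    rw [intervalIntegral.integral_eq_sub_of_hasDerivAt (fun r _ => hJτ s r), h0, sub_zero]
    exact (cC.comp (continuous_const.prodMk continuous_id)).intervalIntegrable _ _
  -- Differentiating `J = ∫ C` under the integral identifies the mixed derivatives: `D = J_τs` is
  -- also the `τ`-derivative of `W = J_s`.
  have hWint : ∀ s τ, W s τ = ∫ r in (0 : ℝ)..τ, D s r := by
    intro s τ
    refine (hJs s τ).unique ?_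
    simp_rw [hJint _ τ]
    obtain ⟨B, hB⟩ := ((isCompact_closedBall s 1).prod (isCompact_uIcc (a := (0 : ℝ)) (b := τ))).exists_bound_of_continuousOn cD.continuousOn
    refine (intervalIntegral.hasDerivAt_integral_of_dominated_loc_of_deriv_le
      (bound := fun _ => B) (F' := fun s r => D s r) (Metric.closedBall_mem_nhds s one_pos)
      (Eventually.of_forall fun x =>
        (cC.comp (continuous_const.prodMk continuous_id)).aestronglyMeasurable)
      ((cC.comp (continuous_const.prodMk continuous_id)).intervalIntegrable _ _)
      (cD.comp (continuous_const.prodMk continuous_id)).aestronglyMeasurable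
      (Eventually.of_forall fun r hr x hx =>
        hB (x, r) ⟨hx, Set.uIoc_subset_uIcc hr⟩)
      (by simp) (Eventually.of_forall fun r _ x _ => hCs x r)).2
  have hWτ : ∀ s τ, HasDerivAt (fun τ => W s τ) (D s τ) τ := by
    intro s τ
    simp_rw [hWint s]
    have c : Continuous fun r => D s r := cD.comp (continuous_const.prodMk continuous_id)
    exact intervalIntegral.integral_hasDerivAt_right (c.intervalIntegrable _ _)
      c.stronglyMeasurable.stronglyMeasurableAtFilter c.continuousAt
  have hW0 : ∀ s, W s 0 = 0 := fun s => by rw [hWint]; simp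
  have hC0 : ∀ τ, C 0 τ = 0 := fun τ => by
    have h2 : (fun τ => J 0 τ) = fun _ => 0 := funext h1
    have h3 := hJτ 0 τ
    rw [h2] at h3
    exact h3.unique (hasDerivAt_const τ 0)
  -- `J_τ + J_s` is constant along `s + τ = T`: the four terms are `D - K + K - D`. Its values at `s
  -- = T` and `s = 0` are the two sides.
  have hE : ∀ s, HasDerivAt (fun s => C s (T - s) + W s (T - s)) 0 s := by
    intro s
    refine ((hasDerivAt_antidiagonal hCs hCτ cD cK T s).add
      (hasDerivAt_antidiagonal hWs hWτ cK cD T s)).congr_deriv ?_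
    ring
  have hconst := is_const_of_deriv_eq_zero (fun s => (hE s).differentiableAt)
    (fun s => (hE s).deriv) T 0
  simpa [hW0, hC0] using hconst

end Duhamel

/-! ### Spherical means on `L^p` and the symmetry of Kirchhoff's operator. -/

/-- Spherical means of nonnegative functions. -/
noncomputable def avg (t : ℝ) (F : R3 → ℝ≥0∞) (x : R3) : ℝ≥0∞ := ∫⁻ θ, F (x + t • θ) ∂sph

lemma measurable_avg (t : ℝ) {F : R3 → ℝ≥0∞} (hF : Measurable F) : Measurable (avg t F) := by
  have : Measurable fun p : R3 × R3 => F (p.1 + t • p.2) := by fun_prop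
  exact this.lintegral_prod_right'

lemma enorm_wave_le {E : Type*} [NormedAddCommGroup E] [NormedSpace ℝ E] (t : ℝ) (f : R3 → E)
    (x : R3) : ‖wave t f x‖ₑ ≤ ENNReal.ofReal |t| * avg t (fun y => ‖f y‖ₑ) x := by
  rw [wave, enorm_smul, Real.enorm_eq_ofReal_abs]
  gcongr
  exact enorm_integral_le_lintegral_enorm _

/-- Jensen for the probability measure `sph`, then Tonelli and translation invariance. -/
lemma lintegral_avg_rpow_le (t : ℝ) {F : R3 → ℝ≥0∞} (hF : Measurable F) {p : ℝ} (hp : 1 ≤ p) :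
    ∫⁻ x, avg t F x ^ p ≤ ∫⁻ x, F x ^ p := by
  have h0 : Measurable fun q : R3 × R3 => F (q.1 + t • q.2) := by fun_prop
  have h1 : ∀ x, avg t F x ^ p ≤ ∫⁻ θ, F (x + t • θ) ^ p ∂sph := by
    intro x
    have hm : Measurable fun θ => F (x + t • θ) := by fun_prop
    have := eLpNorm'_le_eLpNorm'_of_exponent_le (μ := sph) (p := 1) (q := p) one_pos hp
      (f := fun θ => F (x + t • θ)) hm.aestronglyMeasurable
    simp only [eLpNorm', enorm_eq_self, ENNReal.rpow_one, one_div, inv_one] at this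
    calc avg t F x ^ p ≤ ((∫⁻ θ, F (x + t • θ) ^ p ∂sph) ^ p⁻¹) ^ p := by gcongr; exact this
      _ = _ := by rw [← ENNReal.rpow_mul, inv_mul_cancel₀ (by positivity), ENNReal.rpow_one]
  calc ∫⁻ x, avg t F x ^ p ≤ ∫⁻ x, ∫⁻ θ, F (x + t • θ) ^ p ∂sph := lintegral_mono h1
    _ = ∫⁻ θ, ∫⁻ x, F (x + t • θ) ^ p ∂volume ∂sph := by
        rw [lintegral_lintegral_swap]
        exact (h0.pow_const p).aemeasurable
    _ = ∫⁻ θ, ∫⁻ x, F x ^ p ∂volume ∂sph := by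
        congr 1; ext θ
        exact lintegral_add_right_eq_self (fun x => F x ^ p) (t • θ)
    _ = _ := by simp

lemma eLpNorm_eq_lintegral_ofReal {E : Type*} [NormedAddCommGroup E] (f : R3 → E) {p : ℝ}
    (hp : 0 < p) : eLpNorm f (ENNReal.ofReal p) volume = (∫⁻ x, ‖f x‖ₑ ^ p) ^ p⁻¹ := by
  rw [eLpNorm_eq_lintegral_rpow_enorm_toReal (by simpa using hp) ENNReal.ofReal_ne_top,
    ENNReal.toReal_ofReal hp.le, one_div]

lemma stronglyMeasurable_wave {E : Type*} [NormedAddCommGroup E] [NormedSpace ℝ E]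
    (t : ℝ) {f : R3 → E} (hf : StronglyMeasurable f) : StronglyMeasurable (wave t f) := by
  have : StronglyMeasurable fun p : R3 × R3 => f (p.1 + t • p.2) :=
    hf.comp_measurable (by fun_prop)
  exact this.integral_prod_right'.const_smul t

lemma eLpNorm_wave_le {E : Type*} [NormedAddCommGroup E] [NormedSpace ℝ E]
    (t : ℝ) {f : R3 → E} (hf : StronglyMeasurable f) {p : ℝ} (hp : 1 ≤ p) :
    eLpNorm (wave t f) (ENNReal.ofReal p) volume
      ≤ ENNReal.ofReal |t| * eLpNorm f (ENNReal.ofReal p) volume := by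
  have hp0 : 0 < p := by positivity
  rw [eLpNorm_eq_lintegral_ofReal _ hp0, eLpNorm_eq_lintegral_ofReal _ hp0]
  calc (∫⁻ x, ‖wave t f x‖ₑ ^ p) ^ p⁻¹
      ≤ (∫⁻ x, (ENNReal.ofReal |t| * avg t (fun y => ‖f y‖ₑ) x) ^ p) ^ p⁻¹ := by
        gcongr with x; exact enorm_wave_le t f x
    _ = (ENNReal.ofReal |t| ^ p * ∫⁻ x, avg t (fun y => ‖f y‖ₑ) x ^ p) ^ p⁻¹ := by
        simp_rw [ENNReal.mul_rpow_of_nonneg _ _ hp0.le]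
        rw [lintegral_const_mul _ ((measurable_avg t hf.enorm).pow_const p)]
    _ ≤ (ENNReal.ofReal |t| ^ p * ∫⁻ x, ‖f x‖ₑ ^ p) ^ p⁻¹ := by
        exact ENNReal.rpow_le_rpow (mul_le_mul' le_rfl (lintegral_avg_rpow_le t hf.enorm hp))
          (by positivity)
    _ = _ := by
        rw [ENNReal.mul_rpow_of_nonneg _ _ (by positivity), ← ENNReal.rpow_mul,
          mul_inv_cancel₀ hp0.ne', ENNReal.rpow_one]

lemma MeasureTheory.MemLp.wave {E : Type*} [NormedAddCommGroup E] [NormedSpace ℝ E]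
    (t : ℝ) {f : R3 → E} (hfm : StronglyMeasurable f) {p : ℝ} (hp : 1 ≤ p)
    (hf : MemLp f (ENNReal.ofReal p) volume) : MemLp (wave t f) (ENNReal.ofReal p) volume :=
  ⟨(stronglyMeasurable_wave t hfm).aestronglyMeasurable,
    (eLpNorm_wave_le t hfm hp).trans_lt (ENNReal.mul_lt_top ENNReal.ofReal_lt_top hf.2)⟩

/-- Kirchhoff's operator is symmetric. -/
lemma integral_mul_wave (t : ℝ) {f : R3 → ℂ} (hfm : StronglyMeasurable f)
    (hf : LocallyIntegrable f volume) {φ : R3 → ℝ} (hφ : Continuous φ) (hc : HasCompactSupport φ) :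
    ∫ x, f x * ((wave t φ x : ℝ) : ℂ) = ∫ x, wave t f x * (φ x : ℂ) := by
  obtain ⟨B, hB⟩ := hφ.bounded_above_of_compact_support hc
  obtain ⟨R, hR⟩ := hc.isCompact.isBounded.subset_closedBall (0 : R3)
  have hB0 : 0 ≤ B := (norm_nonneg _).trans (hB 0)
  set K := Metric.closedBall (0 : R3) (R + |t|) with hK
  -- For unit `θ` the factor `φ (x + t • θ)` vanishes unless `x` lies in `K`, so local integrability
  -- of `f` suffices.
  have hI1 : Integrable (fun p : R3 × R3 => f p.1 * (φ (p.1 + t • p.2) : ℂ)) (volume.prod sph) := by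
    have hfK : Integrable (K.indicator f) volume :=
      (hf.integrableOn_isCompact (isCompact_closedBall _ _)).integrable_indicator
        measurableSet_closedBall
    have h2 : Integrable (fun p : R3 × R3 => B * ‖K.indicator f p.1‖) (volume.prod sph) :=
      (hfK.norm.const_mul B).comp_fst sph
    refine h2.mono' ?_ ?_
    · refine AEStronglyMeasurable.mul
        (hfm.comp_measurable measurable_fst).aestronglyMeasurable
        (Continuous.aestronglyMeasurable (by fun_prop))
    · have hθ : ∀ᵐ p : R3 × R3 ∂(volume.prod sph), ‖p.2‖ = 1 :=
        Measure.quasiMeasurePreserving_snd.ae sph_ae_norm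
      filter_upwards [hθ] with p hp
      rw [norm_mul, Complex.norm_real, mul_comm]
      by_cases hpK : p.1 ∈ K
      · rw [Set.indicator_of_mem hpK]
        gcongr; exact hB _
      · have : φ (p.1 + t • p.2) = 0 := by
          by_contra h0
          have h1 := hR (subset_tsupport _ h0)
          rw [mem_closedBall_zero_iff] at h1
          apply hpK
          rw [hK, mem_closedBall_zero_iff]
          have h3 := norm_sub_le (p.1 + t • p.2) (t • p.2)
          rw [add_sub_cancel_right, norm_smul, hp, mul_one, Real.norm_eq_abs] at h3
          linarith
        rw [this]; simp; positivity
  have hI2 : Integrable (fun p : R3 × R3 => f (p.1 + t • p.2) * (φ p.1 : ℂ)) (volume.prod sph) := by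
    -- The shear `(x, θ) ↦ (x + tθ, -θ)` preserves the measure and carries the integrand of `hI1` to
    -- that of `hI2`.
    have hmp : MeasurePreserving (fun p : R3 × R3 => (p.1 + t • p.2, -p.2)) (volume.prod sph)
        (volume.prod sph) := by
      have h1 : MeasurePreserving (fun q : R3 × R3 => (-q.1, q.2 + t • q.1)) (sph.prod volume)
          (sph.prod volume) := by
        refine MeasurePreserving.skew_product (f := fun θ : R3 => -θ)
          (g := fun θ x => x + t • θ) ⟨by fun_prop, sph_map_neg⟩ (by fun_prop) ?_
        exact Eventually.of_forall fun θ => (measurePreserving_add_right volume (t • θ)).map_eq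
      exact (Measure.measurePreserving_swap.comp h1).comp Measure.measurePreserving_swap
    have h := hmp.integrable_comp_of_integrable hI1
    refine h.congr (Eventually.of_forall fun p => ?_)
    simp
  have e1 : ∀ x, f x * ((wave t φ x : ℝ) : ℂ) = t * ∫ θ, f x * (φ (x + t • θ) : ℂ) ∂sph := by
    intro x
    rw [ofReal_wave, wave, Complex.real_smul, integral_const_mul]; ring
  have e2 : ∀ x, wave t f x * (φ x : ℂ) = t * ∫ θ, f (x + t • θ) * (φ x : ℂ) ∂sph := by
    intro x
    rw [wave, Complex.real_smul, integral_mul_const]; ring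
  simp_rw [e1, e2]
  have s1 := integral_integral_swap (f := fun x θ => f x * (φ (x + t • θ) : ℂ)) hI1
  have s2 := integral_integral_swap (f := fun x θ => f (x + t • θ) * (φ x : ℂ)) hI2
  rw [integral_const_mul, integral_const_mul, s1, s2]
  congr 1
  have h3 : ∀ θ : R3, ∫ x, f (x + t • θ) * (φ x : ℂ) = ∫ x, f x * (φ (x + t • (-θ)) : ℂ) := by
    intro θ
    rw [← integral_add_right_eq_self (fun x => f x * (φ (x + t • (-θ)) : ℂ)) (t • θ)]
    simp
  simp_rw [h3]
  conv_lhs => rw [← sph_map_neg]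
  rw [integral_map (by fun_prop)]
  rw [sph_map_neg]
  exact hI1.swap.aestronglyMeasurable.integral_prod_right'

/-! ### Pairing solutions with moving test functions, and uniqueness. -/

section Pairing

variable {f : R3 → ℂ} {u : ℝ → R3 → ℂ} {ψ χ : ℝ → R3 → ℝ} {R M : ℝ}

lemma integrable_mul_of_radius {g : R3 → ℂ} (hg : LocallyIntegrable g volume) {η : R3 → ℝ} {r : ℝ}
    (hη : Continuous η) (hr : ∀ x, r < ‖x‖ → η x = 0) : Integrable fun x => g x * (η x : ℂ) := by
  have h1 := hg.integrable_smul_left_of_hasCompactSupport (g := fun x => (η x : ℂ))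
    (Complex.continuous_ofReal.comp hη) ((IsTest.hasCompactSupport_of_radius hr).comp_left
      (g := Complex.ofReal) rfl)
  simpa [mul_comm] using h1

/-- Pairings with a smoothly moving test function are differentiable. -/
lemma hasDerivAt_pairing {g : R3 → ℂ} (hg : LocallyIntegrable g volume)
    (hψ : ∀ τ, Continuous (ψ τ)) (hχ : ∀ τ, Continuous (χ τ))
    (hd : ∀ τ x, HasDerivAt (fun τ => ψ τ x) (χ τ x) τ)
    (hψR : ∀ τ x, R + |τ| < ‖x‖ → ψ τ x = 0) (hχR : ∀ τ x, R + |τ| < ‖x‖ → χ τ x = 0)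
    (hχM : ∀ τ x, |χ τ x| ≤ (1 + |τ|) * M) (τ : ℝ) :
    HasDerivAt (fun τ => ∫ x, g x * (ψ τ x : ℂ)) (∫ x, g x * (χ τ x : ℂ)) τ := by
  set K := Metric.closedBall (0 : R3) (R + (|τ| + 1)) with hK
  have hgK : Integrable (K.indicator g) volume :=
    (hg.integrableOn_isCompact (isCompact_closedBall _ _)).integrable_indicator
      measurableSet_closedBall
  have hM : 0 ≤ M := by
    have := (abs_nonneg _).trans (hχM 0 0)
    simpa using this
  refine (hasDerivAt_integral_of_dominated_loc_of_deriv_le (μ := (volume : Measure R3))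
    (𝕜 := ℝ) (E := ℂ) (x₀ := τ) (F := fun τ x => g x * (ψ τ x : ℂ))
    (F' := fun τ x => g x * (χ τ x : ℂ))
    (bound := fun x => ((2 + |τ|) * M) * ‖K.indicator g x‖)
    (s := Metric.ball τ 1) (Metric.ball_mem_nhds τ one_pos)
    (Eventually.of_forall fun s => ?_) ?_ ?_ ?_ ?_ ?_).2
  · exact hg.aestronglyMeasurable.mul
      (Complex.continuous_ofReal.comp (hψ s)).aestronglyMeasurable
  · exact integrable_mul_of_radius hg (hψ τ) (hψR τ)
  · exact hg.aestronglyMeasurable.mul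
      (Complex.continuous_ofReal.comp (hχ τ)).aestronglyMeasurable
  · refine Eventually.of_forall fun x s hs => ?_
    have hs' : |s| ≤ |τ| + 1 := by
      rw [Metric.mem_ball, Real.dist_eq] at hs
      have := abs_sub_abs_le_abs_sub s τ
      linarith
    rw [norm_mul, Complex.norm_real, Real.norm_eq_abs, mul_comm]
    by_cases hx : x ∈ K
    · rw [Set.indicator_of_mem hx]
      gcongr
      exact (hχM s x).trans (mul_le_mul_of_nonneg_right (by linarith) hM)
    · have : χ s x = 0 := hχR s x (by
        rw [hK, mem_closedBall_zero_iff, not_le] at hx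
        linarith)
      rw [this]; simp; positivity
  · exact hgK.norm.const_mul _
  · exact Eventually.of_forall fun x s _ => (hd s x).ofReal_comp.const_mul _

/-- For `τ` near `τ₀` the test functions are uniformly bounded and supported in one ball, so the
change from `u s₀` to `u s` is controlled by continuity in `L¹_loc`. The remaining dependence on `τ`
alone is `hasDerivAt_pairing`. -/
lemma continuous_pairing (hu : IsWaveSolution f u)
    (hψ : ∀ τ, Continuous (ψ τ)) (hχ : ∀ τ, Continuous (χ τ))
    (hd : ∀ τ x, HasDerivAt (fun τ => ψ τ x) (χ τ x) τ)
    (hψR : ∀ τ x, R + |τ| < ‖x‖ → ψ τ x = 0) (hχR : ∀ τ x, R + |τ| < ‖x‖ → χ τ x = 0)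
    (hψM : ∀ τ x, |ψ τ x| ≤ (1 + |τ|) * M) (hχM : ∀ τ x, |χ τ x| ≤ (1 + |τ|) * M) :
    Continuous fun p : ℝ × ℝ => ∫ x, u p.1 x * (ψ p.2 x : ℂ) := by
  have hM : 0 ≤ M := by
    have := (abs_nonneg _).trans (hψM 0 0)
    simpa using this
  rw [continuous_iff_continuousAt]
  rintro ⟨s₀, τ₀⟩
  have hsplit : (fun p : ℝ × ℝ => ∫ x, u p.1 x * (ψ p.2 x : ℂ))
      = fun p => (∫ x, (u p.1 x - u s₀ x) * (ψ p.2 x : ℂ)) + ∫ x, u s₀ x * (ψ p.2 x : ℂ) := by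
    ext p
    have i1 := integrable_mul_of_radius (hu.locallyIntegrable p.1) (hψ p.2) (hψR p.2)
    have i0 := integrable_mul_of_radius (hu.locallyIntegrable s₀) (hψ p.2) (hψR p.2)
    simp_rw [sub_mul]
    rw [integral_sub i1 i0, sub_add_cancel]
  set K := Metric.closedBall (0 : R3) (R + (|τ₀| + 1)) with hK
  have hKc : IsCompact K := isCompact_closedBall _ _
  have hlim : Tendsto (fun p : ℝ × ℝ => ((2 + |τ₀|) * M)
      * (∫⁻ x in K, ‖u p.1 x - u s₀ x‖ₑ).toReal) (𝓝 (s₀, τ₀)) (𝓝 0) := by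
    have h1 := (ENNReal.tendsto_toReal ENNReal.zero_ne_top).comp (hu.continuous_L1loc K hKc s₀)
    have h2 : Tendsto (fun p : ℝ × ℝ => p.1) (𝓝 (s₀, τ₀)) (𝓝 s₀) := continuousAt_fst
    simpa using (h1.comp h2).const_mul ((2 + |τ₀|) * M)
  have hfirst : Tendsto (fun p : ℝ × ℝ => ∫ x, (u p.1 x - u s₀ x) * (ψ p.2 x : ℂ))
      (𝓝 (s₀, τ₀)) (𝓝 0) := by
    refine squeeze_zero_norm' ?_ hlim
    have hev : ∀ᶠ p : ℝ × ℝ in 𝓝 (s₀, τ₀), |p.2| < |τ₀| + 1 :=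
      (continuous_abs.comp continuous_snd).continuousAt.eventually_lt continuousAt_const (by simp)
    filter_upwards [hev] with p hp
    have hli : LocallyIntegrable (fun x => u p.1 x - u s₀ x) volume :=
      (hu.locallyIntegrable p.1).sub (hu.locallyIntegrable s₀)
    have hi : IntegrableOn (fun x => u p.1 x - u s₀ x) K := hli.integrableOn_isCompact hKc
    have e : (∫⁻ x in K, ‖u p.1 x - u s₀ x‖ₑ).toReal = ∫ x in K, ‖u p.1 x - u s₀ x‖ :=
      (integral_norm_eq_lintegral_enorm hi.aestronglyMeasurable).symm
    rw [e, ← integral_const_mul, ← integral_indicator hKc.measurableSet]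
    refine norm_integral_le_of_norm_le ?_ (Eventually.of_forall fun x => ?_)
    · exact (integrable_indicator_iff hKc.measurableSet).2 (hi.norm.const_mul _)
    · rw [norm_mul, Complex.norm_real, Real.norm_eq_abs, mul_comm]
      by_cases hx : x ∈ K
      · rw [Set.indicator_of_mem hx]
        gcongr
        exact (hψM p.2 x).trans (mul_le_mul_of_nonneg_right (by linarith) hM)
      · have : ψ p.2 x = 0 := hψR _ x (by
          rw [hK, mem_closedBall_zero_iff, not_le] at hx
          linarith)
        rw [this, Set.indicator_of_notMem hx]; simp
  have hsecond : Tendsto (fun p : ℝ × ℝ => ∫ x, u s₀ x * (ψ p.2 x : ℂ)) (𝓝 (s₀, τ₀))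
      (𝓝 (∫ x, u s₀ x * (ψ τ₀ x : ℂ))) := by
    have h1 := (hasDerivAt_pairing (hu.locallyIntegrable s₀) hψ hχ hd hψR hχR hχM τ₀).continuousAt
    have h2 : Tendsto (fun p : ℝ × ℝ => p.2) (𝓝 (s₀, τ₀)) (𝓝 τ₀) := continuousAt_snd
    exact h1.tendsto.comp h2
  unfold ContinuousAt
  rw [hsplit]
  simpa using hfirst.add hsecond

end Pairing

lemma IsTest.waveDeriv_zero {φ : R3 → ℝ} (h : IsTest φ) (x : R3) :
    _root_.waveDeriv 0 φ x = φ x := by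
  have h1 := h.ofReal_waveDeriv_eq 0 x
  have h2 : multOp (cosSymbol 0) h.schwartz x = h.schwartz x := by
    have h3 : 𝓕⁻ (𝓕 h.schwartz) = h.schwartz := FourierTransform.fourierInv_fourier_eq _
    conv_rhs => rw [← h3]
    rw [SchwartzMap.fourierInv_coe, multOp]
    simp [cosSymbol]
  rw [h2, h.schwartz_apply] at h1
  exact_mod_cast h1

/-- Weak solutions are tested by the propagated test function. -/
lemma IsWaveSolution.integral_mul_eq {f : R3 → ℂ} {u : ℝ → R3 → ℂ} (hu : IsWaveSolution f u)
    {φ : R3 → ℝ} (hφ : IsTest φ) (T : ℝ) :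
    ∫ x, u T x * (φ x : ℂ) = ∫ x, f x * ((wave T φ x : ℝ) : ℂ) := by
  obtain ⟨R, -, hR⟩ := hφ.exists_radius
  have hRΔ : ∀ y, R < ‖y‖ → (Δ φ) y = 0 := by
    intro y hy
    have h0 : φ =ᶠ[𝓝 y] fun _ => 0 := by
      have : ∀ᶠ z in 𝓝 y, R < ‖z‖ :=
        continuousAt_const.eventually_lt continuous_norm.continuousAt hy
      filter_upwards [this] with z hz using hR z hz
    rw [(InnerProductSpace.laplacian_congr_nhds h0).self_of_nhds]
    simp [InnerProductSpace.laplacian_eq_iteratedFDeriv_stdOrthonormalBasis]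
  obtain ⟨M₁, hM₁⟩ := hφ.abs_wave_le
  obtain ⟨M₂, hM₂⟩ := hφ.abs_waveDeriv_le
  obtain ⟨M₃, hM₃⟩ := hφ.laplacian.abs_wave_le
  obtain ⟨M₄, hM₄⟩ := hφ.laplacian.abs_waveDeriv_le
  obtain ⟨M₅, hM₅⟩ := hφ.laplacian.laplacian.abs_wave_le
  -- `low` and `low'` put the bounds `|t| M` for `wave` and `M` for `waveDeriv` in the common shape
  -- `(1 + |t|) M'` required by the pairing lemmas.
  have low : ∀ {M : ℝ} {ψ : ℝ → R3 → ℝ}, (∀ t x, |ψ t x| ≤ |t| * M) →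
      ∀ M', |M| ≤ M' → ∀ t x, |ψ t x| ≤ (1 + |t|) * M' := by
    intro M ψ h M' hM t x
    have h1 := h t x
    have h2 := abs_nonneg t
    have h3 := (le_abs_self M).trans hM
    have h4 := (abs_nonneg M).trans hM
    nlinarith
  have low' : ∀ {M : ℝ} {ψ : ℝ → R3 → ℝ}, (∀ t x, |ψ t x| ≤ M) →
      ∀ M', |M| ≤ M' → ∀ t x, |ψ t x| ≤ (1 + |t|) * M' := by
    intro M ψ h M' hM t x
    have h1 := h t x
    have h2 := abs_nonneg t
    have h3 := (le_abs_self M).trans hM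
    have h4 := (abs_nonneg M).trans hM
    nlinarith
  set M := |M₁| + |M₂| + |M₃| + |M₄| + |M₅| with hM
  have p1 := abs_nonneg M₁
  have p2 := abs_nonneg M₂
  have p3 := abs_nonneg M₃
  have p4 := abs_nonneg M₄
  have p5 := abs_nonneg M₅
  have b1 := low hM₁ M (by linarith)
  have b2 := low' hM₂ M (by linarith)
  have b3 := low hM₃ M (by linarith)
  have b4 := low' hM₄ M (by linarith)
  have b5 := low hM₅ M (by linarith)
  have c1 : ∀ τ, Continuous (wave τ φ) := fun τ => (hφ.wave τ).1.continuous
  have c2 : ∀ τ, Continuous (waveDeriv τ φ) := fun τ => (hφ.waveDeriv τ).1.continuous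
  have c3 : ∀ τ, Continuous (wave τ (Δ φ)) := fun τ => (hφ.laplacian.wave τ).1.continuous
  have c4 : ∀ τ, Continuous (waveDeriv τ (Δ φ)) := fun τ => (hφ.laplacian.waveDeriv τ).1.continuous
  have c5 : ∀ τ, Continuous (wave τ (Δ (Δ φ))) := fun τ =>
    (hφ.laplacian.laplacian.wave τ).1.continuous
  have r1 : ∀ τ x, R + |τ| < ‖x‖ → wave τ φ x = 0 := fun τ x h => wave_eq_zero hR h
  have r2 : ∀ τ x, R + |τ| < ‖x‖ → waveDeriv τ φ x = 0 := fun τ x h =>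
    IsTest.waveDeriv_eq_zero hR h
  have r3 : ∀ τ x, R + |τ| < ‖x‖ → wave τ (Δ φ) x = 0 := fun τ x h => wave_eq_zero hRΔ h
  have r4 : ∀ τ x, R + |τ| < ‖x‖ → waveDeriv τ (Δ φ) x = 0 := fun τ x h =>
    IsTest.waveDeriv_eq_zero hRΔ h
  have r5 : ∀ τ x, R + |τ| < ‖x‖ → wave τ (Δ (Δ φ)) x = 0 := by
    intro τ x h
    refine wave_eq_zero (R := R) (fun y hy => ?_) h
    have h0 : Δ φ =ᶠ[𝓝 y] fun _ => 0 := by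
      have : ∀ᶠ z in 𝓝 y, R < ‖z‖ :=
        continuousAt_const.eventually_lt continuous_norm.continuousAt hy
      filter_upwards [this] with z hz using hRΔ z hz
    rw [(InnerProductSpace.laplacian_congr_nhds h0).self_of_nhds]
    simp [InnerProductSpace.laplacian_eq_iteratedFDeriv_stdOrthonormalBasis]
  choose W hW1 hW2 hW3 using fun τ => hu.weak_equation _ (hφ.wave τ).1 (hφ.wave τ).2
  choose D hD1 hD2 hD3 using fun τ => hu.weak_equation _ (hφ.waveDeriv τ).1 (hφ.waveDeriv τ).2
  simp_rw [hφ.laplacian_wave] at hW2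
  simp_rw [hφ.laplacian_waveDeriv] at hD2
  -- Here `J(s, τ) = ⟨u(s), wave τ φ⟩`. Derivatives in `s` come from the weak equation, those in `τ`
  -- from the propagated test function; `J` vanishes at `τ = 0` since `wave 0 = 0`, and at `s = 0`
  -- by the initial condition.
  have key := dAlembert (J := fun s τ => ∫ x, u s x * ((wave τ φ x : ℝ) : ℂ))
    (C := fun s τ => ∫ x, u s x * ((waveDeriv τ φ x : ℝ) : ℂ))
    (W := fun s τ => W τ s) (D := fun s τ => D τ s)
    (K := fun s τ => ∫ x, u s x * ((wave τ (Δ φ) x : ℝ) : ℂ))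
    (K' := fun s τ => ∫ x, u s x * ((waveDeriv τ (Δ φ) x : ℝ) : ℂ))
    (fun s τ => hW1 τ s) (fun s τ => hW2 τ s)
    (fun s τ => hasDerivAt_pairing (hu.locallyIntegrable s) c1 c2 hφ.hasDerivAt_wave r1 r2 b2 τ)
    (fun s τ => hasDerivAt_pairing (hu.locallyIntegrable s) c2 c3 hφ.hasDerivAt_waveDeriv r2 r3 b3 τ)
    (fun s τ => hD1 τ s) (fun s τ => hD2 τ s)
    (continuous_pairing hu c2 c3 hφ.hasDerivAt_waveDeriv r2 r3 b2 b3)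
    (continuous_pairing hu c3 c4 hφ.laplacian.hasDerivAt_wave r3 r4 b3 b4)
    (continuous_pairing hu c4 c5 hφ.laplacian.hasDerivAt_waveDeriv r4 r5 b4 b5)
    (fun s => by simp [wave])
    (fun τ => by
      refine integral_eq_zero_of_ae ?_
      filter_upwards [hu.initial_position] with x hx
      simp [hx]) T
  simp only [hφ.waveDeriv_zero, hW3] at key
  exact key

/-- Uniqueness of weak solutions: they are given by Kirchhoff's formula. -/
theorem IsWaveSolution.ae_eq_wave {f : R3 → ℂ} {u : ℝ → R3 → ℂ} (hu : IsWaveSolution f u)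
    (hfm : StronglyMeasurable f) {p : ℝ} (hp : 1 ≤ p) (hf : MemLp f (ENNReal.ofReal p) volume)
    (t : ℝ) : u t =ᵐ[volume] wave t f := by
  have hp' : (1 : ℝ≥0∞) ≤ ENNReal.ofReal p := by
    rw [← ENNReal.ofReal_one]; exact ENNReal.ofReal_le_ofReal hp
  refine ae_eq_of_integral_contDiff_smul_eq (hu.locallyIntegrable t)
    ((hf.wave t hfm hp).locallyIntegrable hp') fun φ hφ hc => ?_
  have h1 := hu.integral_mul_eq ⟨hφ, hc⟩ t
  rw [integral_mul_wave t hfm (hf.locallyIntegrable hp') hφ.continuous hc] at h1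
  simp_rw [Complex.real_smul, mul_comm ((φ _ : ℝ) : ℂ)]
  exact h1

lemma IsWaveSolution.congr_data {f f' : R3 → ℂ} {u : ℝ → R3 → ℂ} (hu : IsWaveSolution f u)
    (h : f =ᵐ[volume] f') : IsWaveSolution f' u := by
  refine ⟨hu.1, hu.2, hu.3, fun φ hφ hc => ?_⟩
  obtain ⟨w, h1, h2, h3⟩ := hu.weak_equation φ hφ hc
  refine ⟨w, h1, h2, h3.trans (integral_congr_ae ?_)⟩
  filter_upwards [h] with x hx
  rw [hx]

/-! ### Integrals of powers of the norm in polar coordinates. -/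

lemma lintegral_radial {g : ℝ → ℝ≥0∞} (hg : Measurable g) :
    ∫⁻ x : R3, g ‖x‖
      = ENNReal.ofReal (4 * Real.pi) * ∫⁻ r in Set.Ioi (0 : ℝ), ENNReal.ofReal (r ^ 2) * g r := by
  have hd : Module.finrank ℝ R3 = 3 := by simp
  have hmp := (volume : Measure R3).measurePreserving_homeomorphUnitSphereProd
  rw [hd] at hmp
  have e1 : ∫⁻ x : R3, g ‖x‖
      = ∫⁻ x : ({(0 : R3)}ᶜ : Set R3), g ‖x.1‖ ∂((volume : Measure R3).comap (↑)) := by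
    rw [lintegral_subtype_comap (measurableSet_singleton _).compl fun x => g ‖x‖,
      restrict_compl_singleton]
  have e2 := hmp.lintegral_comp (f := fun p : Metric.sphere (0 : R3) 1 × Set.Ioi (0 : ℝ) => g p.2)
    (by fun_prop)
  have e3 : ∀ x : ({(0 : R3)}ᶜ : Set R3), g (((homeomorphUnitSphereProd R3) x).2 : ℝ) = g ‖x.1‖ :=
    fun x => by simp
  simp_rw [e3] at e2
  rw [e1, e2, lintegral_prod _ (by fun_prop)]
  simp only [lintegral_const, Measure.toSphere_apply_univ, hd, volume_ball_one_R3]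
  rw [mul_comm]
  congr 1
  · rw [← ENNReal.ofReal_natCast, ← ENNReal.ofReal_mul (by positivity)]
    congr 1; push_cast; ring
  · rw [Measure.volumeIoiPow, lintegral_withDensity_eq_lintegral_mul _ (by fun_prop) (by fun_prop)]
    exact lintegral_subtype_comap measurableSet_Ioi fun r => ENNReal.ofReal (r ^ 2) * g r

lemma lintegral_ball_inv_sq_le (A : ℝ) :
    ∫⁻ x : R3 in Metric.ball 0 A, ENNReal.ofReal (‖x‖ ^ (-2 : ℤ)) ≤ ENNReal.ofReal (4 * Real.pi * A) := by
  have h1 : ∫⁻ x : R3 in Metric.ball 0 A, ENNReal.ofReal (‖x‖ ^ (-2 : ℤ))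
      = ∫⁻ x : R3, (Set.Iio A).indicator (fun r => ENNReal.ofReal (r ^ (-2 : ℤ))) ‖x‖ := by
    rw [← lintegral_indicator measurableSet_ball]
    congr 1; ext x
    simp [Set.indicator]
  rw [h1, lintegral_radial ((by fun_prop : Measurable fun r : ℝ =>
    ENNReal.ofReal (r ^ (-2 : ℤ))).indicator measurableSet_Iio), ENNReal.ofReal_mul (p := 4 * Real.pi) (by positivity)]
  refine mul_le_mul' le_rfl ?_
  calc _ ≤ ∫⁻ r in Set.Ioi (0 : ℝ), (Set.Ioo 0 A).indicator (fun _ => 1) r := by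
        refine setLIntegral_mono' measurableSet_Ioi fun r (hr : 0 < r) => ?_
        by_cases hrA : r < A
        · rw [Set.indicator_of_mem (by exact hrA), Set.indicator_of_mem (by exact ⟨hr, hrA⟩),
            ← ENNReal.ofReal_mul (by positivity), ← ENNReal.ofReal_one]
          apply ENNReal.ofReal_le_ofReal
          rw [zpow_neg, zpow_ofNat, mul_inv_cancel₀ (by positivity)]
        · rw [Set.indicator_of_notMem (by exact hrA)]; simp
    _ ≤ ∫⁻ r, (Set.Ioo 0 A).indicator (fun _ => 1) r := setLIntegral_le_lintegral _ _
    _ = ENNReal.ofReal A := by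
        rw [lintegral_indicator measurableSet_Ioo]; simp

lemma lintegral_ball_inv_le {A : ℝ} (hA : 0 ≤ A) :
    ∫⁻ x : R3 in Metric.ball 0 A, ENNReal.ofReal (‖x‖⁻¹) ≤ ENNReal.ofReal (4 * Real.pi * A ^ 2) := by
  calc _ ≤ ∫⁻ x : R3 in Metric.ball 0 A, ENNReal.ofReal A * ENNReal.ofReal (‖x‖ ^ (-2 : ℤ)) := by
        refine setLIntegral_mono' measurableSet_ball fun x hx => ?_
        rw [mem_ball_zero_iff] at hx
        rw [← ENNReal.ofReal_mul hA]
        apply ENNReal.ofReal_le_ofReal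
        rcases eq_or_ne ‖x‖ 0 with h0 | h0
        · rw [h0]; simp
        · have : 0 < ‖x‖ := lt_of_le_of_ne (norm_nonneg x) h0.symm
          rw [zpow_neg, zpow_ofNat, ← div_eq_mul_inv, le_div_iff₀ (by positivity), sq,
            inv_mul_cancel_left₀ h0]
          exact hx.le
    _ ≤ ENNReal.ofReal A * ENNReal.ofReal (4 * Real.pi * A) := by
        rw [lintegral_const_mul _ (by fun_prop)]
        gcongr; exact lintegral_ball_inv_sq_le A
    _ = _ := by rw [← ENNReal.ofReal_mul hA]; congr 1; ring

lemma lintegral_compl_ball_inv_pow_four_le {A : ℝ} (hA : 0 < A) :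
    ∫⁻ x : R3 in (Metric.ball 0 A)ᶜ, ENNReal.ofReal (‖x‖ ^ (-4 : ℤ))
      ≤ ENNReal.ofReal (4 * Real.pi / A) := by
  have h1 : ∫⁻ x : R3 in (Metric.ball 0 A)ᶜ, ENNReal.ofReal (‖x‖ ^ (-4 : ℤ))
      = ∫⁻ x : R3, (Set.Ici A).indicator (fun r => ENNReal.ofReal (r ^ (-4 : ℤ))) ‖x‖ := by
    rw [← lintegral_indicator measurableSet_ball.compl]
    congr 1; ext x
    simp [Set.indicator]
  rw [h1, lintegral_radial ((by fun_prop : Measurable fun r : ℝ =>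
    ENNReal.ofReal (r ^ (-4 : ℤ))).indicator measurableSet_Ici), div_eq_mul_inv,
    ENNReal.ofReal_mul (p := 4 * Real.pi) (by positivity)]
  refine mul_le_mul' le_rfl ?_
  calc _ ≤ ∫⁻ r in Set.Ioi (0 : ℝ), (Set.Ici A).indicator (fun r => ENNReal.ofReal (r ^ (-2 : ℝ))) r := by
        refine setLIntegral_mono' measurableSet_Ioi fun r (hr : 0 < r) => ?_
        by_cases hrA : A ≤ r
        · rw [Set.indicator_of_mem (by exact hrA), Set.indicator_of_mem (by exact hrA),
            ← ENNReal.ofReal_mul (by positivity)]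
          apply ENNReal.ofReal_le_ofReal
          rw [Real.rpow_neg hr.le, Real.rpow_ofNat, zpow_neg, zpow_ofNat]
          apply le_of_eq
          field_simp
        · rw [Set.indicator_of_notMem (by exact hrA)]; simp
    _ ≤ ∫⁻ r, (Set.Ici A).indicator (fun r => ENNReal.ofReal (r ^ (-2 : ℝ))) r :=
        setLIntegral_le_lintegral _ _
    _ = ENNReal.ofReal A⁻¹ := by
        rw [lintegral_indicator measurableSet_Ici, Measure.restrict_congr_set Ioi_ae_eq_Ici.symm,
          ← ofReal_integral_eq_lintegral_ofReal, integral_Ioi_rpow_of_lt (by norm_num) hA]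
        · norm_num [Real.rpow_neg_one]
        · exact integrableOn_Ioi_rpow_of_lt (by norm_num) hA
        · exact (ae_restrict_iff' measurableSet_Ioi).2 (Eventually.of_forall fun r hr =>
            Real.rpow_nonneg (hA.le.trans (le_of_lt hr)) _)

/-! ### The Fourier transform on `L²` against the one on `L¹`, and Plancherel. -/

lemma integral_fourier_smul_comm {f g : R3 → ℂ} (hf : Integrable f) (hg : Integrable g) :
    ∫ x, 𝓕 f x • g x = ∫ x, f x • 𝓕 g x := by
  simpa using! (VectorFourier.integral_fourierIntegral_smul_eq_flip (L := innerₗ R3)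
    Real.continuous_fourierChar continuous_inner hf hg)

/-- The `L²` and `L¹` Fourier transforms agree. -/
lemma fourier_toLp_ae_eq {h : R3 → ℂ} (h2 : MemLp h 2 volume) (h1 : Integrable h) :
    (𝓕 (h2.toLp h) : Lp ℂ 2 volume) =ᵐ[volume] 𝓕 h := by
  refine ae_eq_of_integral_contDiff_smul_eq
    ((Lp.memLp _).locallyIntegrable (by norm_num))
    (Continuous.locallyIntegrable (VectorFourier.fourierIntegral_continuous
      Real.continuous_fourierChar continuous_inner h1)) fun φ hφ hc => ?_
  have hT : IsTest φ := ⟨hφ, hc⟩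
  have e1 := Lp.fourier_toTemperedDistribution_eq (h2.toLp h)
  have e2 := congrArg (fun S : TemperedDistribution R3 ℂ => S hT.schwartz) e1
  simp only [TemperedDistribution.fourier_apply, Lp.toTemperedDistribution_apply] at e2
  calc ∫ x, φ x • (𝓕 (h2.toLp h) : Lp ℂ 2 volume) x
      = ∫ x, hT.schwartz x • (𝓕 (h2.toLp h) : Lp ℂ 2 volume) x := by
        simp_rw [hT.schwartz_apply, Complex.real_smul, smul_eq_mul]
    _ = ∫ x, 𝓕 hT.schwartz x • (h2.toLp h) x := e2.symm
    _ = ∫ x, 𝓕 hT.schwartz x • h x := by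
        refine integral_congr_ae ?_
        filter_upwards [h2.coeFn_toLp] with x hx
        rw [hx]
    _ = ∫ x, hT.schwartz x • 𝓕 h x :=
        integral_fourier_smul_comm hT.schwartz.integrable h1
    _ = _ := by simp_rw [hT.schwartz_apply, Complex.real_smul, smul_eq_mul]

/-- Testing against smooth functions identifies the `L²` inverse transform with the integral one,
whose modulus is at most the `L¹` norm. -/
lemma norm_fourierInv_toLp_le {h : R3 → ℂ} (h2 : MemLp h 2 volume) (h1 : Integrable h) :
    ∀ᵐ x, ‖(𝓕⁻ (h2.toLp h) : Lp ℂ 2 volume) x‖ ≤ ∫ ξ, ‖h ξ‖ := by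
  have key : (𝓕⁻ (h2.toLp h) : Lp ℂ 2 volume) =ᵐ[volume] 𝓕⁻ h := by
    have hc : Continuous (𝓕⁻ h) := by
      have : 𝓕⁻ h = fun x => 𝓕 h (-x) := by ext x; rw [Real.fourierInv_eq_fourier_neg]
      rw [this]
      exact (VectorFourier.fourierIntegral_continuous
        Real.continuous_fourierChar continuous_inner h1).comp continuous_neg
    refine ae_eq_of_integral_contDiff_smul_eq
      ((Lp.memLp _).locallyIntegrable (by norm_num)) hc.locallyIntegrable fun φ hφ hcs => ?_
    have hT : IsTest φ := ⟨hφ, hcs⟩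
    have e1 := Lp.fourierInv_toTemperedDistribution_eq (h2.toLp h)
    have e2 := congrArg (fun S : TemperedDistribution R3 ℂ => S hT.schwartz) e1
    simp only [TemperedDistribution.fourierInv_apply, Lp.toTemperedDistribution_apply] at e2
    calc ∫ x, φ x • (𝓕⁻ (h2.toLp h) : Lp ℂ 2 volume) x
        = ∫ x, hT.schwartz x • (𝓕⁻ (h2.toLp h) : Lp ℂ 2 volume) x := by
          simp_rw [hT.schwartz_apply, Complex.real_smul, smul_eq_mul]
      _ = ∫ x, 𝓕⁻ hT.schwartz x • (h2.toLp h) x := e2.symm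
      _ = ∫ x, 𝓕⁻ hT.schwartz x • h x := by
          refine integral_congr_ae ?_
          filter_upwards [h2.coeFn_toLp] with x hx
          rw [hx]
      -- A reflection turns inverse transforms into transforms, to which the exchange formula
      -- applies.
      _ = ∫ x, 𝓕 hT.schwartz x • h (-x) := by
          rw [← integral_neg_eq_self]
          congr 1; ext x
          rw [SchwartzMap.fourierInv_coe, Real.fourierInv_eq_fourier_neg, neg_neg,
            SchwartzMap.fourier_coe]
      _ = ∫ x, hT.schwartz x • 𝓕 (fun y => h (-y)) x :=
          integral_fourier_smul_comm hT.schwartz.integrable h1.comp_neg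
      _ = ∫ x, φ x • 𝓕⁻ h x := by
          simp_rw [hT.schwartz_apply, Complex.real_smul, smul_eq_mul]
          congr 1; ext x
          rw [Real.fourierInv_eq_fourier_comp_neg]
  filter_upwards [key] with x hx
  rw [hx, Real.fourierInv_eq]
  refine (norm_integral_le_integral_norm _).trans_eq ?_
  simp

lemma lintegral_mul_sq_le {α : Type*} [MeasurableSpace α] {μ : Measure α} {f g : α → ℝ≥0∞}
    (hf : AEMeasurable f μ) (hg : AEMeasurable g μ) :
    (∫⁻ a, f a * g a ∂μ) ^ 2 ≤ (∫⁻ a, f a ^ 2 ∂μ) * ∫⁻ a, g a ^ 2 ∂μ := by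
  have h := ENNReal.lintegral_mul_le_Lp_mul_Lq μ Real.HolderConjugate.two_two hf hg
  simp only [Pi.mul_apply, ENNReal.rpow_ofNat] at h
  calc _ ≤ ((∫⁻ a, f a ^ 2 ∂μ) ^ (1 / 2 : ℝ) * (∫⁻ a, g a ^ 2 ∂μ) ^ (1 / 2 : ℝ)) ^ 2 := by
        gcongr
    _ = _ := by
        rw [mul_pow, ← ENNReal.rpow_natCast, ← ENNReal.rpow_natCast, ← ENNReal.rpow_mul,
          ← ENNReal.rpow_mul]
        norm_num

lemma eLpNorm_two_sq {E : Type*} [NormedAddCommGroup E] (f : R3 → E) :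
    eLpNorm f 2 volume ^ 2 = ∫⁻ x, ‖f x‖ₑ ^ 2 := by
  rw [eLpNorm_eq_lintegral_rpow_enorm_toReal (by simp) (by simp)]
  simp only [ENNReal.toReal_ofNat, ENNReal.rpow_ofNat, one_div]
  rw [← ENNReal.rpow_natCast, ← ENNReal.rpow_mul]
  norm_num

lemma lintegral_fourierInv_sq (g : Lp ℂ 2 (volume : Measure R3)) :
    ∫⁻ x, ‖(𝓕⁻ g : Lp ℂ 2 volume) x‖ₑ ^ 2 = ∫⁻ x, ‖g x‖ₑ ^ 2 := by
  have h1 : ‖(𝓕⁻ g : Lp ℂ 2 (volume : Measure R3))‖ₑ = ‖g‖ₑ := by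
    have h2 := Lp.norm_fourier_eq (𝓕⁻ g)
    rw [FourierTransform.fourier_fourierInv_eq] at h2
    rw [← ofReal_norm, ← ofReal_norm, h2]
  rw [← eLpNorm_two_sq, ← eLpNorm_two_sq, ← Lp.enorm_def, ← Lp.enorm_def, h1]

lemma lintegral_fourier_sq {h : R3 → ℂ} (hh : MemLp h 2 volume) :
    ∫⁻ x, ‖(𝓕 (hh.toLp h) : Lp ℂ 2 volume) x‖ₑ ^ 2 = ∫⁻ x, ‖h x‖ₑ ^ 2 := by
  rw [← lintegral_fourierInv_sq, FourierTransform.fourierInv_fourier_eq]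
  refine lintegral_congr_ae ?_
  filter_upwards [hh.coeFn_toLp] with x hx
  rw [hx]

/-! ### The homogeneous Sobolev inequality through level sets. -/

/-- Splitting frequencies at radius `A` controls the level sets. -/
lemma level_set_le {h : R3 → ℂ} (hh : MemLp h 2 volume) {A l : ℝ} (hA : 0 ≤ A) (hl : 0 < l)
    (hAl : ENNReal.ofReal (4 * Real.pi * A ^ 2)
      * ∫⁻ ξ, ‖ξ‖ₑ * ‖(𝓕 (hh.toLp h) : Lp ℂ 2 volume) ξ‖ₑ ^ 2 ≤ ENNReal.ofReal (l / 4) ^ 2) :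
    volume {x | l < ‖h x‖} * ENNReal.ofReal (l ^ 2) ≤
      4 * ∫⁻ ξ in (Metric.ball 0 A)ᶜ, ‖(𝓕 (hh.toLp h) : Lp ℂ 2 volume) ξ‖ₑ ^ 2 := by
  set H := (𝓕 (hh.toLp h) : Lp ℂ 2 (volume : Measure R3)) with hH
  have hHm : MemLp H 2 volume := Lp.memLp H
  have hb : MeasurableSet (Metric.ball (0 : R3) A) := measurableSet_ball
  have hG : MemLp ((Metric.ball (0 : R3) A).indicator H) 2 volume := hHm.indicator hb
  have hG' : MemLp ((Metric.ball (0 : R3) A)ᶜ.indicator H) 2 volume := hHm.indicator hb.compl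
  have hHe : AEMeasurable (fun ξ => ‖H ξ‖ₑ) volume := hHm.1.enorm
  -- Cauchy–Schwarz after inserting `‖ξ‖^(-1/2) ‖ξ‖^(1/2)`: the hypothesis on `A` makes the
  -- low-frequency part at most `l / 4` in absolute value.
  have hlow : ∫⁻ ξ, ‖(Metric.ball (0 : R3) A).indicator H ξ‖ₑ ≤ ENNReal.ofReal (l / 4) := by
    refine (ENNReal.pow_le_pow_left_iff two_ne_zero).1 (le_trans ?_ hAl)
    have e1 : ∫⁻ ξ, ‖(Metric.ball (0 : R3) A).indicator H ξ‖ₑ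
        = ∫⁻ ξ in Metric.ball (0 : R3) A, (ENNReal.ofReal (√(‖ξ‖⁻¹))) *
          (ENNReal.ofReal (√‖ξ‖) * ‖H ξ‖ₑ) := by
      simp_rw [enorm_indicator_eq_indicator_enorm]
      rw [lintegral_indicator hb]
      have h0 : ∀ᵐ ξ : R3, ξ ≠ 0 := by rw [ae_iff]; simp
      refine lintegral_congr_ae ?_
      filter_upwards [ae_restrict_of_ae h0] with ξ hξ
      rw [← mul_assoc, ← ENNReal.ofReal_mul (by positivity), ← Real.sqrt_mul (by positivity),
        inv_mul_cancel₀ (norm_ne_zero_iff.2 hξ)]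
      simp
    rw [e1]
    refine (lintegral_mul_sq_le (by fun_prop) (by fun_prop)).trans ?_
    have e2 : ∀ ξ : R3, ENNReal.ofReal (√(‖ξ‖⁻¹)) ^ 2 = ENNReal.ofReal (‖ξ‖⁻¹) := fun ξ => by
      rw [← ENNReal.ofReal_pow (by positivity), Real.sq_sqrt (by positivity)]
    have e3 : ∀ ξ : R3, (ENNReal.ofReal (√‖ξ‖) * ‖H ξ‖ₑ) ^ 2 = ‖ξ‖ₑ * ‖H ξ‖ₑ ^ 2 := fun ξ => by
      rw [mul_pow, ← ENNReal.ofReal_pow (by positivity), Real.sq_sqrt (by positivity),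
        ofReal_norm]
    simp_rw [e2, e3]
    exact mul_le_mul' (lintegral_ball_inv_le hA) (setLIntegral_le_lintegral _ _)
  have hGi : Integrable ((Metric.ball (0 : R3) A).indicator H) volume :=
    ⟨hG.1, hlow.trans_lt ENNReal.ofReal_lt_top⟩
  have hlow' : ∫ ξ, ‖(Metric.ball (0 : R3) A).indicator H ξ‖ ≤ l / 4 := by
    rw [integral_norm_eq_lintegral_enorm hG.1]
    exact ENNReal.toReal_le_of_le_ofReal (by positivity) hlow
  have hsum : hh.toLp h = 𝓕⁻ (hG.toLp _) + 𝓕⁻ (hG'.toLp _) := by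
    have h1 : H = hG.toLp _ + hG'.toLp _ := by
      rw [← MemLp.toLp_add]
      ext1
      filter_upwards [(hG.add hG').coeFn_toLp] with x hx
      rw [hx, Set.indicator_self_add_compl]
    rw [← FourierTransform.fourierInv_add, ← h1, hH, FourierTransform.fourierInv_fourier_eq]
  set high := (𝓕⁻ (hG'.toLp _) : Lp ℂ 2 (volume : Measure R3)) with hhigh
  have hae : ∀ᵐ x, ‖h x‖ ≤ l / 4 + ‖high x‖ := by
    filter_upwards [hh.coeFn_toLp, norm_fourierInv_toLp_le hG hGi,
      Lp.coeFn_add (𝓕⁻ (hG.toLp _)) high] with x h1 h2 h3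
    rw [← h1, hsum, h3, Pi.add_apply]
    exact (norm_add_le _ _).trans (add_le_add_left (h2.trans hlow') _)
  -- Where `‖h‖ > l`, the high-frequency part exceeds `3l/4`; the weaker threshold `l/2` accounts
  -- for the factor `4`.
  have hmeas : volume {x | l < ‖h x‖} ≤ volume {x | ENNReal.ofReal ((l / 2) ^ 2) ≤ ‖high x‖ₑ ^ 2} := by
    refine measure_mono_ae ?_
    filter_upwards [hae] with x hx (hlx : l < ‖h x‖)
    change _ ≤ _
    rw [← ofReal_norm, ← ENNReal.ofReal_pow (norm_nonneg _)]
    apply ENNReal.ofReal_le_ofReal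
    gcongr
    linarith
  calc volume {x | l < ‖h x‖} * ENNReal.ofReal (l ^ 2)
      ≤ volume {x | ENNReal.ofReal ((l / 2) ^ 2) ≤ ‖high x‖ₑ ^ 2} * ENNReal.ofReal (l ^ 2) := by
        gcongr
    _ = 4 * (ENNReal.ofReal ((l / 2) ^ 2)
          * volume {x | ENNReal.ofReal ((l / 2) ^ 2) ≤ ‖high x‖ₑ ^ 2}) := by
        have : ENNReal.ofReal (l ^ 2) = 4 * ENNReal.ofReal ((l / 2) ^ 2) := by
          rw [← ENNReal.ofReal_ofNat, ← ENNReal.ofReal_mul (by norm_num)]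
          congr 1; ring
        rw [this]; ring
    _ ≤ 4 * ∫⁻ x, ‖high x‖ₑ ^ 2 := by
        gcongr
        exact mul_meas_ge_le_lintegral₀ ((Lp.aestronglyMeasurable high).enorm.pow_const 2) _
    _ = _ := by
        rw [hhigh, lintegral_fourierInv_sq, ← lintegral_indicator hb.compl]
        congr 1
        refine lintegral_congr_ae ?_
        filter_upwards [hG'.coeFn_toLp] with x hx
        rw [hx]
        by_cases hxb : x ∈ (Metric.ball (0 : R3) A)ᶜ
        · simp only [Set.indicator_of_mem hxb]
        · simp only [Set.indicator_of_notMem hxb]; simp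

/-- The homogeneous Sobolev inequality for the exponents `1/2` and `3`. -/
lemma sobolev_three : ∃ C : ℝ≥0, 0 < C ∧ ∀ (h : R3 → ℂ) (hh : MemLp h 2 volume),
    eLpNorm h 3 volume ≤
      C * (∫⁻ ξ, ‖ξ‖ₑ * ‖(𝓕 (hh.toLp h) : Lp ℂ 2 volume) ξ‖ₑ ^ 2) ^ (1 / 2 : ℝ) := by
  -- With `A = l/(cN)` and `c² = 64π` one has `4πA²N² = (l/4)²`, the borderline case of
  -- `level_set_le`.
  set c : ℝ := 8 * √Real.pi with hc
  have hc0 : 0 < c := by positivity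
  have hc2 : c ^ 2 = 64 * Real.pi := by rw [hc, mul_pow, Real.sq_sqrt Real.pi_pos.le]; norm_num
  refine ⟨(12 * c).toNNReal ^ (1 / 3 : ℝ), by positivity, fun h hh => ?_⟩
  set H := (𝓕 (hh.toLp h) : Lp ℂ 2 (volume : Measure R3)) with hH
  set N2 := ∫⁻ ξ, ‖ξ‖ₑ * ‖H ξ‖ₑ ^ 2 with hN2
  have hHe : AEMeasurable (fun ξ => ‖H ξ‖ₑ) volume := (Lp.aestronglyMeasurable H).enorm
  rcases eq_or_ne N2 ⊤ with htop | htop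
  · rw [htop, ENNReal.top_rpow_of_pos (by norm_num), ENNReal.mul_top]
    · exact le_top
    · simp only [ne_eq, ENNReal.coe_eq_zero]
      positivity
  rcases eq_or_ne N2 0 with hzero | hzero
  · have h1 : ∀ᵐ ξ : R3, ‖ξ‖ₑ * ‖H ξ‖ₑ ^ 2 = 0 :=
      (lintegral_eq_zero_iff' (by fun_prop)).1 hzero
    have h0 : ∀ᵐ ξ : R3, ξ ≠ 0 := by rw [ae_iff]; simp
    have h2 : ∫⁻ x, ‖h x‖ₑ ^ 2 = 0 := by
      rw [← lintegral_fourier_sq hh, ← hH, lintegral_eq_zero_iff' (by fun_prop)]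
      filter_upwards [h1, h0] with ξ h3 h4
      rcases mul_eq_zero.1 h3 with h5 | h5
      · exact absurd (enorm_eq_zero.1 h5) h4
      · exact h5
    have h3 : h =ᵐ[volume] 0 := by
      have := (lintegral_eq_zero_iff' (hh.1.enorm.pow_const 2)).1 h2
      filter_upwards [this] with x hx
      simpa using hx
    rw [eLpNorm_congr_ae h3]; simp
  set N : ℝ := √N2.toReal with hN
  have hNpos : 0 < N := Real.sqrt_pos.2 (ENNReal.toReal_pos hzero htop)
  have hNN : N2 = ENNReal.ofReal (N ^ 2) := by
    rw [hN, Real.sq_sqrt ENNReal.toReal_nonneg, ENNReal.ofReal_toReal htop]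
  have hlev : ∀ l : ℝ, 0 < l → volume {x | l < ‖h x‖} * ENNReal.ofReal (l ^ (3 - 1 : ℝ)) ≤
      4 * ∫⁻ ξ, (Set.Iic (c * N * ‖ξ‖)).indicator (fun _ => ‖H ξ‖ₑ ^ 2) l := by
    intro l hl
    have hl2 : l ^ (3 - 1 : ℝ) = l ^ 2 := by norm_num
    rw [hl2]
    refine (level_set_le hh (A := l / (c * N)) (by positivity) hl ?_).trans ?_
    · rw [← hH, ← hN2, hNN, ← ENNReal.ofReal_mul (by positivity),
        ← ENNReal.ofReal_pow (by positivity)]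
      apply ENNReal.ofReal_le_ofReal
      apply le_of_eq
      rw [div_pow, mul_pow, hc2]
      field_simp
      norm_num
    · refine mul_le_mul' le_rfl ?_
      rw [← lintegral_indicator measurableSet_ball.compl]
      refine lintegral_mono fun ξ => ?_
      by_cases hξ : ξ ∈ (Metric.ball (0 : R3) (l / (c * N)))ᶜ
      · rw [Set.indicator_of_mem hξ, Set.indicator_of_mem]
        simp only [Set.mem_compl_iff, mem_ball_zero_iff, not_lt] at hξ
        rw [div_le_iff₀ (by positivity)] at hξ
        simp only [Set.mem_Iic]
        linarith
      · rw [Set.indicator_of_notMem hξ]; exact zero_le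
  -- Layer cake with the cutoff radius proportional to the level: a frequency `ξ` contributes only
  -- for `l ≤ cN‖ξ‖`. Integrating in `l` produces the weight `cN‖ξ‖`, for a total of `3 · 4 · cN ·
  -- N²`.
  have hcube : ∫⁻ x, ‖h x‖ₑ ^ (3 : ℝ) ≤ ENNReal.ofReal (12 * c) * N2 ^ (3 / 2 : ℝ) := by
    have e1 : ∫⁻ x, ‖h x‖ₑ ^ (3 : ℝ) = ∫⁻ x, ENNReal.ofReal (‖h x‖ ^ (3 : ℝ)) := by
      congr 1; ext x
      rw [← ENNReal.ofReal_rpow_of_nonneg (norm_nonneg _) (by norm_num), ofReal_norm]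
    rw [e1, lintegral_rpow_eq_lintegral_meas_lt_mul volume
      (Eventually.of_forall fun x => norm_nonneg _) hh.1.norm.aemeasurable (by norm_num)]
    calc _ ≤ ENNReal.ofReal 3 * ∫⁻ l in Set.Ioi (0 : ℝ),
          4 * ∫⁻ ξ, (Set.Iic (c * N * ‖ξ‖)).indicator (fun _ => ‖H ξ‖ₑ ^ 2) l := by
          refine mul_le_mul' le_rfl (setLIntegral_mono' measurableSet_Ioi fun l hl => hlev l hl)
      _ = ENNReal.ofReal 3 * (4 * ∫⁻ ξ, ∫⁻ l in Set.Ioi (0 : ℝ),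
            (Set.Iic (c * N * ‖ξ‖)).indicator (fun _ => ‖H ξ‖ₑ ^ 2) l) := by
          rw [lintegral_const_mul' _ _ (by simp), lintegral_lintegral_swap]
          have hS : MeasurableSet {p : ℝ × R3 | p.1 ≤ c * N * ‖p.2‖} :=
            measurableSet_le (by fun_prop) (by fun_prop)
          have : (Function.uncurry fun (l : ℝ) (ξ : R3) =>
              (Set.Iic (c * N * ‖ξ‖)).indicator (fun _ => ‖H ξ‖ₑ ^ 2) l)
              = {p : ℝ × R3 | p.1 ≤ c * N * ‖p.2‖}.indicator (fun p => ‖H p.2‖ₑ ^ 2) := by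
            ext p; simp [Set.indicator, Function.uncurry]
          rw [this]
          exact ((hHe.comp_snd).pow_const 2).indicator hS
      _ = ENNReal.ofReal 3 * (4 * ∫⁻ ξ, ENNReal.ofReal (c * N) * (‖ξ‖ₑ * ‖H ξ‖ₑ ^ 2)) := by
          congr 3; ext ξ
          rw [lintegral_indicator measurableSet_Iic, Measure.restrict_restrict measurableSet_Iic,
            Set.inter_comm, Set.Ioi_inter_Iic, setLIntegral_const, Real.volume_Ioc, sub_zero,
            ENNReal.ofReal_mul (by positivity), ofReal_norm]
          ring
      _ = ENNReal.ofReal 3 * (4 * (ENNReal.ofReal (c * N) * N2)) := by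
          rw [lintegral_const_mul' _ _ (by simp)]
      _ = _ := by
          have e2 : N2 ^ (3 / 2 : ℝ) = ENNReal.ofReal (N ^ 3) := by
            rw [hNN, ENNReal.ofReal_rpow_of_nonneg (by positivity) (by norm_num),
              ← Real.rpow_natCast N 2, ← Real.rpow_mul hNpos.le]
            norm_num
          rw [e2, hNN, ← ENNReal.ofReal_ofNat 4, ← ENNReal.ofReal_mul (by positivity),
            ← ENNReal.ofReal_mul (by positivity), ← ENNReal.ofReal_mul (by positivity),
            ← ENNReal.ofReal_mul (by positivity)]
          congr 1; ring
  rw [eLpNorm_eq_lintegral_rpow_enorm_toReal (by simp) (by simp)]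
  simp only [ENNReal.toReal_ofNat]
  calc _ ≤ (ENNReal.ofReal (12 * c) * N2 ^ (3 / 2 : ℝ)) ^ (1 / 3 : ℝ) := by gcongr
    _ = _ := by
      rw [ENNReal.mul_rpow_of_nonneg _ _ (by norm_num), ← ENNReal.rpow_mul]
      rw [ENNReal.coe_rpow_of_nonneg _ (by norm_num : (0 : ℝ) ≤ 1 / 3)]
      norm_num [ENNReal.ofReal]

/-! ### The bilinear estimate on the Fourier side. -/

lemma enorm_sinSymbol_sq_le (t : ℝ) (ξ : R3) (hξ : ξ ≠ 0) :
    ‖sinSymbol t ξ‖ₑ ^ 2 ≤ ENNReal.ofReal (‖ξ‖ ^ (-2 : ℤ)) := by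
  have hn : 0 < ‖ξ‖ := norm_pos_iff.2 hξ
  rw [Real.enorm_eq_ofReal_abs, ← ENNReal.ofReal_pow (abs_nonneg _)]
  apply ENNReal.ofReal_le_ofReal
  have h1 := norm_mul_abs_sinSymbol_le t ξ
  have h2 : ‖ξ‖ * |sinSymbol t ξ| ≤ 1 := by
    refine le_trans ?_ h1
    gcongr
    nlinarith [Real.pi_gt_three]
  rw [zpow_neg, zpow_ofNat, ← inv_pow]
  gcongr
  rwa [← one_div, le_div_iff₀ hn, mul_comm]

lemma ae_ne_zero_sub (ξ : R3) : ∀ᵐ η : R3, η ≠ 0 ∧ ξ - η ≠ 0 := by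
  have h1 : ∀ a : R3, ∀ᵐ η : R3, η ≠ a := fun a => by rw [ae_iff]; simp
  filter_upwards [h1 0, h1 ξ] with η h2 h3
  exact ⟨h2, fun h => h3 (sub_eq_zero.1 h).symm⟩

/-- If `η` is the shorter of `η` and `ξ - η`, then `‖ξ‖ ≤ 2‖ξ - η‖`. The product is then at most
`4‖ξ‖⁻²‖η‖⁻²` for `‖η‖ < ‖ξ‖`, and at most `‖η‖⁻⁴` beyond. These integrate to `(16π + 4π)/‖ξ‖`, and
the symmetric case doubles this. -/
lemma lintegral_inv_sq_mul_inv_sq_le {ξ : R3} (hξ : ξ ≠ 0) :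
    ∫⁻ η : R3, ENNReal.ofReal (‖η‖ ^ (-2 : ℤ)) * ENNReal.ofReal (‖ξ - η‖ ^ (-2 : ℤ))
      ≤ ENNReal.ofReal (40 * Real.pi / ‖ξ‖) := by
  have hn : 0 < ‖ξ‖ := norm_pos_iff.2 hξ
  set k : R3 → ℝ≥0∞ := fun η =>
    (Metric.ball (0 : R3) ‖ξ‖).indicator
      (fun η => ENNReal.ofReal (4 * ‖ξ‖ ^ (-2 : ℤ)) * ENNReal.ofReal (‖η‖ ^ (-2 : ℤ))) η
    + (Metric.ball (0 : R3) ‖ξ‖)ᶜ.indicator (fun η => ENNReal.ofReal (‖η‖ ^ (-4 : ℤ))) η with hk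
  have hb : MeasurableSet (Metric.ball (0 : R3) ‖ξ‖) := measurableSet_ball
  have hkm : Measurable k := by
    refine Measurable.add (Measurable.indicator (by fun_prop) hb)
      (Measurable.indicator (by fun_prop) hb.compl)
  have hkint : ∫⁻ η, k η ≤ ENNReal.ofReal (20 * Real.pi / ‖ξ‖) := by
    rw [hk, lintegral_add_right _ (Measurable.indicator (by fun_prop) hb.compl),
      lintegral_indicator hb, lintegral_indicator hb.compl, lintegral_const_mul _ (by fun_prop)]
    calc _ ≤ ENNReal.ofReal (4 * ‖ξ‖ ^ (-2 : ℤ)) * ENNReal.ofReal (4 * Real.pi * ‖ξ‖)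
          + ENNReal.ofReal (4 * Real.pi / ‖ξ‖) :=
          add_le_add (mul_le_mul' le_rfl (lintegral_ball_inv_sq_le _))
            (lintegral_compl_ball_inv_pow_four_le hn)
      _ = _ := by
          rw [← ENNReal.ofReal_mul (by positivity), ← ENNReal.ofReal_add (by positivity)
            (by positivity)]
          congr 1
          rw [zpow_neg, zpow_ofNat]
          field_simp
          ring
  have key : ∀ a b : R3, a ≠ 0 → b ≠ 0 → a + b = ξ → ‖a‖ ≤ ‖b‖ →
      ENNReal.ofReal (‖a‖ ^ (-2 : ℤ)) * ENNReal.ofReal (‖b‖ ^ (-2 : ℤ)) ≤ k a := by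
    intro a b ha hb hab hle
    have ha0 : 0 < ‖a‖ := norm_pos_iff.2 ha
    have hb0 : 0 < ‖b‖ := norm_pos_iff.2 hb
    have htri : ‖ξ‖ ≤ 2 * ‖b‖ := by
      rw [← hab]; linarith [norm_add_le a b]
    by_cases h : a ∈ Metric.ball (0 : R3) ‖ξ‖
    · rw [hk]
      simp only
      rw [Set.indicator_of_mem h, Set.indicator_of_notMem (by simpa using h), add_zero, mul_comm]
      gcongr
      rw [zpow_neg, zpow_ofNat, zpow_neg, zpow_ofNat, ← div_eq_mul_inv, inv_eq_one_div,
        div_le_div_iff₀ (by positivity) (by positivity)]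
      nlinarith
    · rw [hk]
      simp only
      rw [Set.indicator_of_notMem h, Set.indicator_of_mem (by exact h), zero_add,
        ← ENNReal.ofReal_mul (by positivity)]
      apply ENNReal.ofReal_le_ofReal
      have : ‖a‖ ^ (-4 : ℤ) = ‖a‖ ^ (-2 : ℤ) * ‖a‖ ^ (-2 : ℤ) := by
        rw [← zpow_add₀ ha0.ne']; norm_num
      rw [this]
      gcongr ?_ * ?_
      rw [zpow_neg, zpow_ofNat, zpow_neg, zpow_ofNat]
      gcongr
  calc _ ≤ ∫⁻ η, (k η + k (ξ - η)) := by
        refine lintegral_mono_ae ?_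
        filter_upwards [ae_ne_zero_sub ξ] with η hη
        rcases le_total ‖η‖ ‖ξ - η‖ with h | h
        · exact (key η (ξ - η) hη.1 hη.2 (by abel) h).trans le_self_add
        · rw [mul_comm]
          exact (key (ξ - η) η hη.2 hη.1 (by abel) h).trans le_add_self
    _ = (∫⁻ η, k η) + ∫⁻ η, k η := by
        rw [lintegral_add_left hkm, lintegral_sub_left_eq_self (μ := volume) k ξ]
    _ ≤ _ := by
        refine (add_le_add hkint hkint).trans_eq ?_
        rw [← ENNReal.ofReal_add (by positivity) (by positivity)]
        congr 1; ring

lemma lintegral_sinSymbol_mul_le (t : ℝ) (ξ : R3) :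
    ‖ξ‖ₑ * ∫⁻ η, (‖sinSymbol t η‖ₑ * ‖sinSymbol t (ξ - η)‖ₑ) ^ 2
      ≤ ENNReal.ofReal (40 * Real.pi) := by
  rcases eq_or_ne ξ 0 with rfl | hξ
  · simp
  calc _ ≤ ‖ξ‖ₑ * ENNReal.ofReal (40 * Real.pi / ‖ξ‖) := by
        refine mul_le_mul' le_rfl (le_trans ?_ (lintegral_inv_sq_mul_inv_sq_le hξ))
        refine lintegral_mono_ae ?_
        filter_upwards [ae_ne_zero_sub ξ] with η hη
        rw [mul_pow]
        exact mul_le_mul' (enorm_sinSymbol_sq_le t η hη.1) (enorm_sinSymbol_sq_le t _ hη.2)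
    _ = _ := by
        rw [← ofReal_norm, ← ENNReal.ofReal_mul (norm_nonneg _)]
        congr 1
        have := norm_ne_zero_iff.2 hξ
        field_simp

/-- The bounds `|t|` and `1/‖η‖` on the symbol cross at `‖η‖ = 1/|t|`; the two regions contribute
`4π|t|/3` and `4π|t|`. -/
lemma lintegral_sinSymbol_pow_four_le (t : ℝ) :
    ∫⁻ η, ‖sinSymbol t η‖ₑ ^ 4 ≤ ENNReal.ofReal (6 * Real.pi * |t|) := by
  rcases eq_or_ne t 0 with rfl | ht
  · simp [sinSymbol]
  have ht0 : 0 < |t| := abs_pos.2 ht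
  have hA : 0 < |t|⁻¹ := by positivity
  rw [← lintegral_add_compl _ (measurableSet_ball (x := (0 : R3)) (ε := |t|⁻¹))]
  calc _ ≤ (∫⁻ _ in Metric.ball (0 : R3) |t|⁻¹, ENNReal.ofReal (|t| ^ 4))
        + ∫⁻ η in (Metric.ball (0 : R3) |t|⁻¹)ᶜ, ENNReal.ofReal (‖η‖ ^ (-4 : ℤ)) := by
        refine add_le_add (lintegral_mono fun η => ?_)
          (setLIntegral_mono' measurableSet_ball.compl fun η hη => ?_)
        · rw [Real.enorm_eq_ofReal_abs, ← ENNReal.ofReal_pow (abs_nonneg _)]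
          apply ENNReal.ofReal_le_ofReal
          exact pow_le_pow_left₀ (abs_nonneg _) (abs_sinSymbol_le t η) 4
        · have hη0 : η ≠ 0 := by
            rintro rfl
            exact hη (Metric.mem_ball_self hA)
          have h1 := enorm_sinSymbol_sq_le t η hη0
          calc ‖sinSymbol t η‖ₑ ^ 4 = (‖sinSymbol t η‖ₑ ^ 2) ^ 2 := by ring
            _ ≤ ENNReal.ofReal (‖η‖ ^ (-2 : ℤ)) ^ 2 := by gcongr
            _ = _ := by
              rw [← ENNReal.ofReal_pow (by positivity), ← zpow_natCast, ← zpow_mul]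
              norm_num
    _ ≤ ENNReal.ofReal (4 / 3 * Real.pi * |t|) + ENNReal.ofReal (4 * Real.pi * |t|) := by
        refine add_le_add (le_of_eq ?_) ((lintegral_compl_ball_inv_pow_four_le hA).trans_eq ?_)
        · rw [setLIntegral_const, EuclideanSpace.volume_ball_fin_three,
            ← ENNReal.ofReal_pow hA.le, ← ENNReal.ofReal_mul (by positivity),
            ← ENNReal.ofReal_mul (by positivity)]
          congr 1
          field_simp
        · congr 1
          field_simp
    _ ≤ _ := by
        rw [← ENNReal.ofReal_add (by positivity) (by positivity)]
        apply ENNReal.ofReal_le_ofReal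
        nlinarith [mul_pos Real.pi_pos ht0]

lemma lintegral_sinSymbol_mul_le' (t : ℝ) (ξ : R3) :
    ∫⁻ η, (‖sinSymbol t η‖ₑ * ‖sinSymbol t (ξ - η)‖ₑ) ^ 2 ≤ ENNReal.ofReal (6 * Real.pi * |t|) := by
  have hm : Measurable fun η => ‖sinSymbol t η‖ₑ := (continuous_sinSymbol t).enorm.measurable
  have hm' : Measurable fun η => ‖sinSymbol t (ξ - η)‖ₑ := hm.comp (measurable_const.sub measurable_id)
  have h1 := lintegral_mul_sq_le (μ := (volume : Measure R3))
    (f := fun η => ‖sinSymbol t η‖ₑ ^ 2) (g := fun η => ‖sinSymbol t (ξ - η)‖ₑ ^ 2)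
    (hm.pow_const 2).aemeasurable (hm'.pow_const 2).aemeasurable
  have h2 : ∫⁻ η, (‖sinSymbol t (ξ - η)‖ₑ ^ 2) ^ 2 = ∫⁻ η, (‖sinSymbol t η‖ₑ ^ 2) ^ 2 :=
    lintegral_sub_left_eq_self (μ := volume) (fun η => (‖sinSymbol t η‖ₑ ^ 2) ^ 2) ξ
  rw [h2, ← sq] at h1
  refine le_trans ?_ (lintegral_sinSymbol_pow_four_le t)
  simp_rw [mul_pow]
  refine ((ENNReal.pow_le_pow_left_iff two_ne_zero).1 h1).trans_eq ?_
  congr 1; ext η; ring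

/-- Cauchy–Schwarz for the convolution of two propagated spectra. -/
lemma lintegral_weight_conv_sq_le {t : ℝ} {w : R3 → ℝ≥0∞} {C : ℝ≥0∞}
    (hC : ∀ ξ, w ξ * ∫⁻ η, (‖sinSymbol t η‖ₑ * ‖sinSymbol t (ξ - η)‖ₑ) ^ 2 ≤ C)
    {a b : R3 → ℝ≥0∞} (ha : Measurable a) (hb : Measurable b) :
    ∫⁻ ξ, w ξ * (∫⁻ η, (‖sinSymbol t η‖ₑ * a η) * (‖sinSymbol t (ξ - η)‖ₑ * b (ξ - η))) ^ 2
      ≤ C * ((∫⁻ η, a η ^ 2) * ∫⁻ η, b η ^ 2) := by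
  have hm : Measurable fun η => ‖sinSymbol t η‖ₑ := (continuous_sinSymbol t).enorm.measurable
  have hprod : Measurable fun p : R3 × R3 => a p.2 ^ 2 * b (p.1 - p.2) ^ 2 := by fun_prop
  calc _ ≤ ∫⁻ ξ, C * ∫⁻ η, a η ^ 2 * b (ξ - η) ^ 2 := by
        refine lintegral_mono fun ξ => ?_
        have h1 := lintegral_mul_sq_le (μ := (volume : Measure R3))
          (f := fun η => ‖sinSymbol t η‖ₑ * ‖sinSymbol t (ξ - η)‖ₑ)
          (g := fun η => a η * b (ξ - η))
          (hm.mul (hm.comp (measurable_const.sub measurable_id))).aemeasurable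
          (ha.mul (hb.comp (measurable_const.sub measurable_id))).aemeasurable
        have h2 : ∫⁻ η, (‖sinSymbol t η‖ₑ * a η) * (‖sinSymbol t (ξ - η)‖ₑ * b (ξ - η))
            = ∫⁻ η, (‖sinSymbol t η‖ₑ * ‖sinSymbol t (ξ - η)‖ₑ) * (a η * b (ξ - η)) := by
          congr 1; ext η; ring
        simp only [h2]
        calc _ ≤ w ξ * ((∫⁻ η, (‖sinSymbol t η‖ₑ * ‖sinSymbol t (ξ - η)‖ₑ) ^ 2)
              * ∫⁻ η, (a η * b (ξ - η)) ^ 2) := by gcongr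
          _ ≤ C * ∫⁻ η, (a η * b (ξ - η)) ^ 2 := by
              rw [← mul_assoc]; gcongr; exact hC ξ
          _ = _ := by simp_rw [mul_pow]
    _ = C * ∫⁻ ξ, ∫⁻ η, a η ^ 2 * b (ξ - η) ^ 2 := by
        rw [lintegral_const_mul _ hprod.lintegral_prod_right']
    _ = C * ∫⁻ η, ∫⁻ ξ, a η ^ 2 * b (ξ - η) ^ 2 := by
        rw [lintegral_lintegral_swap hprod.aemeasurable]
    _ = _ := by
        congr 1
        rw [← lintegral_mul_const _ (ha.pow_const 2)]
        congr 1; ext η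
        rw [lintegral_const_mul _ (by fun_prop)]
        congr 1
        exact lintegral_sub_right_eq_self (μ := volume) (fun ξ => b ξ ^ 2) η

lemma hasCompactSupport_wave {f : R3 → ℂ} (hc : HasCompactSupport f) (t : ℝ) :
    HasCompactSupport (wave t f) := by
  obtain ⟨R, hR⟩ := hc.isCompact.isBounded.subset_closedBall (0 : R3)
  have h1 : ∀ y, R < ‖y‖ → f y = 0 := fun y hy => by
    by_contra h0
    have := hR (subset_tsupport _ h0)
    rw [mem_closedBall_zero_iff] at this
    linarith
  exact HasCompactSupport.intro (isCompact_closedBall (0 : R3) (R + |t|)) fun x hx =>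
    wave_eq_zero h1 (by simpa using hx)

/-- The convolution theorem for the inverse transform: `𝓕⁻` of the convolution of `𝓕 U` and `𝓕 V` is
the product `U V`. -/
lemma enorm_fourier_mul_le (U V : SchwartzMap R3 ℂ) (ξ : R3) :
    ‖𝓕 (fun x => U x * V x) ξ‖ₑ ≤ ∫⁻ η, ‖𝓕 U η‖ₑ * ‖𝓕 V (ξ - η)‖ₑ := by
  set W := SchwartzMap.convolution (ContinuousLinearMap.mul ℂ ℂ) (𝓕 U) (𝓕 V) with hW
  have h0 : ∀ (X : SchwartzMap R3 ℂ) (x : R3), 𝓕 X (-x) = (𝓕⁻ X) x := by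
    intro X x
    rw [SchwartzMap.fourierInv_coe, Real.fourierInv_eq_fourier_neg, SchwartzMap.fourier_coe]
  have h1 : ∀ x, (𝓕⁻ W : SchwartzMap R3 ℂ) x = U x * V x := by
    intro x
    rw [← h0, hW, SchwartzMap.fourier_convolution, SchwartzMap.pairing_apply_apply, h0, h0,
      FourierTransform.fourierInv_fourier_eq, FourierTransform.fourierInv_fourier_eq,
      ContinuousLinearMap.mul_apply']
  have h2 : (fun x => U x * V x) = ⇑(𝓕⁻ W : SchwartzMap R3 ℂ) := funext fun x => (h1 x).symm
  rw [h2, ← SchwartzMap.fourier_coe, FourierTransform.fourier_fourierInv_eq, hW,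
    SchwartzMap.convolution_apply]
  refine (enorm_integral_le_lintegral_enorm _).trans_eq ?_
  simp

lemma lintegral_enorm_fourier_sq {h : R3 → ℂ} (h2 : MemLp h 2 volume) (h1 : Integrable h) :
    ∫⁻ ξ, ‖𝓕 h ξ‖ₑ ^ 2 = ∫⁻ x, ‖h x‖ₑ ^ 2 := by
  rw [← lintegral_fourier_sq h2]
  refine lintegral_congr_ae ?_
  filter_upwards [fourier_toLp_ae_eq h2 h1] with ξ hξ
  rw [hξ]

lemma exists_schwartz_wave {f : R3 → ℂ} (hf : ContDiff ℝ ∞ f) (hc : HasCompactSupport f) (t : ℝ) :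
    ∃ U : SchwartzMap R3 ℂ, ⇑U = wave t f ∧ HasCompactSupport U ∧
      ∀ ξ, 𝓕 U ξ = sinSymbol t ξ * 𝓕 f ξ := by
  set F : SchwartzMap R3 ℂ := hc.toSchwartzMap hf with hF
  have hFf : ⇑F = f := rfl
  have h0 : wave t f = multOp (sinSymbol t) F := by
    rw [← hFf]; exact funext fun x => wave_eq_multOp t F x
  have hs : HasCompactSupport (multOp (sinSymbol t) F) := h0 ▸ hasCompactSupport_wave hc t
  refine ⟨hs.toSchwartzMap (contDiff_multOp (continuous_sinSymbol t) (abs_sinSymbol_le t) F),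
    h0.symm, hs, fun ξ => ?_⟩
  rw [SchwartzMap.fourier_coe]
  have := fourier_multOp (continuous_sinSymbol t) (abs_sinSymbol_le t) F hs ξ
  rwa [SchwartzMap.fourier_coe, hFf] at this

/-- The weight is left free: `w = 1` gives the `L²` norm of the product, `w = ‖ξ‖` its homogeneous
half-derivative norm. -/
lemma lintegral_weight_fourier_wave_mul_le {t : ℝ} {w : R3 → ℝ≥0∞} {C : ℝ≥0∞}
    (hC : ∀ ξ, w ξ * ∫⁻ η, (‖sinSymbol t η‖ₑ * ‖sinSymbol t (ξ - η)‖ₑ) ^ 2 ≤ C)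
    {f g : R3 → ℂ} (hf : ContDiff ℝ ∞ f) (hfc : HasCompactSupport f)
    (hg : ContDiff ℝ ∞ g) (hgc : HasCompactSupport g) :
    ∫⁻ ξ, w ξ * ‖𝓕 (fun x => wave t f x * wave t g x) ξ‖ₑ ^ 2
      ≤ C * (eLpNorm f 2 volume ^ 2 * eLpNorm g 2 volume ^ 2) := by
  obtain ⟨U, hU, -, hUF⟩ := exists_schwartz_wave hf hfc t
  obtain ⟨V, hV, -, hVF⟩ := exists_schwartz_wave hg hgc t
  have hi : ∀ {f : R3 → ℂ}, ContDiff ℝ ∞ f → HasCompactSupport f →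
      Integrable f ∧ MemLp f 2 volume := fun h hc =>
    ⟨h.continuous.integrable_of_hasCompactSupport hc, h.continuous.memLp_of_hasCompactSupport hc⟩
  have hm : ∀ {f : R3 → ℂ}, Integrable f → Measurable fun ξ => ‖𝓕 f ξ‖ₑ := fun h =>
    (VectorFourier.fourierIntegral_continuous
      Real.continuous_fourierChar continuous_inner h).enorm.measurable
  rw [eLpNorm_two_sq, eLpNorm_two_sq, ← lintegral_enorm_fourier_sq (hi hf hfc).2 (hi hf hfc).1,
    ← lintegral_enorm_fourier_sq (hi hg hgc).2 (hi hg hgc).1]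
  refine le_trans (lintegral_mono fun ξ => ?_) (lintegral_weight_conv_sq_le hC
    (hm (hi hf hfc).1) (hm (hi hg hgc).1))
  refine mul_le_mul' le_rfl (pow_le_pow_left₀ zero_le ?_ 2)
  rw [← hU, ← hV]
  refine (enorm_fourier_mul_le U V ξ).trans_eq ?_
  congr 1; ext η
  rw [hUF, hVF, enorm_mul, enorm_mul]
  simp [enorm_eq_nnnorm]

/-! ### From smooth data to `L²` data. -/

/-- The Bochner integral in `wave` is zero by convention where the slice is not integrable, so
`wave` is additive only at the points found here, which are almost all. -/
lemma ae_integrable_slice (t : ℝ) {E : Type*} [NormedAddCommGroup E] [NormedSpace ℝ E] {f : R3 → E}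
    (hfm : StronglyMeasurable f) {p : ℝ} (hp : 1 ≤ p) (hf : MemLp f (ENNReal.ofReal p) volume) :
    ∀ᵐ x : R3, Integrable (fun θ => f (x + t • θ)) sph := by
  have hp0 : 0 < p := by positivity
  have h1 : ∫⁻ x, avg t (fun y => ‖f y‖ₑ) x ^ p ≠ ⊤ := by
    refine ne_top_of_le_ne_top ?_ (lintegral_avg_rpow_le t hfm.enorm hp)
    have := hf.2
    rw [eLpNorm_eq_lintegral_ofReal _ hp0] at this
    intro h
    rw [h, ENNReal.top_rpow_of_pos (by positivity)] at this
    exact lt_irrefl _ this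
  filter_upwards [ae_lt_top ((measurable_avg t hfm.enorm).pow_const p) h1] with x hx
  refine ⟨(hfm.comp_measurable (by fun_prop)).aestronglyMeasurable, ?_⟩
  by_contra h
  have h2 : avg t (fun y => ‖f y‖ₑ) x = ⊤ := by
    simpa [avg, HasFiniteIntegral] using h
  rw [h2, ENNReal.top_rpow_of_pos hp0] at hx
  exact lt_irrefl _ hx

lemma wave_sub_ae (t : ℝ) {E : Type*} [NormedAddCommGroup E] [NormedSpace ℝ E] {f g : R3 → E}
    (hfm : StronglyMeasurable f) (hgm : StronglyMeasurable g) {p : ℝ} (hp : 1 ≤ p)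
    (hf : MemLp f (ENNReal.ofReal p) volume) (hg : MemLp g (ENNReal.ofReal p) volume) :
    wave t (f - g) =ᵐ[volume] wave t f - wave t g := by
  filter_upwards [ae_integrable_slice t hfm hp hf, ae_integrable_slice t hgm hp hg] with x h1 h2
  simp only [wave, Pi.sub_apply]
  rw [integral_sub h1 h2, smul_sub]

lemma eLpNorm_wave_sub_le (t : ℝ) {E : Type*} [NormedAddCommGroup E] [NormedSpace ℝ E]
    {f g : R3 → E}
    (hfm : StronglyMeasurable f) (hgm : StronglyMeasurable g) {p : ℝ} (hp : 1 ≤ p)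
    (hf : MemLp f (ENNReal.ofReal p) volume) (hg : MemLp g (ENNReal.ofReal p) volume) :
    eLpNorm (wave t f - wave t g) (ENNReal.ofReal p) volume
      ≤ ENNReal.ofReal |t| * eLpNorm (f - g) (ENNReal.ofReal p) volume := by
  rw [← eLpNorm_congr_ae (wave_sub_ae t hfm hgm hp hf hg)]
  exact eLpNorm_wave_le t (hfm.sub hgm) hp

lemma exists_seq_contDiff_tendsto {f : R3 → ℂ} {p : ℝ≥0∞} (hp : p ≠ ⊤) (hp1 : 1 ≤ p)
    (hf : MemLp f p volume) : ∃ F : ℕ → R3 → ℂ, (∀ n, ContDiff ℝ ∞ (F n)) ∧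
      (∀ n, HasCompactSupport (F n)) ∧ Tendsto (fun n => eLpNorm (F n - f) p volume) atTop (𝓝 0) ∧
      Tendsto (fun n => eLpNorm (F n) p volume) atTop (𝓝 (eLpNorm f p volume)) := by
  have h : ∀ n : ℕ, ∃ g : R3 → ℂ, HasCompactSupport g ∧ ContDiff ℝ ∞ g ∧
      eLpNorm (f - g) p volume ≤ ENNReal.ofReal (1 / (n + 1)) := fun n =>
    hf.exist_eLpNorm_sub_le hp hp1 (by positivity)
  choose F hc hd hF using h
  have h0 : Tendsto (fun n => eLpNorm (F n - f) p volume) atTop (𝓝 0) := by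
    refine tendsto_of_tendsto_of_tendsto_of_le_of_le tendsto_const_nhds ?_ (fun _ => zero_le)
      fun n => (eLpNorm_sub_comm _ _ _ _).trans_le (hF n)
    have := ENNReal.tendsto_ofReal tendsto_one_div_add_atTop_nhds_zero_nat
    simpa using this
  refine ⟨F, hd, hc, h0, ?_⟩
  have hm : ∀ n, AEStronglyMeasurable (F n) volume := fun n =>
    (hd n).continuous.aestronglyMeasurable
  refine tendsto_of_tendsto_of_tendsto_of_le_of_le
    (g := fun n => eLpNorm f p volume - eLpNorm (F n - f) p volume)
    (h := fun n => eLpNorm f p volume + eLpNorm (F n - f) p volume) ?_ ?_ ?_ ?_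
  · have := ENNReal.Tendsto.sub (tendsto_const_nhds (x := eLpNorm f p volume)) h0
      (Or.inl hf.2.ne)
    simpa using this
  · simpa using (tendsto_const_nhds (x := eLpNorm f p volume)).add h0
  · intro n
    refine tsub_le_iff_right.2 ?_
    have := eLpNorm_add_le (μ := (volume : Measure R3)) (hm n) (hf.1.sub (hm n)) hp1
    rw [add_sub_cancel, eLpNorm_sub_comm] at this
    exact this
  · intro n
    have := eLpNorm_add_le (μ := (volume : Measure R3)) hf.1 ((hm n).sub hf.1) hp1
    rwa [add_sub_cancel] at this

lemma eLpNorm_one_mul_le {a b : R3 → ℂ} (ha : AEStronglyMeasurable a volume)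
    (hb : AEStronglyMeasurable b volume) :
    eLpNorm (fun x => a x * b x) 1 volume ≤ eLpNorm a 2 volume * eLpNorm b 2 volume := by
  refine (ENNReal.pow_le_pow_left_iff two_ne_zero).1 ?_
  rw [mul_pow, eLpNorm_two_sq, eLpNorm_two_sq, eLpNorm_one_eq_lintegral_enorm]
  simp only [enorm_mul]
  exact lintegral_mul_sq_le ha.enorm hb.enorm

lemma tendsto_fourier {h : R3 → ℂ} {H : ℕ → R3 → ℂ} (hi : Integrable h)
    (hHi : ∀ n, Integrable (H n))
    (hH : Tendsto (fun n => eLpNorm (fun x => H n x - h x) 1 volume) atTop (𝓝 0)) (ξ : R3) :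
    Tendsto (fun n => 𝓕 (H n) ξ) atTop (𝓝 (𝓕 h ξ)) := by
  simp only [Real.fourier_eq]
  refine tendsto_integral_of_L1 _ ((Real.fourierIntegral_convergent_iff ξ).2 hi).aestronglyMeasurable
    (Eventually.of_forall fun n => (Real.fourierIntegral_convergent_iff ξ).2 (hHi n)) ?_
  simp only [eLpNorm_one_eq_lintegral_enorm] at hH
  refine hH.congr fun n => lintegral_congr fun x => ?_
  rw [← smul_sub, ← ofReal_norm, ← ofReal_norm, Circle.norm_smul]

lemma measurable_fourier {h : R3 → ℂ} (hi : Integrable h) : Measurable (𝓕 h) :=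
  (VectorFourier.fourierIntegral_continuous
      Real.continuous_fourierChar continuous_inner hi).measurable

/-- The product of two propagated `L²` functions is approximated by smooth ones. -/
lemma exists_seq_wave_mul {f g : R3 → ℂ} (t : ℝ) (hfm : StronglyMeasurable f)
    (hgm : StronglyMeasurable g) (hf : MemLp f 2 volume) (hg : MemLp g 2 volume) :
    Integrable (fun x => wave t f x * wave t g x) ∧ ∃ F G : ℕ → R3 → ℂ,
      (∀ n, ContDiff ℝ ∞ (F n)) ∧ (∀ n, HasCompactSupport (F n)) ∧
      (∀ n, ContDiff ℝ ∞ (G n)) ∧ (∀ n, HasCompactSupport (G n)) ∧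
      Tendsto (fun n => eLpNorm (F n) 2 volume ^ 2 * eLpNorm (G n) 2 volume ^ 2) atTop
        (𝓝 (eLpNorm f 2 volume ^ 2 * eLpNorm g 2 volume ^ 2)) ∧
      Tendsto (fun n => eLpNorm (fun x => wave t (F n) x * wave t (G n) x
        - wave t f x * wave t g x) 1 volume) atTop (𝓝 0) := by
  have e2 : ENNReal.ofReal 2 = 2 := by simp
  have hW : ∀ {f : R3 → ℂ}, StronglyMeasurable f → MemLp f 2 volume →
      MemLp (wave t f) 2 volume := fun hm h => by
    have := MemLp.wave t hm one_le_two (by rwa [e2])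
    rwa [e2] at this
  have hWn : ∀ {f : R3 → ℂ}, StronglyMeasurable f →
      eLpNorm (wave t f) 2 volume ≤ ENNReal.ofReal |t| * eLpNorm f 2 volume := fun hm => by
    have := eLpNorm_wave_le t hm one_le_two
    rwa [e2] at this
  have hWs : ∀ {f g : R3 → ℂ}, StronglyMeasurable f → StronglyMeasurable g →
      MemLp f 2 volume → MemLp g 2 volume → eLpNorm (wave t f - wave t g) 2 volume
        ≤ ENNReal.ofReal |t| * eLpNorm (f - g) 2 volume := fun h1 h2 h3 h4 => by
    have := eLpNorm_wave_sub_le t h1 h2 one_le_two (by rwa [e2]) (by rwa [e2])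
    rwa [e2] at this
  obtain ⟨F, hFd, hFc, hF0, hF⟩ := exists_seq_contDiff_tendsto (by norm_num) (by norm_num) hf
  obtain ⟨G, hGd, hGc, hG0, hG⟩ := exists_seq_contDiff_tendsto (by norm_num) (by norm_num) hg
  refine ⟨(hW hfm hf).integrable_mul (hW hgm hg), F, G, hFd, hFc, hGd, hGc, ?_, ?_⟩
  · refine ENNReal.Tendsto.mul (ENNReal.Tendsto.pow hF) (Or.inr (by finiteness [hg.2.ne]))
      (ENNReal.Tendsto.pow hG) (Or.inr (by finiteness [hf.2.ne]))
  have hm : ∀ {f : R3 → ℂ}, ContDiff ℝ ∞ f → StronglyMeasurable f :=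
    fun h => h.continuous.stronglyMeasurable
  have hM : ∀ {f : R3 → ℂ}, ContDiff ℝ ∞ f → HasCompactSupport f → MemLp f 2 volume :=
    fun h hc => h.continuous.memLp_of_hasCompactSupport hc
  refine tendsto_of_tendsto_of_tendsto_of_le_of_le
    (h := fun n => (ENNReal.ofReal |t| * eLpNorm (F n - f) 2 volume)
        * (ENNReal.ofReal |t| * eLpNorm (G n) 2 volume)
      + (ENNReal.ofReal |t| * eLpNorm f 2 volume)
        * (ENNReal.ofReal |t| * eLpNorm (G n - g) 2 volume))
    tendsto_const_nhds ?_ (fun _ => zero_le) fun n => ?_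
  · have h1 : Tendsto (fun n => ENNReal.ofReal |t| * eLpNorm (F n - f) 2 volume) atTop (𝓝 0) := by
      simpa using ENNReal.Tendsto.const_mul hF0 (Or.inr (ENNReal.ofReal_ne_top (r := |t|)))
    have h2 : Tendsto (fun n => ENNReal.ofReal |t| * eLpNorm (G n - g) 2 volume) atTop (𝓝 0) := by
      simpa using ENNReal.Tendsto.const_mul hG0 (Or.inr (ENNReal.ofReal_ne_top (r := |t|)))
    have h3 := ENNReal.Tendsto.const_mul hG (Or.inr (ENNReal.ofReal_ne_top (r := |t|)))
    have h4 : ENNReal.ofReal |t| * eLpNorm g 2 volume ≠ ⊤ := by finiteness [hg.2.ne]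
    have h5 : ENNReal.ofReal |t| * eLpNorm f 2 volume ≠ ⊤ := by finiteness [hf.2.ne]
    have h6 := ENNReal.Tendsto.mul h1 (Or.inr h4) h3 (Or.inr ENNReal.zero_ne_top)
    have h7 := ENNReal.Tendsto.const_mul h2 (Or.inr h5)
    simpa using h6.add h7
  · have e : (fun x => wave t (F n) x * wave t (G n) x - wave t f x * wave t g x)
        = (fun x => (wave t (F n) - wave t f) x * wave t (G n) x)
          + fun x => wave t f x * (wave t (G n) - wave t g) x := by
      ext x
      simp only [Pi.add_apply, Pi.sub_apply]
      ring
    have mf := (hW hfm hf).1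
    have mg := (hW hgm hg).1
    have mF := (hW (hm (hFd n)) (hM (hFd n) (hFc n))).1
    have mG := (hW (hm (hGd n)) (hM (hGd n) (hGc n))).1
    rw [e]
    refine (eLpNorm_add_le ((mF.sub mf).mul mG) (mf.mul (mG.sub mg)) le_rfl).trans ?_
    refine add_le_add ((eLpNorm_one_mul_le (mF.sub mf) mG).trans ?_)
      ((eLpNorm_one_mul_le mf (mG.sub mg)).trans ?_)
    · exact mul_le_mul' (hWs (hm (hFd n)) hfm (hM (hFd n) (hFc n)) hf) (hWn (hm (hGd n)))
    · exact mul_le_mul' (hWn hfm) (hWs (hm (hGd n)) hgm (hM (hGd n) (hGc n)) hg)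

lemma integrable_wave_mul {f g : R3 → ℂ} (t : ℝ) (hf : ContDiff ℝ ∞ f) (hfc : HasCompactSupport f)
    (hg : ContDiff ℝ ∞ g) (hgc : HasCompactSupport g) :
    Integrable (fun x => wave t f x * wave t g x) ∧
      MemLp (fun x => wave t f x * wave t g x) 2 volume := by
  obtain ⟨U, hU, hUc, -⟩ := exists_schwartz_wave hf hfc t
  obtain ⟨V, hV, -, -⟩ := exists_schwartz_wave hg hgc t
  have hc : Continuous fun x => wave t f x * wave t g x := by
    rw [← hU, ← hV]; exact U.continuous.mul V.continuous
  have hs : HasCompactSupport fun x => wave t f x * wave t g x := by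
    rw [← hU, ← hV]; exact hUc.mul_right
  exact ⟨hc.integrable_of_hasCompactSupport hs, hc.memLp_of_hasCompactSupport hs⟩

/-- The smooth products converge in `L¹`, hence their transforms converge pointwise, and Fatou
passes the bound to the limit. -/
lemma lintegral_weight_fourier_wave_mul_le_of_memLp {t : ℝ} {w : R3 → ℝ≥0∞} (hw : Measurable w)
    {C : ℝ≥0∞} (hCt : C ≠ ⊤)
    (hC : ∀ ξ, w ξ * ∫⁻ η, (‖sinSymbol t η‖ₑ * ‖sinSymbol t (ξ - η)‖ₑ) ^ 2 ≤ C)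
    {f g : R3 → ℂ} (hfm : StronglyMeasurable f)
    (hgm : StronglyMeasurable g) (hf : MemLp f 2 volume) (hg : MemLp g 2 volume)
    (hwt : ∀ ξ, w ξ ≠ ⊤) :
    ∫⁻ ξ, w ξ * ‖𝓕 (fun x => wave t f x * wave t g x) ξ‖ₑ ^ 2
      ≤ C * (eLpNorm f 2 volume ^ 2 * eLpNorm g 2 volume ^ 2) := by
  obtain ⟨hi, F, G, hFd, hFc, hGd, hGc, hN, h1⟩ := exists_seq_wave_mul t hfm hgm hf hg
  have hFG := fun n => (integrable_wave_mul t (hFd n) (hFc n) (hGd n) (hGc n)).1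
  have hlim := fun ξ => tendsto_fourier hi hFG h1 ξ
  calc _ = ∫⁻ ξ, liminf (fun n => w ξ * ‖𝓕 (fun x => wave t (F n) x * wave t (G n) x) ξ‖ₑ ^ 2)
          atTop := by
        refine lintegral_congr fun ξ => ?_
        refine (Tendsto.liminf_eq ?_).symm
        exact ENNReal.Tendsto.const_mul (ENNReal.Tendsto.pow (hlim ξ).enorm) (Or.inr (hwt ξ))
    _ ≤ liminf (fun n => ∫⁻ ξ, w ξ * ‖𝓕 (fun x => wave t (F n) x * wave t (G n) x) ξ‖ₑ ^ 2)
          atTop := lintegral_liminf_le fun n =>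
            hw.mul ((measurable_fourier (hFG n)).enorm.pow_const 2)
    _ ≤ liminf (fun n => C * (eLpNorm (F n) 2 volume ^ 2 * eLpNorm (G n) 2 volume ^ 2)) atTop :=
        liminf_le_liminf (Eventually.of_forall fun n =>
          lintegral_weight_fourier_wave_mul_le hC (hFd n) (hFc n) (hGd n) (hGc n))
    _ = _ := (ENNReal.Tendsto.const_mul hN (Or.inr hCt)).liminf_eq

/-- A product of two `L²` functions is a priori only in `L¹`. The `L²` bound for smooth data
survives along an almost everywhere convergent subsequence, by Fatou. -/
lemma memLp_wave_mul {f g : R3 → ℂ} (t : ℝ) (hfm : StronglyMeasurable f)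
    (hgm : StronglyMeasurable g) (hf : MemLp f 2 volume) (hg : MemLp g 2 volume) :
    MemLp (fun x => wave t f x * wave t g x) 2 volume := by
  obtain ⟨hi, F, G, hFd, hFc, hGd, hGc, hN, h1⟩ := exists_seq_wave_mul t hfm hgm hf hg
  have hFG := fun n => integrable_wave_mul t (hFd n) (hFc n) (hGd n) (hGc n)
  obtain ⟨ns, hns, hae⟩ := (tendstoInMeasure_of_tendsto_eLpNorm (one_ne_zero)
    (fun n => (hFG n).1.1) hi.1 h1).exists_seq_tendsto_ae
  refine ⟨hi.1, (ENNReal.pow_lt_top_iff (n := 2)).1 ?_ |>.resolve_right two_ne_zero⟩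
  rw [eLpNorm_two_sq]
  set C := ENNReal.ofReal (6 * Real.pi * |t|)
  calc _ = ∫⁻ x, liminf (fun n => ‖wave t (F (ns n)) x * wave t (G (ns n)) x‖ₑ ^ 2) atTop := by
        refine lintegral_congr_ae ?_
        filter_upwards [hae] with x hx
        exact (ENNReal.Tendsto.pow hx.enorm).liminf_eq.symm
    _ ≤ liminf (fun n => ∫⁻ x, ‖wave t (F (ns n)) x * wave t (G (ns n)) x‖ₑ ^ 2) atTop :=
        lintegral_liminf_le' fun n => (hFG _).1.1.enorm.pow_const 2
    _ ≤ liminf (fun n => C * (eLpNorm (F (ns n)) 2 volume ^ 2 * eLpNorm (G (ns n)) 2 volume ^ 2))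
          atTop := by
        refine liminf_le_liminf (Eventually.of_forall fun n => ?_)
        rw [← lintegral_enorm_fourier_sq (hFG (ns n)).2 (hFG (ns n)).1]
        have := lintegral_weight_fourier_wave_mul_le (t := t) (w := fun _ => 1) (C := C)
          (fun ξ => by rw [one_mul]; exact lintegral_sinSymbol_mul_le' t ξ)
          (hFd (ns n)) (hFc _) (hGd (ns n)) (hGc _)
        simpa only [one_mul] using this
    _ = C * (eLpNorm f 2 volume ^ 2 * eLpNorm g 2 volume ^ 2) :=
        (ENNReal.Tendsto.const_mul (hN.comp hns.tendsto_atTop)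
          (Or.inr ENNReal.ofReal_ne_top)).liminf_eq
    _ < ⊤ := by
        have := hf.2.ne
        have := hg.2.ne
        finiteness

/-! ### The Sobolev norm of order one half, and part (i). -/

lemma sobolevNorm_congr_ae {s : ℝ} {h k : R3 → ℂ} (e : h =ᵐ[volume] k) :
    sobolevNorm s h = sobolevNorm s k := by
  by_cases hk : MemLp k 2 volume
  · have hh : MemLp h 2 volume := (memLp_congr_ae e).2 hk
    have : hh.toLp h = hk.toLp k := MemLp.toLp_eq_toLp_iff hh hk |>.2 e
    rw [sobolevNorm, sobolevNorm, iInf_pos hh, iInf_pos hk, this]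
  · have hh : ¬ MemLp h 2 volume := fun h0 => hk ((memLp_congr_ae e).1 h0)
    rw [sobolevNorm, sobolevNorm, iInf_neg hh, iInf_neg hk]

lemma sobolevNorm_half_sq {h : R3 → ℂ} (hh : MemLp h 2 volume) :
    sobolevNorm (1 / 2) h ^ 2 = ∫⁻ ξ : R3, ENNReal.ofReal √(1 + ‖ξ‖ ^ 2)
      * ‖(𝓕 (hh.toLp h) : Lp ℂ 2 volume) ξ‖ₑ ^ 2 := by
  rw [sobolevNorm, iInf_pos hh, eLpNorm_two_sq]
  refine lintegral_congr fun ξ => ?_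
  rw [enorm_mul, mul_pow]
  congr 1
  have h0 : (0 : ℝ) ≤ (1 + ‖ξ‖ ^ 2) ^ ((1 / 2 : ℝ) / 2) := by positivity
  rw [← ofReal_norm, Complex.norm_real, Real.norm_of_nonneg h0, ← ENNReal.ofReal_pow h0,
    ← Real.rpow_natCast, ← Real.rpow_mul (by positivity), Real.sqrt_eq_rpow]
  norm_num

lemma lintegral_norm_mul_le_sobolevNorm_sq {h : R3 → ℂ} (hh : MemLp h 2 volume) :
    ∫⁻ ξ, ‖ξ‖ₑ * ‖(𝓕 (hh.toLp h) : Lp ℂ 2 volume) ξ‖ₑ ^ 2 ≤ sobolevNorm (1 / 2) h ^ 2 := by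
  rw [sobolevNorm_half_sq hh]
  refine lintegral_mono fun ξ => mul_le_mul' ?_ le_rfl
  rw [← ofReal_norm]
  exact ENNReal.ofReal_le_ofReal (Real.le_sqrt_of_sq_le (by linarith))

/-- `√(1 + r²) ≤ 1 + r` separates the `L²` norm, which grows in time, from the homogeneous part,
which does not. -/
lemma sobolevNorm_sq_le {h : R3 → ℂ} (hh : MemLp h 2 volume) :
    sobolevNorm (1 / 2) h ^ 2 ≤ (∫⁻ x, ‖h x‖ₑ ^ 2)
      + ∫⁻ ξ, ‖ξ‖ₑ * ‖(𝓕 (hh.toLp h) : Lp ℂ 2 volume) ξ‖ₑ ^ 2 := by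
  rw [sobolevNorm_half_sq hh, ← lintegral_fourier_sq hh, ← lintegral_add_left'
    ((Lp.aestronglyMeasurable _).enorm.pow_const 2)]
  refine lintegral_mono fun ξ => ?_
  simp only
  rw [← one_add_mul]
  refine mul_le_mul' ?_ le_rfl
  rw [← ofReal_norm, ← ENNReal.ofReal_one, ← ENNReal.ofReal_add zero_le_one (norm_nonneg _)]
  refine ENNReal.ofReal_le_ofReal (Real.sqrt_le_iff.2 ⟨by positivity, ?_⟩)
  nlinarith [norm_nonneg ξ]

lemma wave_mul_estimates (t : ℝ) {f g : R3 → ℂ} (hfm : StronglyMeasurable f)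
    (hgm : StronglyMeasurable g) (hf : MemLp f 2 volume) (hg : MemLp g 2 volume)
    (hh : MemLp (fun x => wave t f x * wave t g x) 2 volume) :
    (∫⁻ x, ‖wave t f x * wave t g x‖ₑ ^ 2 ≤ ENNReal.ofReal (6 * Real.pi * |t|)
      * (eLpNorm f 2 volume ^ 2 * eLpNorm g 2 volume ^ 2)) ∧
    ∫⁻ ξ, ‖ξ‖ₑ * ‖(𝓕 (hh.toLp fun x => wave t f x * wave t g x) : Lp ℂ 2 volume) ξ‖ₑ ^ 2
      ≤ ENNReal.ofReal (40 * Real.pi) * (eLpNorm f 2 volume ^ 2 * eLpNorm g 2 volume ^ 2) := by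
  have hi := (exists_seq_wave_mul t hfm hgm hf hg).1
  constructor
  · rw [← lintegral_enorm_fourier_sq hh hi]
    have := lintegral_weight_fourier_wave_mul_le_of_memLp (t := t) (w := fun _ => 1)
      measurable_const ENNReal.ofReal_ne_top
      (fun ξ => by rw [one_mul]; exact lintegral_sinSymbol_mul_le' t ξ) hfm hgm hf hg
      (fun _ => ENNReal.one_ne_top)
    simpa only [one_mul] using this
  · refine le_trans (lintegral_mono_ae ?_) (lintegral_weight_fourier_wave_mul_le_of_memLp (t := t)
      (w := fun ξ => ‖ξ‖ₑ) measurable_enorm ENNReal.ofReal_ne_top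
      (lintegral_sinSymbol_mul_le t) hfm hgm hf hg (fun _ => enorm_ne_top))
    filter_upwards [fourier_toLp_ae_eq hh hi] with ξ hξ
    rw [hξ]

lemma rpow_half_le {a c N : ℝ≥0∞} (h : a ≤ c * N ^ 2) :
    a ^ (1 / 2 : ℝ) ≤ c ^ (1 / 2 : ℝ) * N := by
  refine (ENNReal.rpow_le_rpow h (by norm_num)).trans_eq ?_
  rw [ENNReal.mul_rpow_of_nonneg _ _ (by norm_num), ← ENNReal.rpow_natCast, ← ENNReal.rpow_mul]
  norm_num

theorem bilinear_sobolev_bound :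
    ∃ C C' : ℝ≥0, ∀ (t : ℝ) (f g : R3 → ℂ) (u v : ℝ → R3 → ℂ),
      MemLp f 2 volume → MemLp g 2 volume → IsWaveSolution f u → IsWaveSolution g v →
        eLpNorm (fun x => u t x * v t x) 3 volume
            ≤ C * sobolevNorm (1 / 2) (fun x => u t x * v t x) ∧
        sobolevNorm (1 / 2) (fun x => u t x * v t x)
            ≤ C' * ENNReal.ofReal (√(1 + |t|)) * (eLpNorm f 2 volume * eLpNorm g 2 volume) ∧
        eLpNorm (fun x => u t x * v t x) 3 volume
            ≤ C' * (eLpNorm f 2 volume * eLpNorm g 2 volume) := by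
  obtain ⟨C, hC0, hC⟩ := sobolev_three
  set c : ℝ≥0 := (40 * Real.pi).toNNReal ^ (1 / 2 : ℝ) with hc
  have hcE : (c : ℝ≥0∞) = ENNReal.ofReal (40 * Real.pi) ^ (1 / 2 : ℝ) := by
    rw [hc, ENNReal.coe_rpow_of_nonneg _ (by norm_num)]; rfl
  -- `c = √(40π)` serves the Sobolev bound and `C * c` the uniform `L³` bound; the sum covers both.
  refine ⟨C, c + C * c, fun t f g u v hf hg hu hv => ?_⟩
  -- Kirchhoff's integral evaluates the data on null sets, so the data are first replaced by
  -- strongly measurable representatives.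
  have hff : f =ᵐ[volume] hf.1.mk f := hf.1.ae_eq_mk
  have hgg : g =ᵐ[volume] hg.1.mk g := hg.1.ae_eq_mk
  have hfm : StronglyMeasurable (hf.1.mk f) := hf.1.stronglyMeasurable_mk
  have hgm : StronglyMeasurable (hg.1.mk g) := hg.1.stronglyMeasurable_mk
  have hf' : MemLp (hf.1.mk f) 2 volume := (memLp_congr_ae hff).1 hf
  have hg' : MemLp (hg.1.mk g) 2 volume := (memLp_congr_ae hgg).1 hg
  rw [eLpNorm_congr_ae hff, eLpNorm_congr_ae hgg]
  replace hu := hu.congr_data hff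
  replace hv := hv.congr_data hgg
  generalize hf.1.mk f = f' at *
  generalize hg.1.mk g = g' at *
  have e2 : ENNReal.ofReal 2 = 2 := by simp
  have eu := hu.ae_eq_wave hfm one_le_two (by rwa [e2]) t
  have ev := hv.ae_eq_wave hgm one_le_two (by rwa [e2]) t
  have euv : (fun x => u t x * v t x) =ᵐ[volume] fun x => wave t f' x * wave t g' x := by
    filter_upwards [eu, ev] with x h1 h2
    rw [h1, h2]
  rw [eLpNorm_congr_ae euv, sobolevNorm_congr_ae euv]
  have hh := memLp_wave_mul t hfm hgm hf' hg'
  obtain ⟨h1, h2⟩ := wave_mul_estimates t hfm hgm hf' hg' hh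
  rw [← mul_pow] at h1 h2
  have h3 := hC _ hh
  set N := eLpNorm f' 2 volume * eLpNorm g' 2 volume with hN
  refine ⟨h3.trans (mul_le_mul' le_rfl ?_), ?_, ?_⟩
  · have := rpow_half_le (c := 1) ((lintegral_norm_mul_le_sobolevNorm_sq hh).trans_eq
      (one_mul _).symm)
    simpa using this
  · have h4 : sobolevNorm (1 / 2) (fun x => wave t f' x * wave t g' x) ^ 2
        ≤ (ENNReal.ofReal (40 * Real.pi) * ENNReal.ofReal (1 + |t|)) * N ^ 2 := by
      refine (sobolevNorm_sq_le hh).trans ((add_le_add h1 h2).trans ?_)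
      rw [← add_mul, ← ENNReal.ofReal_add (by positivity) (by positivity),
        ← ENNReal.ofReal_mul (p := 40 * Real.pi) (by positivity)]
      refine mul_le_mul' (ENNReal.ofReal_le_ofReal ?_) le_rfl
      nlinarith [Real.pi_pos, mul_nonneg Real.pi_pos.le (abs_nonneg t)]
    have h5 := rpow_half_le h4
    rw [← ENNReal.rpow_natCast, ← ENNReal.rpow_mul, ENNReal.mul_rpow_of_nonneg _ _ (by norm_num),
      ← hcE, ENNReal.ofReal_rpow_of_nonneg (by positivity) (by norm_num),
      ← Real.sqrt_eq_rpow] at h5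
    norm_num at h5
    refine h5.trans (mul_le_mul' (mul_le_mul' ?_ le_rfl) le_rfl)
    push_cast
    exact le_self_add
  · refine h3.trans ((mul_le_mul' le_rfl (rpow_half_le h2)).trans ?_)
    rw [← hcE, ← mul_assoc]
    refine mul_le_mul' ?_ le_rfl
    push_cast
    exact le_add_self

/-! ### Translation differences of Kirchhoff's solution in `L²`. -/

/-- The gain of one derivative: a translation by `y` costs `2π‖ξ‖‖y‖`, which the decay `1/(2π‖ξ‖)`
of the symbol cancels, uniformly in `t`. -/
lemma norm_one_sub_exp_mul_sinSymbol_le (t : ℝ) (y ξ : R3) :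
    ‖(1 - Complex.exp (2 * Real.pi * Complex.I * (inner ℝ ξ y : ℝ))) * sinSymbol t ξ‖ ≤ ‖y‖ := by
  have h1 : ‖1 - Complex.exp (2 * Real.pi * Complex.I * (inner ℝ ξ y : ℝ))‖
      ≤ 2 * Real.pi * ‖ξ‖ * ‖y‖ := by
    have := Real.norm_exp_I_mul_ofReal_sub_one_le (x := 2 * Real.pi * inner ℝ ξ y)
    rw [norm_sub_rev]
    calc _ = ‖Complex.exp (Complex.I * ((2 * Real.pi * inner ℝ ξ y : ℝ) : ℂ)) - 1‖ := by
          congr 3; push_cast; ring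
      _ ≤ _ := this
      _ = 2 * Real.pi * |inner ℝ ξ y| := by
          rw [Real.norm_eq_abs, abs_mul, abs_of_pos (by positivity)]
      _ ≤ 2 * Real.pi * (‖ξ‖ * ‖y‖) := by
          gcongr
          exact abs_real_inner_le_norm ξ y
      _ = _ := by ring
  rw [norm_mul, Complex.norm_real, Real.norm_eq_abs]
  calc _ ≤ (2 * Real.pi * ‖ξ‖ * ‖y‖) * |sinSymbol t ξ| := by gcongr
    _ = (2 * Real.pi * ‖ξ‖ * |sinSymbol t ξ|) * ‖y‖ := by ring
    _ ≤ 1 * ‖y‖ := by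
        gcongr
        exact norm_mul_abs_sinSymbol_le t ξ
    _ = _ := one_mul _

lemma fourier_comp_add_right' (U : R3 → ℂ) (y ξ : R3) :
    𝓕 (fun x => U (x + y)) ξ = Complex.exp (2 * Real.pi * Complex.I * (inner ℝ ξ y : ℝ)) * 𝓕 U ξ := by
  rw [Real.fourier_eq', Real.fourier_eq', ← integral_add_right_eq_self
    (fun v => Complex.exp (↑(-2 * Real.pi * inner ℝ v ξ) * Complex.I) • U v) y, ← integral_const_mul]
  congr 1; ext v
  simp only [smul_eq_mul]
  rw [← mul_assoc, ← Complex.exp_add]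
  congr 2
  rw [inner_add_left, real_inner_comm ξ y]
  push_cast; ring

lemma eLpNorm_wave_translate_le_of_contDiff (t : ℝ) (y : R3) {f : R3 → ℂ} (hf : ContDiff ℝ ∞ f)
    (hc : HasCompactSupport f) :
    eLpNorm (fun x => wave t f x - wave t f (x + y)) 2 volume ≤ ‖y‖ₑ * eLpNorm f 2 volume := by
  obtain ⟨U, hU, hUc, hUF⟩ := exists_schwartz_wave hf hc t
  have hUi : Integrable U := U.integrable
  have hUi' : Integrable fun x => U (x + y) := hUi.comp_add_right y
  have hU2 : MemLp U 2 volume := U.memLp 2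
  have hU2' : MemLp (fun x => U (x + y)) 2 volume :=
    hU2.comp_measurePreserving (measurePreserving_add_right volume y)
  rw [← hU]
  change eLpNorm (⇑U - fun x => U (x + y)) 2 volume ≤ _
  refine (ENNReal.pow_le_pow_left_iff two_ne_zero).1 ?_
  have hfi : Integrable f := hf.continuous.integrable_of_hasCompactSupport hc
  rw [mul_pow, eLpNorm_two_sq, eLpNorm_two_sq,
    ← lintegral_enorm_fourier_sq (hU2.sub hU2') (hUi.sub hUi'),
    ← lintegral_enorm_fourier_sq (hf.continuous.memLp_of_hasCompactSupport hc) hfi,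
    ← lintegral_const_mul _ ((measurable_fourier hfi).enorm.pow_const 2)]
  refine lintegral_mono fun ξ => ?_
  have e : 𝓕 (⇑U - fun x => U (x + y)) ξ
      = ((1 - Complex.exp (2 * Real.pi * Complex.I * (inner ℝ ξ y : ℝ))) * sinSymbol t ξ)
        * 𝓕 f ξ := by
    have h1 : 𝓕 (⇑U - fun x => U (x + y)) ξ = 𝓕 (⇑U) ξ - 𝓕 (fun x => U (x + y)) ξ := by
      simp only [Real.fourier_eq]
      rw [← integral_sub ((Real.fourierIntegral_convergent_iff ξ).2 hUi)
        ((Real.fourierIntegral_convergent_iff ξ).2 hUi')]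
      simp [smul_sub]
    rw [h1, fourier_comp_add_right', ← SchwartzMap.fourier_coe, hUF]
    ring
  rw [e, enorm_mul, mul_pow]
  refine mul_le_mul' (pow_le_pow_left₀ zero_le ?_ 2) le_rfl
  rw [← ofReal_norm, ← ofReal_norm]
  exact ENNReal.ofReal_le_ofReal (norm_one_sub_exp_mul_sinSymbol_le t y ξ)

lemma eLpNorm_wave_translate_le (t : ℝ) (y : R3) {f : R3 → ℂ} (hfm : StronglyMeasurable f)
    (hf : MemLp f 2 volume) :
    eLpNorm (fun x => wave t f x - wave t f (x + y)) 2 volume ≤ ‖y‖ₑ * eLpNorm f 2 volume := by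
  obtain ⟨F, hFd, hFc, hF0, hF⟩ := exists_seq_contDiff_tendsto (by norm_num) (by norm_num) hf
  have e2 : ENNReal.ofReal 2 = 2 := by simp
  have hlim : Tendsto (fun n => 2 * (ENNReal.ofReal |t| * eLpNorm (F n - f) 2 volume)
      + ‖y‖ₑ * eLpNorm (F n) 2 volume) atTop (𝓝 (‖y‖ₑ * eLpNorm f 2 volume)) := by
    have h1 := ENNReal.Tendsto.const_mul hF0 (Or.inr (ENNReal.ofReal_ne_top (r := |t|)))
    have h2 := ENNReal.Tendsto.const_mul h1 (Or.inr (ENNReal.ofNat_ne_top (n := 2)))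
    have h3 := ENNReal.Tendsto.const_mul hF (Or.inr (enorm_ne_top (x := y)))
    simpa using h2.add h3
  refine ge_of_tendsto hlim (Eventually.of_forall fun n => ?_)
  have hm : StronglyMeasurable (F n) := (hFd n).continuous.stronglyMeasurable
  have hM : MemLp (F n) 2 volume := (hFd n).continuous.memLp_of_hasCompactSupport (hFc n)
  have hd := eLpNorm_wave_sub_le t hm hfm one_le_two (by rwa [e2]) (by rwa [e2])
  rw [e2] at hd
  have mf := stronglyMeasurable_wave t hfm
  have mF := stronglyMeasurable_wave t hm
  have hmp := measurePreserving_add_right (volume : Measure R3) y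
  have htr : eLpNorm (fun x => (wave t (F n) - wave t f) (x + y)) 2 volume
      = eLpNorm (wave t (F n) - wave t f) 2 volume :=
    eLpNorm_comp_measurePreserving (mF.sub mf).aestronglyMeasurable hmp
  have e : (fun x => wave t f x - wave t f (x + y))
      = ((fun x => wave t (F n) x - wave t (F n) (x + y)) - (wave t (F n) - wave t f))
        + fun x => (wave t (F n) - wave t f) (x + y) := by
    ext x
    simp only [Pi.add_apply, Pi.sub_apply]
    ring
  have m1 : AEStronglyMeasurable (fun x => (wave t (F n) - wave t f) (x + y)) volume :=
    ((mF.sub mf).comp_measurable hmp.measurable).aestronglyMeasurable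
  have m2 : AEStronglyMeasurable (fun x => wave t (F n) x - wave t (F n) (x + y)) volume :=
    (mF.sub (mF.comp_measurable hmp.measurable)).aestronglyMeasurable
  rw [e]
  refine (eLpNorm_add_le (m2.sub (mF.sub mf).aestronglyMeasurable) m1 one_le_two).trans ?_
  refine (add_le_add (eLpNorm_sub_le m2 (mF.sub mf).aestronglyMeasurable one_le_two)
    htr.le).trans ?_
  refine (add_le_add (add_le_add (eLpNorm_wave_translate_le_of_contDiff t y (hFd n) (hFc n)) hd)
    hd).trans_eq ?_
  ring

lemma avg_indicator_one (t : ℝ) {E : Set R3} (hE : MeasurableSet E) (x : R3) :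
    avg t (E.indicator 1) x = sph {θ | x + t • θ ∈ E} := by
  have hm : MeasurableSet {θ | x + t • θ ∈ E} := (by fun_prop : Measurable fun θ : R3 => x + t • θ) hE
  rw [avg, ← lintegral_indicator_one hm]
  rfl

lemma wave_indicator_one (t : ℝ) {E : Set R3} (hE : MeasurableSet E) (x : R3) :
    wave t (E.indicator (1 : R3 → ℂ)) x = t * (avg t (E.indicator 1) x).toReal := by
  have hm : MeasurableSet {θ | x + t • θ ∈ E} := (by fun_prop : Measurable fun θ : R3 => x + t • θ) hE
  have h1 : ∫ θ, E.indicator (1 : R3 → ℂ) (x + t • θ) ∂sph = sph.real {θ | x + t • θ ∈ E} := by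
    have := integral_indicator_const (μ := sph) (1 : ℂ) hm
    rw [Complex.real_smul, mul_one] at this
    rw [← this]
    rfl
  rw [avg_indicator_one t hE, wave, h1, Complex.real_smul]
  rfl

/-- Spherical averages of indicators are Lipschitz under translation, in `L²`. -/
lemma lintegral_avg_translate_sq_le {t : ℝ} (ht : t ≠ 0) (y : R3) {E : Set R3} (hE : MeasurableSet E)
    (hEf : volume E ≠ ⊤) :
    ∫⁻ x, (avg t (E.indicator 1) x - avg t (E.indicator 1) (x + y)) ^ 2
      ≤ ENNReal.ofReal ((‖y‖ / |t|) ^ 2) * volume E := by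
  have ht0 : 0 < |t| := abs_pos.2 ht
  set f : R3 → ℂ := E.indicator 1 with hf
  have hfm : StronglyMeasurable f := stronglyMeasurable_one.indicator hE
  have hf2 : eLpNorm f 2 volume ^ 2 = volume E := by
    rw [eLpNorm_two_sq, ← lintegral_indicator_one hE]
    congr 1; ext x
    by_cases h : x ∈ E <;> simp [hf, h]
  have hfL : MemLp f 2 volume := ⟨hfm.aestronglyMeasurable,
    (ENNReal.pow_lt_top_iff (n := 2)).1 (hf2 ▸ hEf.lt_top) |>.resolve_right two_ne_zero⟩
  have h1 := pow_le_pow_left₀ zero_le (eLpNorm_wave_translate_le t y hfm hfL) 2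
  rw [mul_pow, hf2, eLpNorm_two_sq] at h1
  have hle1 : ∀ x, avg t (E.indicator 1) x ≠ ⊤ := fun x => by
    rw [avg_indicator_one t hE]; exact measure_ne_top _ _
  -- On an indicator, `avg` is `wave` divided by `t`. Subtraction in `ℝ≥0∞` is truncated and keeps
  -- only the positive part, bounded by the absolute value.
  have h2 : ∀ x, avg t (E.indicator 1) x - avg t (E.indicator 1) (x + y)
      ≤ ENNReal.ofReal |t|⁻¹ * ‖wave t f x - wave t f (x + y)‖ₑ := by
    intro x
    rw [hf, wave_indicator_one t hE, wave_indicator_one t hE, ← mul_sub, enorm_mul,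
      ← Complex.ofReal_sub, ← ofReal_norm, ← ofReal_norm, Complex.norm_real, Complex.norm_real,
      Real.norm_eq_abs, Real.norm_eq_abs, ← mul_assoc, ← ENNReal.ofReal_mul (by positivity),
      inv_mul_cancel₀ ht0.ne', ENNReal.ofReal_one, one_mul]
    refine le_trans ?_ (ENNReal.ofReal_le_ofReal (le_abs_self _))
    rw [ENNReal.ofReal_sub _ ENNReal.toReal_nonneg, ENNReal.ofReal_toReal (hle1 _),
      ENNReal.ofReal_toReal (hle1 _)]
  calc _ ≤ ∫⁻ x, ENNReal.ofReal |t|⁻¹ ^ 2 * ‖wave t f x - wave t f (x + y)‖ₑ ^ 2 :=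
        lintegral_mono fun x => (pow_le_pow_left₀ zero_le (h2 x) 2).trans_eq (mul_pow _ _ _)
    _ = ENNReal.ofReal |t|⁻¹ ^ 2 * ∫⁻ x, ‖wave t f x - wave t f (x + y)‖ₑ ^ 2 :=
        lintegral_const_mul' _ _ (by finiteness)
    _ ≤ ENNReal.ofReal |t|⁻¹ ^ 2 * (‖y‖ₑ ^ 2 * volume E) := mul_le_mul' le_rfl h1
    _ = _ := by
        rw [← mul_assoc, ← mul_pow, ← ofReal_norm, ← ENNReal.ofReal_mul (by positivity),
          ← ENNReal.ofReal_pow (by positivity)]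
        congr 3
        field_simp

/-! ### Level sets of spherical averages of indicators. -/

lemma sph_smul_ball_le {t : ℝ} (ht : t ≠ 0) (z : R3) (δ : ℝ) :
    sph {θ | ‖z - t • θ‖ < δ} ≤ ENNReal.ofReal (2 * (δ / |t|) ^ 2) := by
  refine le_trans (measure_mono fun θ hθ => ?_) (sph_ball_le (t⁻¹ • z) (δ / |t|))
  have ht0 : 0 < |t| := abs_pos.2 ht
  have h1 : z - t • θ = t • (t⁻¹ • z - θ) := by rw [smul_sub, smul_inv_smul₀ ht]
  simp only [Set.mem_ofPred_eq] at hθ ⊢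
  rw [h1, norm_smul, Real.norm_eq_abs] at hθ
  rwa [lt_div_iff₀ ht0, mul_comm]

/-- Tonelli exchanges the roles: each `z` is charged the `sph`-measure of the directions `θ` with
`‖z - x - tθ‖ < δ`, which `sph_smul_ball_le` bounds. -/
lemma setLIntegral_avg_le {t : ℝ} (ht : t ≠ 0) {F : R3 → ℝ≥0∞} (hF : Measurable F) (x : R3) (δ : ℝ) :
    ∫⁻ y in Metric.ball (0 : R3) δ, avg t F (x + y)
      ≤ ENNReal.ofReal (2 * (δ / |t|) ^ 2) * ∫⁻ z, F z := by
  set B : Set R3 := Metric.ball 0 δ with hB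
  have hBm : MeasurableSet B := measurableSet_ball
  have hBi : Measurable (B.indicator (1 : R3 → ℝ≥0∞)) := measurable_one.indicator hBm
  have hm1 : Measurable fun p : R3 × R3 => B.indicator (1 : R3 → ℝ≥0∞) p.1 * F (x + p.1 + t • p.2) :=
    (hBi.comp measurable_fst).mul (hF.comp (by fun_prop))
  have hm2 : Measurable fun p : R3 × R3 => B.indicator (1 : R3 → ℝ≥0∞) (p.2 - x - t • p.1) * F p.2 :=
    (hBi.comp (by fun_prop)).mul (hF.comp measurable_snd)
  calc ∫⁻ y in B, avg t F (x + y)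
      = ∫⁻ y, ∫⁻ θ, B.indicator (1 : R3 → ℝ≥0∞) y * F (x + y + t • θ) ∂sph := by
        rw [← lintegral_indicator hBm]
        refine lintegral_congr fun y => ?_
        rw [lintegral_const_mul _ (by fun_prop)]
        by_cases hy : y ∈ B <;> simp [hy, avg]
    _ = ∫⁻ θ, (∫⁻ y, B.indicator (1 : R3 → ℝ≥0∞) y * F (x + y + t • θ)) ∂sph :=
        lintegral_lintegral_swap hm1.aemeasurable
    _ = ∫⁻ θ, (∫⁻ z, B.indicator (1 : R3 → ℝ≥0∞) (z - x - t • θ) * F z) ∂sph := by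
        refine lintegral_congr fun θ => ?_
        rw [← lintegral_add_right_eq_self (μ := volume)
          (fun z => B.indicator (1 : R3 → ℝ≥0∞) (z - x - t • θ) * F z) (x + t • θ)]
        refine lintegral_congr fun y => ?_
        congr 2 <;> abel
    _ = ∫⁻ z, ∫⁻ θ, B.indicator (1 : R3 → ℝ≥0∞) (z - x - t • θ) * F z ∂sph ∂volume :=
        lintegral_lintegral_swap hm2.aemeasurable
    _ ≤ ∫⁻ z, ENNReal.ofReal (2 * (δ / |t|) ^ 2) * F z := by
        refine lintegral_mono fun z => ?_
        rw [lintegral_mul_const _ (by fun_prop)]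
        refine mul_le_mul' ?_ le_rfl
        have hS : MeasurableSet {θ | ‖(z - x) - t • θ‖ < δ} :=
          measurableSet_lt (by fun_prop) measurable_const
        refine le_trans (le_of_eq ?_) (sph_smul_ball_le ht (z - x) δ)
        rw [← lintegral_indicator_one hS]
        refine lintegral_congr fun θ => ?_
        have hiff : z - x - t • θ ∈ B ↔ θ ∈ {θ | ‖(z - x) - t • θ‖ < δ} := mem_ball_zero_iff
        by_cases h : z - x - t • θ ∈ B
        · rw [Set.indicator_of_mem h, Set.indicator_of_mem (hiff.1 h)]
          rfl
        · rw [Set.indicator_of_notMem h, Set.indicator_of_notMem (fun h' => h (hiff.2 h'))]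
    _ = _ := lintegral_const_mul _ hF

/-- Deviation of a spherical average from its mean over balls, in `L²`. -/
lemma lintegral_avg_sub_ball_sq_le {t : ℝ} (ht : t ≠ 0) {δ : ℝ} (hδ : 0 < δ) {E : Set R3}
    (hE : MeasurableSet E) (hEf : volume E ≠ ⊤) :
    ∫⁻ x, (avg t (E.indicator 1) x
        - ∫⁻ y, avg t (E.indicator 1) (x + y) ∂(ProbabilityTheory.cond volume (Metric.ball (0 : R3) δ))) ^ 2
      ≤ ENNReal.ofReal ((δ / |t|) ^ 2) * volume E := by
  set G := avg t (E.indicator (1 : R3 → ℝ≥0∞)) with hG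
  have hGm : Measurable G := measurable_avg t (measurable_one.indicator hE)
  have hV : volume (Metric.ball (0 : R3) δ) ≠ 0 := (Metric.measure_ball_pos _ _ hδ).ne'
  set ν : Measure R3 := ProbabilityTheory.cond volume (Metric.ball (0 : R3) δ) with hν
  have : IsProbabilityMeasure ν :=
    ProbabilityTheory.cond_isProbabilityMeasure_of_finite hV measure_ball_lt_top.ne
  have hm : Measurable fun p : R3 × R3 => (G p.1 - G (p.1 + p.2)) ^ 2 :=
    ((hGm.comp measurable_fst).sub (hGm.comp (by fun_prop))).pow_const 2
  calc _ ≤ ∫⁻ x, ∫⁻ y, (G x - G (x + y)) ^ 2 ∂ν := by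
        refine lintegral_mono fun x => ?_
        have hmx : Measurable fun y => G x - G (x + y) :=
          measurable_const.sub (hGm.comp (by fun_prop))
        have h1 : G x - ∫⁻ y, G (x + y) ∂ν ≤ ∫⁻ y, (G x - G (x + y)) ∂ν := by
          have := lintegral_sub_le (μ := ν) (fun y => G (x + y)) (fun _ => G x)
            (hGm.comp (by fun_prop))
          simpa using this
        have h2 := lintegral_mul_sq_le (μ := ν) hmx.aemeasurable
          (measurable_const (a := (1 : ℝ≥0∞))).aemeasurable
        refine (pow_le_pow_left₀ zero_le h1 2).trans ?_
        simpa using h2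
    _ = ∫⁻ y, ∫⁻ x, (G x - G (x + y)) ^ 2 ∂volume ∂ν := lintegral_lintegral_swap hm.aemeasurable
    _ ≤ ∫⁻ _, ENNReal.ofReal ((δ / |t|) ^ 2) * volume E ∂ν := by
        refine lintegral_mono_ae ?_
        filter_upwards [ProbabilityTheory.ae_cond_mem (μ := (volume : Measure R3))
          (measurableSet_ball (x := (0 : R3)) (ε := δ))] with y hy
        refine (lintegral_avg_translate_sq_le ht y hE hEf).trans (mul_le_mul' ?_ le_rfl)
        refine ENNReal.ofReal_le_ofReal ?_
        have : ‖y‖ ≤ δ := by simpa using (mem_ball_zero_iff.1 hy).le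
        gcongr
    _ = _ := by simp

/-- Dividing `2(δ/|t|)²` by the volume `4πδ³/3` leaves `3/(2π) ≤ 1` times `1/(δt²)`. -/
lemma lintegral_cond_ball_avg_le {t : ℝ} (ht : t ≠ 0) {δ : ℝ} (hδ : 0 < δ) {F : R3 → ℝ≥0∞}
    (hF : Measurable F) (x : R3) :
    ∫⁻ y, avg t F (x + y) ∂(ProbabilityTheory.cond volume (Metric.ball (0 : R3) δ))
      ≤ ENNReal.ofReal (1 / (δ * t ^ 2)) * ∫⁻ z, F z := by
  have ht0 : 0 < |t| := abs_pos.2 ht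
  rw [ProbabilityTheory.cond, lintegral_smul_measure, smul_eq_mul]
  refine (mul_le_mul' le_rfl (setLIntegral_avg_le ht hF x δ)).trans ?_
  rw [← mul_assoc]
  refine mul_le_mul' ?_ le_rfl
  rw [EuclideanSpace.volume_ball_fin_three, ← ENNReal.ofReal_pow hδ.le,
    ← ENNReal.ofReal_mul (by positivity), ← ENNReal.ofReal_inv_of_pos (by positivity),
    ← ENNReal.ofReal_mul (by positivity)]
  refine ENNReal.ofReal_le_ofReal ?_
  rw [div_pow, sq_abs, ← sub_nonneg]
  have : 1 / (δ * t ^ 2) - (δ ^ 3 * (Real.pi * 4 / 3))⁻¹ * (2 * (δ ^ 2 / t ^ 2))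
      = (1 - 3 / (2 * Real.pi)) / (δ * t ^ 2) := by
    field_simp
    ring
  rw [this]
  have : 3 / (2 * Real.pi) ≤ 1 := by
    rw [div_le_one (by positivity)]; linarith [Real.pi_gt_three]
  have : 0 ≤ 1 - 3 / (2 * Real.pi) := by linarith
  positivity

lemma measure_le_avg_le {t : ℝ} {E : Set R3} (hE : MeasurableSet E)
    {l : ℝ} (hl : 0 < l) :
    volume {x | ENNReal.ofReal l ≤ avg t (E.indicator 1) x} ≤ volume E / ENNReal.ofReal l := by
  have h1 := mul_meas_ge_le_lintegral (μ := (volume : Measure R3))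
    (measurable_avg t ((measurable_one (α := ℝ≥0∞)).indicator hE)) (ENNReal.ofReal l)
  have h2 := lintegral_avg_rpow_le t ((measurable_one (α := ℝ≥0∞)).indicator hE) le_rfl
  simp only [ENNReal.rpow_one, lintegral_indicator_one hE] at h2
  rw [ENNReal.le_div_iff_mul_le (Or.inl (by simpa using hl)) (Or.inl ENNReal.ofReal_ne_top), mul_comm]
  exact h1.trans h2

/-- Level sets of spherical averages of indicators. -/
lemma measure_le_avg_le_pow {t : ℝ} (ht : t ≠ 0) {E : Set R3} (hE : MeasurableSet E)
    (hEf : volume E ≠ ⊤) {l : ℝ} (hl : 0 < l) :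
    volume {x | ENNReal.ofReal l ≤ avg t (E.indicator 1) x}
      ≤ ENNReal.ofReal (16 / |t| ^ 6 * volume.real E ^ 3 * l⁻¹ ^ 4) := by
  have ht0 : 0 < |t| := abs_pos.2 ht
  have hlE : ENNReal.ofReal l ≠ 0 := by simpa using hl
  set m := volume.real E with hm
  have hmE : volume E = ENNReal.ofReal m := by rw [hm, Measure.real, ENNReal.ofReal_toReal hEf]
  -- A null set would force `δ = 0` below; the first level set bound covers it.
  rcases (measureReal_nonneg (μ := volume) (s := E)).eq_or_lt with h0 | h0
  · refine (measure_le_avg_le hE hl).trans ?_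
    rw [hmE, hm, ← h0]
    simp
  have hm0 : 0 < m := h0
  -- Chosen so that the ball mean `L`, at most `m/(δt²)`, is at most `l/2`. Where `G ≥ l` the
  -- deviation is then at least `l/2`, and Chebyshev in `L²` gives `(δ/|t|)² m · 4/l² =
  -- 16m³/(|t|⁶l⁴)`.
  set δ : ℝ := 2 * m / (l * t ^ 2) with hδ
  have ht2 : 0 < t ^ 2 := by positivity
  have hδ0 : 0 < δ := by positivity
  set G := avg t (E.indicator (1 : R3 → ℝ≥0∞)) with hG
  have hGm : Measurable G := measurable_avg t (measurable_one.indicator hE)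
  set L : R3 → ℝ≥0∞ := fun x =>
    ∫⁻ y, G (x + y) ∂(ProbabilityTheory.cond volume (Metric.ball (0 : R3) δ)) with hL
  have hLle : ∀ x, L x ≤ ENNReal.ofReal (l / 2) := fun x => by
    refine (lintegral_cond_ball_avg_le ht hδ0 (measurable_one.indicator hE) x).trans ?_
    rw [lintegral_indicator_one hE, hmE, ← ENNReal.ofReal_mul (by positivity)]
    refine ENNReal.ofReal_le_ofReal (le_of_eq ?_)
    rw [hδ]
    field_simp
  have hsub : {x | ENNReal.ofReal l ≤ G x} ⊆ {x | ENNReal.ofReal (l ^ 2 / 4) ≤ (G x - L x) ^ 2} := by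
    intro x hx
    have h1 : ENNReal.ofReal (l / 2) ≤ G x - L x := by
      refine ENNReal.le_sub_of_add_le_right (ne_top_of_le_ne_top ENNReal.ofReal_ne_top (hLle x)) ?_
      refine le_trans ?_ hx
      refine (add_le_add le_rfl (hLle x)).trans_eq ?_
      rw [← ENNReal.ofReal_add (by positivity) (by positivity), add_halves]
    refine le_trans (le_of_eq ?_) (pow_le_pow_left₀ zero_le h1 2)
    rw [← ENNReal.ofReal_pow (by positivity)]
    congr 1; ring
  have hLm : Measurable L := by
    have h1 : Measurable fun p : R3 × R3 => G (p.1 + p.2) := hGm.comp (by fun_prop)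
    exact h1.lintegral_prod_right'
  have hpos : ENNReal.ofReal (l ^ 2 / 4) ≠ 0 := by simpa using by positivity
  calc volume {x | ENNReal.ofReal l ≤ G x}
      ≤ (∫⁻ x, (G x - L x) ^ 2) / ENNReal.ofReal (l ^ 2 / 4) := by
        refine (measure_mono hsub).trans ?_
        exact meas_ge_le_lintegral_div ((hGm.sub hLm).pow_const 2).aemeasurable hpos
          ENNReal.ofReal_ne_top
    _ ≤ (ENNReal.ofReal ((δ / |t|) ^ 2) * ENNReal.ofReal m) / ENNReal.ofReal (l ^ 2 / 4) := by
        rw [← hmE]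
        exact ENNReal.div_le_div_right (lintegral_avg_sub_ball_sq_le ht hδ0 hE hEf) _
    _ = _ := by
        rw [← ENNReal.ofReal_mul (by positivity), ← ENNReal.ofReal_div_of_pos (by positivity)]
        congr 1
        rw [hδ, ← sq_abs t]
        field_simp
        ring

/-! ### Interpolation: from indicators to `L^p → L^q`. -/

lemma lintegral_Ioc_rpow {s : ℝ} (hs : -1 < s) :
    ∫⁻ l in Set.Ioc (0 : ℝ) 1, ENNReal.ofReal (l ^ s) = ENNReal.ofReal (s + 1)⁻¹ := by
  rw [← ofReal_integral_eq_lintegral_ofReal, ← intervalIntegral.integral_of_le zero_le_one,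
    integral_rpow (Or.inl hs)]
  · simp [Real.zero_rpow (by linarith : s + 1 ≠ 0)]
  · exact (intervalIntegrable_iff_integrableOn_Ioc_of_le zero_le_one).1
      (intervalIntegral.intervalIntegrable_rpow' hs)
  · filter_upwards [ae_restrict_mem measurableSet_Ioc] with l hl
    exact Real.rpow_nonneg hl.1.le _

/-- Restricted `L^p → L^q` bounds for spherical averages. -/
lemma exists_lintegral_avg_indicator_rpow_le {t : ℝ} (ht : t ≠ 0) {q θ : ℝ} (hq : 4 ≤ q)
    (hθ0 : 0 < θ) (hθ1 : θ < 1) : ∃ K : ℝ, 0 ≤ K ∧ ∀ E : Set R3, MeasurableSet E → volume E ≠ ⊤ →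
      ∫⁻ x, avg t (E.indicator 1) x ^ q ≤ ENNReal.ofReal (K * volume.real E ^ (1 + 2 * θ)) := by
  have ht0 : 0 < |t| := abs_pos.2 ht
  set D : ℝ := (16 / |t| ^ 6) ^ θ with hD
  have hD0 : 0 < D := by positivity
  -- Integrability at `l = 0`; this is where `4 ≤ q` enters for every `θ < 1`.
  have hs : -1 < q - 2 - 3 * θ := by linarith
  have hs0 : 0 < q - 2 - 3 * θ + 1 := by linarith
  refine ⟨q * (D * (q - 2 - 3 * θ + 1)⁻¹), by positivity, fun E hE hEf => ?_⟩
  set m := volume.real E with hm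
  have hm0 : 0 ≤ m := measureReal_nonneg
  set G := avg t (E.indicator (1 : R3 → ℝ≥0∞)) with hG
  have hGm : Measurable G := measurable_avg t (measurable_one.indicator hE)
  have hG1 : ∀ x, G x ≤ 1 := fun x => by rw [hG, avg_indicator_one t hE]; exact prob_le_one
  have hGt : ∀ x, G x ≠ ⊤ := fun x => ne_top_of_le_ne_top ENNReal.one_ne_top (hG1 x)
  have e1 : ∫⁻ x, G x ^ q = ∫⁻ x, ENNReal.ofReal ((G x).toReal ^ q) := by
    refine lintegral_congr fun x => ?_
    rw [← ENNReal.ofReal_rpow_of_nonneg ENNReal.toReal_nonneg (by linarith),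
      ENNReal.ofReal_toReal (hGt x)]
  have hlev : ∀ l ∈ Set.Ioi (0 : ℝ), volume {x | l ≤ (G x).toReal} * ENNReal.ofReal (l ^ (q - 1))
      ≤ (Set.Iic (1 : ℝ)).indicator (fun l => ENNReal.ofReal (D * m ^ (1 + 2 * θ))
        * ENNReal.ofReal (l ^ (q - 2 - 3 * θ))) l := by
    intro l hl
    have hl : 0 < l := hl
    by_cases hl1 : l ≤ 1
    · rw [Set.indicator_of_mem (by exact hl1)]
      have hset : {x | l ≤ (G x).toReal} = {x | ENNReal.ofReal l ≤ G x} := by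
        ext x
        exact (ENNReal.ofReal_le_iff_le_toReal (hGt x)).symm
      have h1 : volume {x | l ≤ (G x).toReal} ≤ ENNReal.ofReal (m / l) := by
        rw [hset]
        refine (measure_le_avg_le hE hl).trans_eq ?_
        rw [ENNReal.ofReal_div_of_pos hl, hm, Measure.real, ENNReal.ofReal_toReal hEf]
      have h2 : volume {x | l ≤ (G x).toReal} ≤ ENNReal.ofReal (16 / |t| ^ 6 * m ^ 3 * l⁻¹ ^ 4) := by
        rw [hset]
        exact measure_le_avg_le_pow ht hE hEf hl
      -- The geometric mean of the two level set bounds: up to a constant, `m^(1+2θ) l^(-1-3θ)`.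
      have h3 : volume {x | l ≤ (G x).toReal}
          ≤ ENNReal.ofReal ((m / l) ^ (1 - θ) * (16 / |t| ^ 6 * m ^ 3 * l⁻¹ ^ 4) ^ θ) := by
        rw [ENNReal.ofReal_mul (by positivity),
          ← ENNReal.ofReal_rpow_of_nonneg (by positivity) (by linarith),
          ← ENNReal.ofReal_rpow_of_nonneg (by positivity) (by linarith)]
        calc volume {x | l ≤ (G x).toReal} = volume {x | l ≤ (G x).toReal} ^ (1 - θ)
              * volume {x | l ≤ (G x).toReal} ^ θ := by
              rw [← ENNReal.rpow_add_of_nonneg _ _ (by linarith) hθ0.le, sub_add_cancel,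
                ENNReal.rpow_one]
          _ ≤ _ := mul_le_mul' (ENNReal.rpow_le_rpow h1 (by linarith))
              (ENNReal.rpow_le_rpow h2 hθ0.le)
      refine (mul_le_mul' h3 le_rfl).trans_eq ?_
      rw [← ENNReal.ofReal_mul (by positivity), ← ENNReal.ofReal_mul (by positivity)]
      congr 1
      rw [Real.mul_rpow (by positivity) (by positivity), Real.mul_rpow (by positivity)
        (by positivity), ← hD, Real.div_rpow hm0 hl.le, ← Real.rpow_natCast m 3,
        ← Real.rpow_mul hm0, inv_pow, Real.inv_rpow (by positivity), ← Real.rpow_natCast l 4,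
        ← Real.rpow_mul hl.le]
      have e3 : m ^ (1 + 2 * θ) = m ^ (1 - θ) * m ^ (((3 : ℕ) : ℝ) * θ) := by
        rw [← Real.rpow_add_of_nonneg hm0 (by linarith) (by positivity)]
        congr 1; push_cast; ring
      have e4 : l ^ (q - 1) = l ^ (q - 2 - 3 * θ) * (l ^ (1 - θ) * l ^ (((4 : ℕ) : ℝ) * θ)) := by
        rw [← Real.rpow_add hl, ← Real.rpow_add hl]
        congr 1; push_cast; ring
      rw [e3, e4]
      have := Real.rpow_pos_of_pos hl (1 - θ)
      have := Real.rpow_pos_of_pos hl (((4 : ℕ) : ℝ) * θ)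
      field_simp
    · have hempty : {x | l ≤ (G x).toReal} = ∅ := by
        refine Set.eq_empty_of_forall_notMem fun x hx => hl1 (le_trans hx ?_)
        exact ENNReal.toReal_le_of_le_ofReal zero_le_one (by simpa using hG1 x)
      rw [hempty]
      simp
  rw [e1, lintegral_rpow_eq_lintegral_meas_le_mul volume
    (Eventually.of_forall fun x => ENNReal.toReal_nonneg) hGm.ennreal_toReal.aemeasurable
    (by linarith)]
  calc _ ≤ ENNReal.ofReal q * ∫⁻ l in Set.Ioi (0 : ℝ), (Set.Iic (1 : ℝ)).indicator
          (fun l => ENNReal.ofReal (D * m ^ (1 + 2 * θ))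
            * ENNReal.ofReal (l ^ (q - 2 - 3 * θ))) l :=
        mul_le_mul' le_rfl (setLIntegral_mono' measurableSet_Ioi hlev)
    _ = ENNReal.ofReal q * (ENNReal.ofReal (D * m ^ (1 + 2 * θ))
          * ENNReal.ofReal (q - 2 - 3 * θ + 1)⁻¹) := by
        rw [lintegral_indicator measurableSet_Iic, Measure.restrict_restrict measurableSet_Iic,
          Set.inter_comm, Set.Ioi_inter_Iic, lintegral_const_mul' _ _ ENNReal.ofReal_ne_top,
          lintegral_Ioc_rpow hs]
    _ = _ := by
        rw [← ENNReal.ofReal_mul (by positivity), ← ENNReal.ofReal_mul (by linarith)]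
        congr 1; ring

/-- Taking `θ = (qa - 1)/2` turns the exponent `1 + 2θ` into `qa`, and `0 < θ < 1` into `1 < qa <
3`. -/
lemma exists_lintegral_avg_indicator_le {t : ℝ} (ht : t ≠ 0) {q a : ℝ} (hq : 4 ≤ q)
    (ha1 : 1 < q * a) (ha3 : q * a < 3) : ∃ K : ℝ, 0 ≤ K ∧ ∀ E : Set R3, MeasurableSet E →
      volume E ≠ ⊤ →
      (∫⁻ x, avg t (E.indicator 1) x ^ q) ^ q⁻¹ ≤ ENNReal.ofReal (K * volume.real E ^ a) := by
  obtain ⟨K, hK0, hK⟩ := exists_lintegral_avg_indicator_rpow_le ht (θ := (q * a - 1) / 2) hq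
    (by linarith) (by linarith)
  have hq0 : 0 < q := by linarith
  refine ⟨K ^ q⁻¹, by positivity, fun E hE hEf => ?_⟩
  refine (ENNReal.rpow_le_rpow (hK E hE hEf) (by positivity)).trans_eq ?_
  have hm : 0 ≤ volume.real E := measureReal_nonneg
  rw [ENNReal.ofReal_rpow_of_nonneg (by positivity) (by positivity),
    Real.mul_rpow hK0 (by positivity), ← Real.rpow_mul hm]
  congr 3
  field_simp
  ring

/-- Minkowski for finite sums, then monotone convergence along finite subsets. -/
lemma lintegral_tsum_rpow_le {α ι : Type*} [MeasurableSpace α] [Countable ι] {μ : Measure α}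
    {q : ℝ} (hq : 1 ≤ q) {g : ι → α → ℝ≥0∞} (hg : ∀ i, Measurable (g i)) :
    (∫⁻ x, (∑' i, g i x) ^ q ∂μ) ^ q⁻¹ ≤ ∑' i, (∫⁻ x, g i x ^ q ∂μ) ^ q⁻¹ := by
  have hq0 : 0 < q := by linarith
  have h1 : ∀ x, (∑' i, g i x) ^ q = ⨆ s : Finset ι, (∑ i ∈ s, g i x) ^ q := fun x => by
    rw [ENNReal.tsum_eq_iSup_sum]
    exact (ENNReal.orderIsoRpow q hq0).map_iSup _
  have hm : ∀ s : Finset ι, Measurable fun x => (∑ i ∈ s, g i x) ^ q := fun s =>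
    (Finset.measurable_fun_sum s fun i _ => hg i).pow_const q
  have hdir : Directed (· ≤ ·) fun (s : Finset ι) x => (∑ i ∈ s, g i x) ^ q := by
    refine Monotone.directed_le fun s s' h x => ?_
    exact ENNReal.rpow_le_rpow (Finset.sum_le_sum_of_subset h) hq0.le
  simp_rw [h1]
  rw [lintegral_iSup_directed (fun s => (hm s).aemeasurable) hdir]
  have h2 : (⨆ s : Finset ι, ∫⁻ x, (∑ i ∈ s, g i x) ^ q ∂μ) ^ q⁻¹
      = ⨆ s : Finset ι, (∫⁻ x, (∑ i ∈ s, g i x) ^ q ∂μ) ^ q⁻¹ :=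
    (ENNReal.orderIsoRpow q⁻¹ (by positivity)).map_iSup _
  rw [h2]
  refine iSup_le fun s => le_trans ?_ (ENNReal.sum_le_tsum s)
  have := eLpNorm'_sum_le (μ := μ) (f := g) (s := s) (fun i _ => (hg i).aestronglyMeasurable) hq
  simpa [eLpNorm', Finset.sum_apply] using this

lemma tsum_ofReal_two_rpow_neg_abs_ne_top {ε : ℝ} (hε : 0 < ε) :
    ∑' k : ℤ, ENNReal.ofReal ((2 : ℝ) ^ (-(ε * |(k : ℝ)|))) ≠ ⊤ := by
  refine Summable.tsum_ofReal_ne_top ?_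
  have hr : (2 : ℝ) ^ (-ε) < 1 := Real.rpow_lt_one_of_one_lt_of_neg one_lt_two (by linarith)
  have hg := summable_geometric_of_lt_one (r := (2 : ℝ) ^ (-ε)) (by positivity) hr
  have h : ∀ n : ℕ, ((2 : ℝ) ^ (-ε)) ^ n = (2 : ℝ) ^ (-(ε * (n : ℝ))) := fun n => by
    rw [← Real.rpow_natCast, ← Real.rpow_mul (by norm_num)]
    congr 1; ring
  simp_rw [h] at hg
  refine Summable.of_nat_of_neg ?_ ?_
  · simpa using hg
  · simpa using hg

lemma le_tsum_dyadic_indicator {a : ℝ≥0∞} (ha : a ≠ ⊤) :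
    a ≤ ∑' k : ℤ, (2 : ℝ≥0∞) ^ (k + 1)
      * (Set.Ico ((2 : ℝ≥0∞) ^ k) ((2 : ℝ≥0∞) ^ (k + 1))).indicator 1 a := by
  rcases eq_or_ne a 0 with rfl | h0
  · exact zero_le
  obtain ⟨k, hk⟩ := ENNReal.exists_mem_Ico_zpow h0 ha ENNReal.one_lt_two ENNReal.ofNat_ne_top
  refine le_trans ?_ (ENNReal.le_tsum k)
  rw [Set.indicator_of_mem hk, Pi.one_apply, mul_one]
  exact hk.2.le

lemma two_zpow_eq_ofReal (k : ℤ) : (2 : ℝ≥0∞) ^ k = ENNReal.ofReal ((2 : ℝ) ^ (k : ℝ)) := by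
  rw [← ENNReal.rpow_intCast, ← ENNReal.ofReal_rpow_of_pos two_pos]
  simp

/-- Spherical averages map the unit ball of `L^p` into a ball of `L^q`. -/
lemma exists_lintegral_avg_rpow_le {t : ℝ} (ht : t ≠ 0) {p q : ℝ} (hq : 4 ≤ q) (hp : 0 < p)
    (hpq : p < q) (hqp : q < 3 * p) : ∃ K : ℝ≥0∞, K ≠ ⊤ ∧ ∀ F : R3 → ℝ≥0∞, Measurable F →
      (∀ x, F x ≠ ⊤) → ∫⁻ x, F x ^ p ≤ 1 → (∫⁻ x, avg t F x ^ q) ^ q⁻¹ ≤ K := by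
  have hq0 : 0 < q := by linarith
  -- The two exponents are the midpoints of `1/q, 1/p` and of `3/q, 1/p`, so `1/q < a₁ < 1/p < a₂ <
  -- 3/q`. They lie on opposite sides of `1/p`, and the dyadic pieces then decay in both directions.
  obtain ⟨K₁, hK₁, h₁⟩ := exists_lintegral_avg_indicator_le ht (a := (1 / q + 1 / p) / 2) hq
    (by field_simp; linarith) (by field_simp; linarith)
  obtain ⟨K₂, hK₂, h₂⟩ := exists_lintegral_avg_indicator_le ht (a := (3 / q + 1 / p) / 2) hq
    (by field_simp; linarith) (by field_simp; linarith)
  set a₁ : ℝ := (1 / q + 1 / p) / 2 with ha₁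
  set a₂ : ℝ := (3 / q + 1 / p) / 2 with ha₂
  have hpa₁ : 0 < 1 - p * a₁ := by rw [ha₁]; field_simp; linarith
  have hpa₂ : 0 < p * a₂ - 1 := by rw [ha₂]; field_simp; linarith
  have ha₁0 : 0 < a₁ := by positivity
  have ha₂0 : 0 < a₂ := by positivity
  set ε : ℝ := min (1 - p * a₁) (p * a₂ - 1) with hε
  have hε0 : 0 < ε := lt_min hpa₁ hpa₂
  set K : ℝ := max K₁ K₂ with hK
  have hK0 : 0 ≤ K := hK₁.trans (le_max_left _ _)
  refine ⟨∑' k : ℤ, ENNReal.ofReal (2 * K) * ENNReal.ofReal ((2 : ℝ) ^ (-(ε * |(k : ℝ)|))), ?_,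
    fun F hF hFt hF1 => ?_⟩
  · rw [ENNReal.tsum_mul_left]
    exact ENNReal.mul_ne_top ENNReal.ofReal_ne_top (tsum_ofReal_two_rpow_neg_abs_ne_top hε0)
  set E : ℤ → Set R3 := fun k => F ⁻¹' Set.Ico ((2 : ℝ≥0∞) ^ k) ((2 : ℝ≥0∞) ^ (k + 1)) with hEdef
  have hE : ∀ k, MeasurableSet (E k) := fun k => hF measurableSet_Ico
  have hvol : ∀ k, volume (E k) ≤ ENNReal.ofReal ((2 : ℝ) ^ (-(k * p))) := by
    intro k
    have h1 := (mul_meas_ge_le_lintegral (μ := (volume : Measure R3)) (hF.pow_const p)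
      (((2 : ℝ≥0∞) ^ k) ^ p)).trans hF1
    have h2 : volume (E k) ≤ volume {x | ((2 : ℝ≥0∞) ^ k) ^ p ≤ F x ^ p} :=
      measure_mono fun x hx => ENNReal.rpow_le_rpow hx.1 hp.le
    have h3 : ((2 : ℝ≥0∞) ^ k) ^ p = ENNReal.ofReal ((2 : ℝ) ^ (k * p)) := by
      rw [two_zpow_eq_ofReal, ENNReal.ofReal_rpow_of_pos (by positivity),
        ← Real.rpow_mul zero_le_two]
    have h4 := (mul_le_mul' le_rfl h2).trans h1
    rw [h3, mul_comm] at h4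
    have h5 : (0 : ℝ) < (2 : ℝ) ^ (k * p) := by positivity
    rw [Real.rpow_neg zero_le_two, ENNReal.ofReal_inv_of_pos h5]
    rw [← one_div]
    exact (ENNReal.le_div_iff_mul_le (Or.inl (by simpa using h5)) (Or.inl ENNReal.ofReal_ne_top)).2 h4
  have hvt : ∀ k, volume (E k) ≠ ⊤ := fun k => ne_top_of_le_ne_top ENNReal.ofReal_ne_top (hvol k)
  have hvr : ∀ k, volume.real (E k) ≤ (2 : ℝ) ^ (-(k * p)) := fun k =>
    ENNReal.toReal_le_of_le_ofReal (by positivity) (hvol k)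
  have hpiece : ∀ k : ℤ, (2 : ℝ≥0∞) ^ (k + 1) * (∫⁻ x, avg t ((E k).indicator 1) x ^ q) ^ q⁻¹
      ≤ ENNReal.ofReal (2 * K) * ENNReal.ofReal ((2 : ℝ) ^ (-(ε * |(k : ℝ)|))) := by
    intro k
    -- Since `|E k| ≤ 2^(-kp)`, the piece of height `2^k` is of size `2^(k(1 - pa))`: `a₂` is used
    -- for `k ≥ 0` and `a₁` for `k ≤ 0`.
    have key : ∀ (a K' : ℝ), 0 ≤ a → 0 ≤ K' → K' ≤ K → k * (1 - p * a) ≤ -(ε * |(k : ℝ)|) →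
        (∫⁻ x, avg t ((E k).indicator 1) x ^ q) ^ q⁻¹
          ≤ ENNReal.ofReal (K' * volume.real (E k) ^ a) →
        (2 : ℝ≥0∞) ^ (k + 1) * (∫⁻ x, avg t ((E k).indicator 1) x ^ q) ^ q⁻¹
          ≤ ENNReal.ofReal (2 * K) * ENNReal.ofReal ((2 : ℝ) ^ (-(ε * |(k : ℝ)|))) := by
      intro a K' ha hK' hK'K hexp hb
      refine (mul_le_mul' le_rfl hb).trans ?_
      rw [two_zpow_eq_ofReal, ← ENNReal.ofReal_mul (by positivity),
        ← ENNReal.ofReal_mul (by positivity)]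
      refine ENNReal.ofReal_le_ofReal ?_
      calc (2 : ℝ) ^ ((k + 1 : ℤ) : ℝ) * (K' * volume.real (E k) ^ a)
          ≤ (2 : ℝ) ^ ((k + 1 : ℤ) : ℝ) * (K * ((2 : ℝ) ^ (-(k * p))) ^ a) := by
            have := Real.rpow_le_rpow measureReal_nonneg (hvr k) ha
            gcongr
        _ = 2 * K * (2 : ℝ) ^ (k * (1 - p * a)) := by
            have e : (k : ℝ) * (1 - p * a) = k + -(k * p) * a := by ring
            rw [← Real.rpow_mul zero_le_two, Int.cast_add, Int.cast_one, e,
              Real.rpow_add two_pos, Real.rpow_add two_pos, Real.rpow_one]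
            ring
        _ ≤ _ := by
            refine mul_le_mul_of_nonneg_left ?_ (by positivity)
            exact Real.rpow_le_rpow_of_exponent_le one_le_two hexp
    rcases le_total (0 : ℝ) k with hk | hk
    · refine key a₂ K₂ ha₂0.le hK₂ (le_max_right _ _) ?_ (h₂ (E k) (hE k) (hvt k))
      rw [abs_of_nonneg hk]
      nlinarith [min_le_right (1 - p * a₁) (p * a₂ - 1)]
    · refine key a₁ K₁ ha₁0.le hK₁ (le_max_left _ _) ?_ (h₁ (E k) (hE k) (hvt k))
      rw [abs_of_nonpos hk]
      nlinarith [min_le_left (1 - p * a₁) (p * a₂ - 1)]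
  have hi : ∀ k, Measurable ((E k).indicator (1 : R3 → ℝ≥0∞)) := fun k =>
    measurable_one.indicator (hE k)
  have havg : ∀ x, avg t F x ≤ ∑' k : ℤ, (2 : ℝ≥0∞) ^ (k + 1) * avg t ((E k).indicator 1) x := by
    intro x
    calc avg t F x ≤ ∫⁻ θ, ∑' k : ℤ, (2 : ℝ≥0∞) ^ (k + 1)
          * (E k).indicator 1 (x + t • θ) ∂sph := lintegral_mono fun θ =>
          le_tsum_dyadic_indicator (hFt (x + t • θ))
      _ = ∑' k : ℤ, ∫⁻ θ, (2 : ℝ≥0∞) ^ (k + 1) * (E k).indicator 1 (x + t • θ) ∂sph :=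
          lintegral_tsum fun k =>
            (measurable_const.mul ((hi k).comp (by fun_prop))).aemeasurable
      _ = _ := by
          refine tsum_congr fun k => ?_
          exact lintegral_const_mul _ ((hi k).comp (by fun_prop))
  calc (∫⁻ x, avg t F x ^ q) ^ q⁻¹
      ≤ (∫⁻ x, (∑' k : ℤ, (2 : ℝ≥0∞) ^ (k + 1) * avg t ((E k).indicator 1) x) ^ q) ^ q⁻¹ :=
        ENNReal.rpow_le_rpow (lintegral_mono fun x => ENNReal.rpow_le_rpow (havg x) hq0.le)
          (by positivity)
    _ ≤ ∑' k : ℤ, (∫⁻ x, ((2 : ℝ≥0∞) ^ (k + 1) * avg t ((E k).indicator 1) x) ^ q) ^ q⁻¹ :=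
        lintegral_tsum_rpow_le (by linarith) fun k =>
          measurable_const.mul (measurable_avg t (hi k))
    _ = ∑' k : ℤ, (2 : ℝ≥0∞) ^ (k + 1) * (∫⁻ x, avg t ((E k).indicator 1) x ^ q) ^ q⁻¹ := by
        refine tsum_congr fun k => ?_
        simp_rw [ENNReal.mul_rpow_of_nonneg _ _ hq0.le]
        rw [lintegral_const_mul _ ((measurable_avg t (hi k)).pow_const q),
          ENNReal.mul_rpow_of_nonneg _ _ (by positivity), ← ENNReal.rpow_mul,
          mul_inv_cancel₀ hq0.ne', ENNReal.rpow_one]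
    _ ≤ _ := ENNReal.tsum_le_tsum hpiece

lemma avg_const_mul (t : ℝ) (c : ℝ≥0∞) {F : R3 → ℝ≥0∞} (hF : Measurable F) (x : R3) :
    avg t (fun y => c * F y) x = c * avg t F x :=
  lintegral_const_mul _ (by fun_prop)

/-- `L^p → L^q` bound for the wave propagator at a fixed time. -/
lemma exists_eLpNorm_wave_le (t : ℝ) {p q : ℝ} (hq : 4 ≤ q) (hp : 1 ≤ p)
    (hpq : p < q) (hqp : q < 3 * p) : ∃ K : ℝ≥0, ∀ f : R3 → ℂ, StronglyMeasurable f →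
      MemLp f (ENNReal.ofReal p) volume →
      eLpNorm (wave t f) (ENNReal.ofReal q) volume ≤ K * eLpNorm f (ENNReal.ofReal p) volume := by
  have hp0 : 0 < p := by linarith
  have hq0 : 0 < q := by linarith
  rcases eq_or_ne t 0 with rfl | ht
  · refine ⟨0, fun f _ _ => ?_⟩
    have : wave 0 f = 0 := by ext x; simp [wave]
    rw [this]
    simp
  obtain ⟨K, hKt, hK⟩ := exists_lintegral_avg_rpow_le ht hq hp0 hpq hqp
  refine ⟨(ENNReal.ofReal |t| * K).toNNReal, fun f hfm hf => ?_⟩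
  rw [ENNReal.coe_toNNReal (by finiteness)]
  have hbound := eLpNorm_wave_le t hfm hp
  set S := eLpNorm f (ENNReal.ofReal p) volume with hS
  -- Data of zero norm cannot be normalised; they are disposed of by the `L^p → L^p` bound.
  rcases eq_or_ne S 0 with h0 | h0
  · rw [h0, mul_zero, nonpos_iff_eq_zero] at hbound
    rw [h0, mul_zero, nonpos_iff_eq_zero]
    have h1 := (eLpNorm_eq_zero_iff (stronglyMeasurable_wave t hfm).aestronglyMeasurable
      (by simpa using hp0)).1 hbound
    rw [eLpNorm_congr_ae h1]
    simp
  have hSt : S ≠ ⊤ := hf.2.ne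
  have hSp : S ^ p = ∫⁻ x, ‖f x‖ₑ ^ p := by
    rw [hS, eLpNorm_eq_lintegral_ofReal _ hp0, ← ENNReal.rpow_mul, inv_mul_cancel₀ hp0.ne',
      ENNReal.rpow_one]
  have hmf : Measurable fun y => ‖f y‖ₑ := hfm.enorm
  have h1 := hK (fun y => S⁻¹ * ‖f y‖ₑ) (measurable_const.mul hmf)
    (fun x => ENNReal.mul_ne_top (ENNReal.inv_ne_top.2 h0) enorm_ne_top) (by
      simp_rw [ENNReal.mul_rpow_of_nonneg _ _ hp0.le]
      rw [lintegral_const_mul _ (hmf.pow_const p), ← hSp, ← ENNReal.mul_rpow_of_nonneg _ _ hp0.le,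
        ENNReal.inv_mul_cancel h0 hSt, ENNReal.one_rpow])
  simp_rw [avg_const_mul t _ hmf, ENNReal.mul_rpow_of_nonneg _ _ hq0.le] at h1
  rw [lintegral_const_mul _ ((measurable_avg t hmf).pow_const q),
    ENNReal.mul_rpow_of_nonneg _ _ (by positivity), ← ENNReal.rpow_mul,
    mul_inv_cancel₀ hq0.ne', ENNReal.rpow_one, mul_comm, ← div_eq_mul_inv,
    ENNReal.div_le_iff h0 hSt] at h1
  rw [eLpNorm_eq_lintegral_ofReal _ hq0]
  calc (∫⁻ x, ‖wave t f x‖ₑ ^ q) ^ q⁻¹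
      ≤ (∫⁻ x, (ENNReal.ofReal |t| * avg t (fun y => ‖f y‖ₑ) x) ^ q) ^ q⁻¹ :=
        ENNReal.rpow_le_rpow (lintegral_mono fun x =>
          ENNReal.rpow_le_rpow (enorm_wave_le t f x) hq0.le) (by positivity)
    _ = ENNReal.ofReal |t| * (∫⁻ x, avg t (fun y => ‖f y‖ₑ) x ^ q) ^ q⁻¹ := by
        simp_rw [ENNReal.mul_rpow_of_nonneg _ _ hq0.le]
        rw [lintegral_const_mul _ ((measurable_avg t hmf).pow_const q),
          ENNReal.mul_rpow_of_nonneg _ _ (by positivity), ← ENNReal.rpow_mul,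
          mul_inv_cancel₀ hq0.ne', ENNReal.rpow_one]
    _ ≤ ENNReal.ofReal |t| * (K * S) := mul_le_mul' le_rfl h1
    _ = _ := (mul_assoc _ _ _).symm

/-- Hölder with two exponents `2r`, where `r = p'`. Then `2r < 3p` is equivalent to `p > 5/3`, and
`p ≤ 2` gives `r ≥ 2`, hence `2r ≥ 4`. -/
theorem bilinear_dual_exponent_bound :
    ∀ p : ℝ, 5 / 3 < p → p ≤ 2 → ∀ t : ℝ, ∃ Cpt : ℝ≥0,
      ∀ (f g : R3 → ℂ) (u v : ℝ → R3 → ℂ),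
        MemLp f (ENNReal.ofReal p) volume → MemLp g (ENNReal.ofReal p) volume →
        IsWaveSolution f u → IsWaveSolution g v →
          eLpNorm (fun x => u t x * v t x) (ENNReal.ofReal (p / (p - 1))) volume
            ≤ Cpt * (eLpNorm f (ENNReal.ofReal p) volume
                * eLpNorm g (ENNReal.ofReal p) volume) := by
  intro p hp1 hp2 t
  have hp0 : 0 < p - 1 := by linarith
  set r : ℝ := p / (p - 1) with hr
  have hr2 : 2 ≤ r := by rw [hr, le_div_iff₀ hp0]; linarith
  have hr0 : 0 < r := by linarith
  obtain ⟨K, hK⟩ := exists_eLpNorm_wave_le t (p := p) (q := 2 * r) (by linarith) (by linarith)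
    (by linarith) (by rw [hr, mul_div_assoc', div_lt_iff₀ hp0]; nlinarith)
  refine ⟨K * K, fun f g u v hf hg hu hv => ?_⟩
  have hW : ∀ {f : R3 → ℂ} {u : ℝ → R3 → ℂ}, MemLp f (ENNReal.ofReal p) volume →
      IsWaveSolution f u → AEStronglyMeasurable (u t) volume ∧
      eLpNorm (u t) (ENNReal.ofReal (2 * r)) volume ≤ K * eLpNorm f (ENNReal.ofReal p) volume := by
    intro f u hf hu
    have hff : f =ᵐ[volume] hf.1.mk f := hf.1.ae_eq_mk
    have hfm : StronglyMeasurable (hf.1.mk f) := hf.1.stronglyMeasurable_mk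
    have hf' : MemLp (hf.1.mk f) (ENNReal.ofReal p) volume := (memLp_congr_ae hff).1 hf
    have eu := (hu.congr_data hff).ae_eq_wave hfm (by linarith) hf' t
    refine ⟨(hu.locallyIntegrable t).aestronglyMeasurable, ?_⟩
    have h := hK _ hfm hf'
    rwa [← eLpNorm_congr_ae eu, ← eLpNorm_congr_ae hff] at h
  obtain ⟨mu, hu'⟩ := hW hf hu
  obtain ⟨mv, hv'⟩ := hW hg hv
  have hT : ENNReal.HolderTriple (ENNReal.ofReal (2 * r)) (ENNReal.ofReal (2 * r))
      (ENNReal.ofReal r) := by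
    refine ⟨?_⟩
    rw [← ENNReal.ofReal_inv_of_pos (by positivity), ← ENNReal.ofReal_inv_of_pos hr0,
      ← ENNReal.ofReal_add (by positivity) (by positivity)]
    congr 1
    field_simp
    norm_num
  have h := eLpNorm_smul_le_mul_eLpNorm (p := ENNReal.ofReal (2 * r)) (q := ENNReal.ofReal (2 * r))
    (r := ENNReal.ofReal r) mv mu
  refine le_trans h ((mul_le_mul' hu' hv').trans_eq ?_)
  push_cast
  ring
theorem theorem4p7 :
    (∃ C C' : ℝ≥0, ∀ (t : ℝ) (f g : R3 → ℂ) (u v : ℝ → R3 → ℂ),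
      MemLp f 2 volume → MemLp g 2 volume → IsWaveSolution f u → IsWaveSolution g v →
        eLpNorm (fun x => u t x * v t x) 3 volume
            ≤ C * sobolevNorm (1 / 2) (fun x => u t x * v t x) ∧
        sobolevNorm (1 / 2) (fun x => u t x * v t x)
            ≤ C' * ENNReal.ofReal (√(1 + |t|)) * (eLpNorm f 2 volume * eLpNorm g 2 volume) ∧
        eLpNorm (fun x => u t x * v t x) 3 volume
            ≤ C' * (eLpNorm f 2 volume * eLpNorm g 2 volume)) ∧
    (∀ p : ℝ, 5 / 3 < p → p ≤ 2 → ∀ t : ℝ, ∃ Cpt : ℝ≥0,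
      ∀ (f g : R3 → ℂ) (u v : ℝ → R3 → ℂ),
        MemLp f (ENNReal.ofReal p) volume → MemLp g (ENNReal.ofReal p) volume →
        IsWaveSolution f u → IsWaveSolution g v →
          eLpNorm (fun x => u t x * v t x) (ENNReal.ofReal (p / (p - 1))) volume
            ≤ Cpt * (eLpNorm f (ENNReal.ofReal p) volume
                * eLpNorm g (ENNReal.ofReal p) volume)) := by
  exact ⟨bilinear_sobolev_bound, bilinear_dual_exponent_bound⟩
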